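/- Let $d,n\ge 1$ and $\alpha\in\mathbb R$. Let $\mathcal H_\alpha$ be the Hilbert space of pairs $Y=(Y^0,Y^1)=(u,v)$ of functions $u,v:\mathbb Z^d\to\mathbb R^n$ with $$\|Y\|_\alpha^2=\sum_{x\in\mathbb Z^d}\big(|u(x)|^2+|v(x)|^2\big)(1+|x|^2)^\alpha<\infty .$$ Functions on $\mathbb T^d=\mathbb R^d/2\pi\mathbb Z^d$ are regarded as $2\pi$-periodic functions on $\mathbb R^d$, and $\hat f(\theta)=\sum_{z\in\mathbb Z^d}f(z)e^{iz\cdot\theta}$. **Interaction.** Let $V(z)=(V_{kl}(z))_{k,l=1}^n$, $z\in\mathbb Z^d$, be real matrices such that * (E1) $|V_{kl}(z)|\le Ce^{-a|z|}$ for some constants $C,a>0$; * (E2) $V_{lk}(-z)=V_{kl}(z)$; * (E3) $\hat V(\theta)$ is nonnegative definite for every $\theta$. Put $\Omega(\theta)=\hat V(\theta)^{1/2}\ge 0$. A *local system of dispersion relations* consists of a nonempty connected open set $O\subset\mathbb R^d$ and real-analytic functions $\omega_1,\dots,\omega_n:O\to\mathbb R$ such that $\omega_1(\theta),\dots,\omega_n(\theta)$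 are the eigenvalues of $\Omega(\theta)$, counted with multiplicity, for each $\theta\in O$. Assume that for every such system * (E4) for each $k$, $\det\big(\partial^2\omega_k/\partial\theta_i\partial\theta_j\big)_{i,j=1}^d$ does not vanish identically on $O$; * (E5) for $k\neq l$, neither $\omega_k-\omega_l$ nor $\omega_k+\omega_l$ is identically equal on $O$ to a nonzero constant. **Dynamics.** For $Y_0\in\mathcal H_\alpha$ let $U(t)Y_0=(u(\cdot,t),v(\cdot,t))$ be the solution in $C(\mathbb R,\mathcal H_\alpha)$ of $$\dot u(x,t)=v(x,t),\qquad \dot v(x,t)=-\sum_{y\in\mathbb Z^d}V(x-y)u(y,t),\qquad U(0)Y_0=Y_0 .$$ **Initial measure.** Let $\mu_0$ be a Borel probability measure on $\mathcal H_\alpha$, with expectation $E$, such that * (S0) $E\,Y(x)=0$ for all $x$; * (S1) $E\big(Y^i(x)\otimes Y^j(y)\big)=q_0^{ij}(x-y)$ depends only on $x-y$, for $i,j=0,1$; * (S2) $E\big(|Y^0(x)|^2+|Y^1(x)|^2\big)<\infty$; * (S3) with $\sigma(S)$ the $\sigma$-algebra generated by the $Y(x)$, $x\in S$, the mixing coefficient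 $$\varphi(r)=\sup\Big\{\frac{|\mu_0(A\cap B)-\mu_0(A)\mu_0(B)|}{\mu_0(B)}:\ A\in\sigma(S),\ B\in\sigma(T),\ \mu_0(B)>0,\ S,T\subset\mathbb Z^d,\ \operatorname{dist}(S,T)\ge r\Big\}$$ satisfies $\varphi(r)\to0$ as $r\to\infty$ and $\int_0^\infty r^{d-1}\varphi^{1/2}(r)\,dr<\infty$; * (ES) if $\det\hat V(\theta)=0$ for some $\theta$, then $\|\Omega^{-i}\hat q_0^{ij}\Omega^{-j}\|\in L^1(\mathbb T^d)$ for $i,j=0,1$. **Limit.** For almost every $\theta$ put $$M_0=\frac12\begin{pmatrix}\hat q_0^{00}+\Omega^{-1}\hat q_0^{11}\Omega^{-1}&\hat q_0^{01}-\Omega^{-1}\hat q_0^{10}\Omega\\ \hat q_0^{10}-\Omega\hat q_0^{01}\Omega^{-1}&\hat q_0^{11}+\Omega\hat q_0^{00}\Omega\end{pmatrix},\qquad \hat q_\infty^{ij}(\theta)=\sum_\sigma\Pi_\sigma(\theta)M_0^{ij}(\theta)\Pi_\sigma(\theta),$$ where $\Pi_\sigma(\theta)$ are the orthogonal projections onto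 the eigenspaces of $\Omega(\theta)$ for its distinct eigenvalues, and $$q_\infty^{ij}(z)=(2\pi)^{-d}\int_{\mathbb T^d}e^{-iz\cdot\theta}\,\hat q_\infty^{ij}(\theta)\,d\theta .$$ **Conclusion.** Let $\mu_t$ be the distribution of $U(t)Y_0$ when $Y_0$ has distribution $\mu_0$. For all $t\in\mathbb R$ the correlation matrices $\int Y^i(x)\otimes Y^j(y)\,\mu_t(dY)$, $i,j=0,1$, are finite and depend only on $x-y$; denote them by $q_t^{ij}(x-y)$. Then 1. $\displaystyle\sup_{t\ge0}\sup_{z\in\mathbb Z^d}|q_t^{ij}(z)|<\infty$ for $i,j=0,1$; 2. the entries of $\hat q_\infty^{ij}$ belong to $L^1(\mathbb T^d)$, and $q_t^{ij}(z)\to q_\infty^{ij}(z)$ as $t\to\infty$ for each $z\in\mathbb Z^d$ and $i,j=0,1$. -/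

import Mathlib

open MeasureTheory Filter Topology

noncomputable section

namespace HarmonicCrystal

/-! ### Lattice and phase space -/

/-- The lattice `ℤ^d`. -/
abbrev Site (d : ℕ) := Fin d → ℤ

/-- The values `(u(x), v(x)) ∈ ℝ^n × ℝ^n` of a field at a site: the component `(0, k)` is `u_k`,
the component `(1, k)` is `v_k`; the norm is the Euclidean one, `‖(u, v)‖² = |u|² + |v|²`. -/
abbrev State (n : ℕ) := EuclideanSpace ℝ (Fin 2 × Fin n)

/-- The Euclidean length `|z|` of a lattice vector. -/
def latNorm {d : ℕ} (z : Site d) : ℝ := Real.sqrt (∑ i, (z i : ℝ) ^ 2)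

/-- The weight `(1 + |x|²)^(α/2)`. -/
def weight {d : ℕ} (α : ℝ) (x : Site d) : ℝ := (1 + latNorm x ^ 2) ^ (α / 2)

lemma weight_pos {d : ℕ} (α : ℝ) (x : Site d) : 0 < weight α x :=
  Real.rpow_pos_of_pos (by positivity) _

lemma weight_sq {d : ℕ} (α : ℝ) (x : Site d) :
    weight α x ^ 2 = (1 + latNorm x ^ 2) ^ α := by
  have h : (0 : ℝ) ≤ 1 + latNorm x ^ 2 := by positivity
  rw [weight, ← Real.rpow_natCast, ← Real.rpow_mul h]
  congr 1
  push_cast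
  ring

/-- The fields `Y` with `∑ₓ (|u(x)|² + |v(x)|²) (1 + |x|²)^α < ∞`. -/
def phaseSubmodule (d n : ℕ) (α : ℝ) : Submodule ℝ (Site d → State n) where
  carrier := {Y | Memℓp (fun x => weight α x • Y x) 2}
  zero_mem' := by
    have h : (fun x : Site d => weight α x • (0 : Site d → State n) x) = 0 := by
      funext x; simp
    simp only [Set.mem_ofPred_eq, h]
    exact zero_memℓp
  add_mem' := by
    intro Y Z hY hZ
    have h : (fun x : Site d => weight α x • (Y + Z) x)
        = (fun x => weight α x • Y x) + fun x => weight α x • Z x := by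
      funext x; simp
    simp only [Set.mem_ofPred_eq, h]
    exact hY.add hZ
  smul_mem' := by
    intro c Y hY
    have h : (fun x : Site d => weight α x • (c • Y) x)
        = c • fun x => weight α x • Y x := by
      funext x; simp [smul_comm c]
    simp only [Set.mem_ofPred_eq, h]
    exact hY.const_smul c

/-- The phase space `H_α`, normed by `‖Y‖_α² = ∑ₓ (|u(x)|² + |v(x)|²) (1 + |x|²)^α`
(see `norm_sq_eq`). -/
def PhaseSpace (d n : ℕ) (α : ℝ) : Type := phaseSubmodule d n α

variable {d n : ℕ} {α : ℝ}

instance : AddCommGroup (PhaseSpace d n α) :=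
  inferInstanceAs (AddCommGroup (phaseSubmodule d n α))

instance : Module ℝ (PhaseSpace d n α) :=
  inferInstanceAs (Module ℝ (phaseSubmodule d n α))

/-- An element of `H_α` is used as a function on the lattice. -/
instance : CoeFun (PhaseSpace d n α) (fun _ => Site d → State n) := ⟨fun Y => Y.1⟩

/-- Multiplication by the weight, as a map from `H_α` to `ℓ²`. -/
def toL2 (d n : ℕ) (α : ℝ) :
    PhaseSpace d n α →ₗ[ℝ] lp (fun _ : Site d => State n) 2 where
  toFun Y := ⟨fun x => weight α x • Y x, Y.2⟩
  map_add' Y Z := by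
    ext x : 2
    exact smul_add _ _ _
  map_smul' c Y := by
    ext x : 2
    exact smul_comm (weight α x) c (Y x)

lemma toL2_injective : Function.Injective (toL2 d n α) := by
  intro Y Z h
  apply Subtype.ext
  funext x
  have hx : weight α x • Y x = weight α x • Z x := congrArg (fun f => f x) h
  exact smul_right_injective _ (weight_pos α x).ne' hx

instance : NormedAddCommGroup (PhaseSpace d n α) :=
  NormedAddCommGroup.induced _ _ (toL2 d n α) toL2_injective

instance : NormedSpace ℝ (PhaseSpace d n α) :=
  NormedSpace.induced ℝ _ _ (toL2 d n α)

lemma norm_sq_eq (Y : PhaseSpace d n α) :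
    ‖Y‖ ^ 2 = ∑' x, ‖Y x‖ ^ 2 * (1 + latNorm x ^ 2) ^ α := by
  have h := lp.norm_rpow_eq_tsum (p := 2) (by norm_num) (toL2 d n α Y)
  have h' : ‖toL2 d n α Y‖ = ‖Y‖ := rfl
  rw [h'] at h
  simp only [ENNReal.toReal_ofNat, Real.rpow_ofNat] at h
  rw [h]
  refine tsum_congr fun x => ?_
  change ‖weight α x • Y x‖ ^ 2 = _
  rw [norm_smul, mul_pow, ← weight_sq, Real.norm_eq_abs, sq_abs, mul_comm]

/-- `H_α` carries its Borel σ-algebra. -/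
instance : MeasurableSpace (PhaseSpace d n α) := borel _

instance : BorelSpace (PhaseSpace d n α) := ⟨rfl⟩

/-! ### Dynamics -/

/-- The interaction matrices `V(z)`, `z ∈ ℤ^d`, with real entries. -/
abbrev Interaction (d n : ℕ) := Site d → Matrix (Fin n) (Fin n) ℝ

/-- `Y ∈ C(ℝ, H_α)` solves the Cauchy problem `u' = v`, `v'(x,t) = - ∑_y V(x - y) u(y,t)`,
`Y(0) = Y₀`. -/
structure IsSolution (V : Interaction d n) (Y₀ : PhaseSpace d n α)
    (Y : ℝ → PhaseSpace d n α) : Prop where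
  continuous : Continuous Y
  initial : Y 0 = Y₀
  deriv_u : ∀ t x k, HasDerivAt (fun s => Y s x (0, k)) (Y t x (1, k)) t
  deriv_v : ∀ t x k, HasDerivAt (fun s => Y s x (1, k))
    (-∑' y, ∑ l, V (x - y) k l * Y t y (0, l)) t

/-- The dynamical group: `U(t) Y₀ = Y(t)`, where `Y` is the solution with initial value `Y₀`
(there is exactly one if `V` decays exponentially). -/
def flow (V : Interaction d n) (t : ℝ) (Y₀ : PhaseSpace d n α) : PhaseSpace d n α :=
  Classical.epsilon (IsSolution V Y₀) t

/-- The distribution `μ_t` of `Y(t) = U(t) Y₀` if `Y₀` has the distribution `μ₀`. -/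
def law (V : Interaction d n) (μ₀ : Measure (PhaseSpace d n α)) (t : ℝ) :
    Measure (PhaseSpace d n α) :=
  μ₀.map (flow V t)

/-- The correlation matrices `Q^{ij}(x, y) = E (Y^i(x) ⊗ Y^j(y))` of a measure. -/
def corr (μ : Measure (PhaseSpace d n α)) (i j : Fin 2) (x y : Site d) :
    Matrix (Fin n) (Fin n) ℝ :=
  Matrix.of fun k l => ∫ Y, Y x (i, k) * Y y (j, l) ∂μ

/-- The correlation matrices `q^{ij}(z)` of a measure with `Q^{ij}(x, y) = q^{ij}(x - y)`. -/
def corrDiff (μ : Measure (PhaseSpace d n α)) (i j : Fin 2) (z : Site d) :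
    Matrix (Fin n) (Fin n) ℝ :=
  corr μ i j z 0

/-! ### Fourier transform and dispersion relations

Functions on the torus `ℝ^d / 2πℤ^d` are `2π`-periodic functions on `ℝ^d`. -/

/-- A fundamental domain of the torus. -/
def cube (d : ℕ) : Set (Fin d → ℝ) := Set.Icc 0 (fun _ => 2 * Real.pi)

/-- The scalar product `z · θ`. -/
def phase (z : Site d) (θ : Fin d → ℝ) : ℝ := ∑ i, (z i : ℝ) * θ i

/-- The Fourier transform `∑_z f(z) e^{i z·θ}` of a matrix function on the lattice. -/
def torusFourier (f : Site d → Matrix (Fin n) (Fin n) ℝ) (θ : Fin d → ℝ) :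
    Matrix (Fin n) (Fin n) ℂ :=
  Matrix.of fun k l => ∑' z, (f z k l : ℂ) * Complex.exp (Complex.I * (phase z θ : ℂ))

/-- The inverse Fourier transform `(2π)^{-d} ∫ e^{-i z·θ} F(θ) dθ` over the torus. -/
def torusFourierInv (F : (Fin d → ℝ) → Matrix (Fin n) (Fin n) ℂ) (z : Site d) :
    Matrix (Fin n) (Fin n) ℂ :=
  Matrix.of fun k l => ((2 * Real.pi : ℝ) ^ d : ℂ)⁻¹ *
    ∫ θ in cube d, Complex.exp (-(Complex.I * (phase z θ : ℂ))) * F θ k l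

/-- `Ω(θ) = V̂(θ)^{1/2}`, the nonnegative square root of the nonnegative Hermitian matrix `V̂(θ)`. -/
def Om (V : Interaction d n) (θ : Fin d → ℝ) : Matrix (Fin n) (Fin n) ℂ :=
  cfc Real.sqrt (torusFourier V θ)

/-- `ω 0, …, ω (n-1)` are real-analytic branches of the dispersion relations on the nonempty
connected open set `O`: at each point they list the eigenvalues of `Ω(θ)` with multiplicity. -/
structure IsLocalDispersion (V : Interaction d n) (O : Set (Fin d → ℝ))
    (ω : Fin n → (Fin d → ℝ) → ℝ) : Prop where
  isOpen : IsOpen O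
  isConnected : IsConnected O
  analytic : ∀ k, AnalyticOnNhd ℝ (ω k) O
  charpoly_eq : ∀ θ ∈ O, (Om V θ).charpoly
    = ∏ k, (Polynomial.X - Polynomial.C (ω k θ : ℂ))

/-- The Hessian matrix `(∂²f / ∂θ_i ∂θ_j)`. -/
def hessian (f : (Fin d → ℝ) → ℝ) (θ : Fin d → ℝ) : Matrix (Fin d) (Fin d) ℝ :=
  Matrix.of fun i j => iteratedFDeriv ℝ 2 f θ ![Pi.single i 1, Pi.single j 1]

/-! ### Conditions on the interaction -/

/-- Exponential decay of the interaction. -/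
def CondE1 (V : Interaction d n) : Prop :=
  ∃ C > 0, ∃ a > 0, ∀ z k l, |V z k l| ≤ C * Real.exp (-a * latNorm z)

/-- Symmetry of the interaction. -/
def CondE2 (V : Interaction d n) : Prop :=
  ∀ z k l, V (-z) l k = V z k l

open scoped ComplexOrder in
/-- `V̂(θ)` is nonnegative definite. -/
def CondE3 (V : Interaction d n) : Prop :=
  ∀ θ, (torusFourier V θ).PosSemidef

/-- The determinant of the Hessian of a dispersion relation does not vanish identically. -/
def CondE4 (V : Interaction d n) : Prop :=
  ∀ O ω, IsLocalDispersion V O ω → ∀ k, ∃ θ ∈ O, (hessian (ω k) θ).det ≠ 0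

/-- `ω_k ± ω_l` with `k ≠ l` is not identically equal to a nonzero constant. -/
def CondE5 (V : Interaction d n) : Prop :=
  ∀ O ω, IsLocalDispersion V O ω → ∀ k l, k ≠ l → ∀ c : ℝ, c ≠ 0 →
    (¬ ∀ θ ∈ O, ω k θ - ω l θ = c) ∧ (¬ ∀ θ ∈ O, ω k θ + ω l θ = c)

/-! ### Conditions on the initial measure -/

/-- The σ-algebra `σ(S)` on `H_α` generated by the `Y(x)` with `x ∈ S`. -/
abbrev sigmaOn (S : Set (Site d)) : MeasurableSpace (PhaseSpace d n α) :=
  ⨆ x ∈ S, MeasurableSpace.comap (fun Y : PhaseSpace d n α => Y x) inferInstance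

/-- The (uniform) Ibragimov-Linnik mixing coefficient `φ(r)`: the supremum of
`|μ(A ∩ B) - μ(A) μ(B)| / μ(B)` over `A ∈ σ(S)`, `B ∈ σ(T)` with `μ(B) > 0` and over sets `S`, `T`
of lattice points at distance at least `r`. (The numbers lie between `0` and `1`.) -/
def mixingCoeff (μ : Measure (PhaseSpace d n α)) (r : ℝ) : ℝ :=
  sSup {c | ∃ S T : Set (Site d), (∀ x ∈ S, ∀ y ∈ T, r ≤ latNorm (x - y)) ∧
    ∃ A B : Set (PhaseSpace d n α),
      MeasurableSet[sigmaOn S] A ∧ MeasurableSet[sigmaOn T] B ∧ 0 < μ.real B ∧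
      c = |μ.real (A ∩ B) - μ.real A * μ.real B| / μ.real B}

/-- Zero mean. -/
def CondS0 (μ : Measure (PhaseSpace d n α)) : Prop :=
  ∀ x p, ∫ Y, Y x p ∂μ = 0

/-- Translation-invariant correlation matrices: `Q^{ij}(x, y)` depends on `x - y` only. -/
def CondS1 (μ : Measure (PhaseSpace d n α)) : Prop :=
  ∀ i j x y, corr μ i j x y = corrDiff μ i j (x - y)

/-- Finite mean energy density: `E (|u(x)|² + |v(x)|²) < ∞`. -/
def CondS2 (μ : Measure (PhaseSpace d n α)) : Prop :=
  ∀ x, Integrable (fun Y : PhaseSpace d n α => ‖Y x‖ ^ 2) μ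

/-- Mixing: `φ(r) → 0` as `r → ∞`, and `∫₀^∞ r^{d-1} φ(r)^{1/2} dr < ∞`. -/
def CondS3 (μ : Measure (PhaseSpace d n α)) : Prop :=
  Tendsto (mixingCoeff μ) atTop (𝓝 0) ∧
    IntegrableOn (fun r : ℝ => r ^ (d - 1) * Real.sqrt (mixingCoeff μ r)) (Set.Ioi 0)

/-- `q̂_0^{ij}(θ)`. -/
def qHat (μ₀ : Measure (PhaseSpace d n α)) (i j : Fin 2) (θ : Fin d → ℝ) :
    Matrix (Fin n) (Fin n) ℂ :=
  torusFourier (corrDiff μ₀ i j) θ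

/-- `Ω^{-i} q̂_0^{ij} Ω^{-j}` is summable over the torus for `i, j = 0, 1`.
(Entrywise, which amounts to the same for any matrix norm; `Ω(θ)` is invertible for almost
all `θ`.) -/
def CondES (V : Interaction d n) (μ₀ : Measure (PhaseSpace d n α)) : Prop :=
  ∀ i j : Fin 2, ∀ k l, IntegrableOn (fun θ =>
    ((Om V θ)⁻¹ ^ (i : ℕ) * qHat μ₀ i j θ * (Om V θ)⁻¹ ^ (j : ℕ)) k l) (cube d)

/-! ### The limit correlations -/

/-- The blocks `M_0^{ij}(θ)`. -/
def M0 (V : Interaction d n) (μ₀ : Measure (PhaseSpace d n α)) (i j : Fin 2)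
    (θ : Fin d → ℝ) : Matrix (Fin n) (Fin n) ℂ :=
  (1 / 2 : ℂ) • (!![
    qHat μ₀ 0 0 θ + (Om V θ)⁻¹ * qHat μ₀ 1 1 θ * (Om V θ)⁻¹,
    qHat μ₀ 0 1 θ - (Om V θ)⁻¹ * qHat μ₀ 1 0 θ * Om V θ;
    qHat μ₀ 1 0 θ - Om V θ * qHat μ₀ 0 1 θ * (Om V θ)⁻¹,
    qHat μ₀ 1 1 θ + Om V θ * qHat μ₀ 0 0 θ * Om V θ] i j)

/-- The orthogonal projection onto the eigenspace of the Hermitian matrix `A` for the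
eigenvalue `a`, as the indicator function of `{a}` applied to `A`. -/
def spectralProj (A : Matrix (Fin n) (Fin n) ℂ) (a : ℝ) : Matrix (Fin n) (Fin n) ℂ :=
  cfc (Set.indicator {a} 1 : ℝ → ℝ) A

/-- `q̂_∞^{ij}(θ) = ∑_σ Π_σ(θ) M_0^{ij}(θ) Π_σ(θ)`, the sum over the distinct eigenvalues
of `Ω(θ)` with their spectral projections `Π_σ(θ)`. -/
def qInfHat (V : Interaction d n) (μ₀ : Measure (PhaseSpace d n α)) (i j : Fin 2)
    (θ : Fin d → ℝ) : Matrix (Fin n) (Fin n) ℂ :=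
  ∑ᶠ a ∈ spectrum ℝ (Om V θ),
    spectralProj (Om V θ) a * M0 V μ₀ i j θ * spectralProj (Om V θ) a

/-- The limit correlation matrices `q_∞^{ij}(z)`. -/
def qInf (V : Interaction d n) (μ₀ : Measure (PhaseSpace d n α)) (i j : Fin 2)
    (z : Site d) : Matrix (Fin n) (Fin n) ℂ :=
  torusFourierInv (qInfHat V μ₀ i j) z

end HarmonicCrystal

end

open HarmonicCrystal

/-!
Let `q̂_t` be the spectral density of `μ_t`, a Hermitian matrix function of size `2n` on the torus.

**The spectral density at time `t`.** The mixing condition and the covariance inequality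
`|Cov(ξ, η)| ≤ 2 √φ ‖ξ‖₂ ‖η‖₂` (`covariance_le_of_mixing`) make the initial correlations summable
(`summable_corrDiff`), so that `q̂_0` is continuous. The dynamics is `exp (t 𝒜)` for a bounded
convolution operator `𝒜` on `H_α` (`flow_eq_evol`). The mean square norm of the initial state is finite
in a larger space `H_β`, where covariances are therefore continuous bilinear functions of the operators
applied to the state. As `𝒜` multiplies the spectral density by its symbol, one gets
`q̂_t = e^{t Â} q̂_0 (e^{t Â})^*` with `Â = (0, 1; -V̂, 0)` (`integrable_and_correlation_eq`).

**Normal modes.** Where `V̂(θ)` is invertible, `e^{t Â} = ∑ e^{i ε ω t} P_{ε, ω}` over the signs `ε` and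
the distinct eigenvalues `ω` of `Ω`, and `q̂_t` is the sum of the terms
`e^{i t (ε ω - ε' ω')} P_{ε, ω} q̂_0 P_{ε', ω'}^*` (`qBlockAt_apply_eq_sum`). The resonant terms, with
`(ε, ω) = (ε', ω')`, add up to `q̂_∞` (`qInfHat_apply_eq_sum`). All amplitudes are dominated by the
entries of the matrices `Ω^{-i} q̂_0^{ij} Ω^{-j}` (`norm_modeAmp_apply_le`), and these are integrable by
assumption if `V̂` is singular somewhere and bounded otherwise (`exists_modeAmp_bound`). This gives the
uniform bound and the integrability of `q̂_∞`.

**The nonresonant terms.** The number of distinct eigenvalues of `V̂(θ)` is governed by the Hankel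
determinants of the power sums `tr V̂^k`, which are real-analytic; hence it is maximal outside a null set
(`measure_zeros_analytic`). Near such a point the distinct eigenvalues are simple roots of a polynomial
with analytic coefficients, so they are analytic with constant multiplicities (`exists_branches`), and
their square roots form a local system of dispersion relations. By the Hessian condition no branch is
identically zero, so that `V̂` is invertible almost everywhere, and no frequency is constant; with the
condition on `ω_k ± ω_l` it follows that all nonresonant phases `ε ω - ε' ω'` are nonconstant analytic
functions (`EigenBranches.exists_phase_ne`). The image of Lebesgue measure under such a function is
absolutely continuous, so the Riemann-Lebesgue lemma applies (`tendsto_oscillatory_integral`). No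
stationary phase estimate is needed. Countably many such neighbourhoods cover almost all of the torus,
and dominated convergence adds up the limits (`tendsto_setIntegral_of_forall_subset`).
-/

open MeasureTheory Filter Topology

noncomputable section

namespace HarmonicCrystal

variable {d n : ℕ} {α : ℝ}

/-! ### Lattice norms and lattice sums -/

lemma latNorm_eq_norm (z : Site d) :
    latNorm z = ‖(WithLp.toLp 2 (fun i => (z i : ℝ)) : EuclideanSpace ℝ (Fin d))‖ := by
  simp [latNorm, EuclideanSpace.norm_eq]

lemma latNorm_nonneg (z : Site d) : 0 ≤ latNorm z := Real.sqrt_nonneg _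

lemma latNorm_add_le (x y : Site d) : latNorm (x + y) ≤ latNorm x + latNorm y := by
  simp only [latNorm_eq_norm]
  refine le_trans (le_of_eq ?_) (norm_add_le _ _)
  congr 1
  ext i
  simp

lemma latNorm_neg (x : Site d) : latNorm (-x) = latNorm x := by
  simp [latNorm]

lemma latNorm_zero : latNorm (0 : Site d) = 0 := by
  simp [latNorm]

lemma abs_coord_le_latNorm (z : Site d) (i : Fin d) : |(z i : ℝ)| ≤ latNorm z := by
  rw [latNorm_eq_norm]
  simpa using PiLp.norm_apply_le
    (WithLp.toLp 2 (fun i => (z i : ℝ)) : EuclideanSpace ℝ (Fin d)) i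

lemma norm_le_latNorm (z : Site d) : ‖z‖ ≤ latNorm z := by
  refine (pi_norm_le_iff_of_nonneg (latNorm_nonneg z)).2 fun i => ?_
  simpa [Int.norm_eq_abs] using abs_coord_le_latNorm z i

lemma volume_floor_cell (z : Site d) :
    volume ((fun x : Fin d → ℝ => fun i => ⌊2 * x i⌋) ⁻¹' {z}) = (2⁻¹ : ENNReal) ^ d := by
  have h : (fun x : Fin d → ℝ => fun i => ⌊2 * x i⌋) ⁻¹' {z}
      = Set.pi Set.univ fun i => Set.Ico ((z i : ℝ) / 2) (((z i : ℝ) + 1) / 2) := by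
    ext x
    simp only [Set.mem_preimage, Set.mem_singleton_iff, funext_iff, Int.floor_eq_iff,
      Set.mem_univ_pi, Set.mem_Ico]
    refine forall_congr' fun i => ?_
    constructor <;> rintro ⟨h1, h2⟩ <;> constructor <;> linarith
  rw [h, Real.volume_pi_Ico]
  have h2 : ∀ i, ENNReal.ofReal (((z i : ℝ) + 1) / 2 - (z i : ℝ) / 2) = 2⁻¹ := by
    intro i
    rw [show ((z i : ℝ) + 1) / 2 - (z i : ℝ) / 2 = 2⁻¹ by ring,
      ENNReal.ofReal_inv_of_pos (by norm_num)]
    simp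
  simp [h2]

/-- Comparison of a lattice sum with an integral. The lattice point `z ≠ 0` is compared with the
cell `{x | ⌊2x⌋ = z}`, all points of which have sup-norm at most `‖z‖`. -/
lemma summable_latNorm_of_integrable {h : ℝ → ℝ} (h0 : ∀ r, 0 ≤ h r) (ha : Antitone h)
    (hi : Integrable (fun x : Fin d → ℝ => h ‖x‖)) :
    Summable fun z : Site d => h (latNorm z) := by
  set φ : (Fin d → ℝ) → Site d := fun x i => ⌊2 * x i⌋ with hφ
  have hφm : Measurable φ := by fun_prop
  set H : Site d → ENNReal := fun z => if z = 0 then 0 else ENNReal.ofReal (h ‖z‖) with hH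
  have hle : ∀ x, H (φ x) ≤ ENNReal.ofReal (h ‖x‖) := by
    intro x
    by_cases hz : φ x = 0
    · simp [hH, hz]
    · simp only [hH, hz, if_false]
      refine ENNReal.ofReal_le_ofReal (ha ?_)
      have h1 : (1 : ℝ) ≤ ‖φ x‖ := by
        obtain ⟨i, hi⟩ := Function.ne_iff.1 hz
        refine le_trans ?_ (norm_le_pi_norm (φ x) i)
        rw [Int.norm_eq_abs]
        exact_mod_cast Int.one_le_abs hi
      refine (pi_norm_le_iff_of_nonneg (norm_nonneg _)).2 fun i => ?_
      have h2 : |((φ x i : ℤ) : ℝ)| ≤ ‖φ x‖ := by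
        rw [← Int.norm_eq_abs]; exact norm_le_pi_norm (φ x) i
      have h3 : ((φ x i : ℤ) : ℝ) ≤ 2 * x i := Int.floor_le _
      have h4 : 2 * x i < (φ x i : ℤ) + 1 := Int.lt_floor_add_one _
      rw [Real.norm_eq_abs, abs_le]
      have := abs_le.1 h2
      constructor <;> linarith
  have hsum : ∑' z, H z ≠ ⊤ := by
    have h1 : ∫⁻ z, H z ∂(volume.map φ) < ⊤ := by
      rw [lintegral_map (measurable_of_countable _) hφm]
      refine (lintegral_mono hle).trans_lt ?_
      exact hi.lintegral_lt_top
    rw [lintegral_countable'] at h1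
    simp_rw [Measure.map_apply hφm (measurableSet_singleton _), hφ, volume_floor_cell,
      ENNReal.tsum_mul_right] at h1
    intro h2
    rw [h2, ENNReal.top_mul (by simp)] at h1
    exact lt_irrefl _ h1
  refine Summable.of_norm_bounded_eventually (ENNReal.summable_toReal hsum) ?_
  have : {(0 : Site d)}ᶜ ∈ (cofinite : Filter (Site d)) := by simp
  filter_upwards [this] with z hz
  have hz : z ≠ 0 := hz
  simp only [hH, hz, if_false]
  rw [Real.norm_of_nonneg (h0 _), ENNReal.toReal_ofReal (h0 _)]
  exact ha (norm_le_latNorm z)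

lemma exists_exp_mul_rpow_le {a : ℝ} (ha : 0 < a) (m : ℝ) :
    ∃ C : ℝ, 0 < C ∧ ∀ r : ℝ, 0 ≤ r → Real.exp (-a * r) * (1 + r ^ 2) ^ m ≤ C := by
  obtain ⟨N, hN⟩ := exists_nat_ge (2 * |m|)
  -- `(1 + r²)^m ≤ (1 + r)^N ≤ N! a^{-N} e^{a (1 + r)}`
  refine ⟨(N.factorial / a ^ N) * Real.exp a, by positivity, fun r hr => ?_⟩
  have h1 : (1 + r ^ 2) ^ m ≤ (1 + r) ^ N := by
    have hb : 1 ≤ 1 + r ^ 2 := by nlinarith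
    calc (1 + r ^ 2) ^ m ≤ (1 + r ^ 2) ^ |m| := Real.rpow_le_rpow_of_exponent_le hb (le_abs_self m)
      _ ≤ ((1 + r) ^ 2) ^ |m| := Real.rpow_le_rpow (by positivity) (by nlinarith) (abs_nonneg m)
      _ = (1 + r) ^ (2 * |m|) := by
          rw [← Real.rpow_natCast, ← Real.rpow_mul (by positivity)]; norm_num
      _ ≤ (1 + r) ^ (N : ℝ) := Real.rpow_le_rpow_of_exponent_le (by linarith) hN
      _ = _ := Real.rpow_natCast _ _
  have h2 : (a * (1 + r)) ^ N / N.factorial ≤ Real.exp (a * (1 + r)) :=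
    Real.pow_div_factorial_le_exp _ (by positivity) N
  have h3 : (1 + r) ^ N ≤ (N.factorial / a ^ N) * Real.exp (a * (1 + r)) := by
    rw [div_le_iff₀ (by positivity), mul_pow] at h2
    rw [div_mul_eq_mul_div, le_div_iff₀ (by positivity)]
    nlinarith
  calc Real.exp (-a * r) * (1 + r ^ 2) ^ m
      ≤ Real.exp (-a * r) * ((N.factorial / a ^ N) * Real.exp (a * (1 + r))) := by
        gcongr; exact h1.trans h3
    _ = (N.factorial / a ^ N) * (Real.exp (-a * r) * Real.exp (a * (1 + r))) := by ring
    _ = _ := by rw [← Real.exp_add]; ring_nf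

lemma summable_one_add_latNorm_sq (d : ℕ) {b : ℝ} (hb : b ≤ -d) :
    Summable fun z : Site d => (1 + latNorm z ^ 2) ^ b := by
  rcases Nat.eq_zero_or_pos d with rfl | hd
  · exact (hasSum_fintype _).summable
  set h : ℝ → ℝ := fun r => (1 + (max r 0) ^ 2) ^ b
  have hd' : (1 : ℝ) ≤ d := by exact_mod_cast hd
  have h1 := summable_latNorm_of_integrable (d := d) (h := h) (fun r => by positivity) ?_ ?_
  · refine h1.congr fun z => ?_
    simp [h, latNorm_nonneg]
  · intro r s hrs
    simp only [h]
    refine Real.rpow_le_rpow_of_nonpos (by positivity) ?_ (by linarith)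
    gcongr
  · have : (Module.finrank ℝ (Fin d → ℝ) : ℝ) < -2 * b := by simp; linarith
    have h2 := integrable_rpow_neg_one_add_norm_sq (E := Fin d → ℝ) (μ := volume) this
    refine h2.congr (Eventually.of_forall fun x => ?_)
    simp [h]

lemma summable_exp_latNorm_mul_rpow (d : ℕ) {a : ℝ} (ha : 0 < a) (m : ℝ) :
    Summable fun z : Site d => Real.exp (-a * latNorm z) * (1 + latNorm z ^ 2) ^ m := by
  obtain ⟨C, hC, h⟩ := exists_exp_mul_rpow_le ha (m + d)
  refine Summable.of_nonneg_of_le (fun z => by positivity) (fun z => ?_)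
    ((summable_one_add_latNorm_sq d (le_refl _)).mul_left C)
  have hp : (0 : ℝ) < 1 + latNorm z ^ 2 := by positivity
  have h1 := h (latNorm z) (latNorm_nonneg z)
  calc Real.exp (-a * latNorm z) * (1 + latNorm z ^ 2) ^ m
      = (Real.exp (-a * latNorm z) * (1 + latNorm z ^ 2) ^ (m + d)) *
          (1 + latNorm z ^ 2) ^ (-(d : ℝ)) := by
        rw [mul_assoc, ← Real.rpow_add hp]; ring_nf
    _ ≤ _ := by gcongr

/-! ### The phase space as a Banach space with translations -/

lemma memlp_weight_iff {Y : Site d → State n} :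
    Memℓp (fun x => weight α x • Y x) 2 ↔
      Summable fun x => ‖Y x‖ ^ 2 * (1 + latNorm x ^ 2) ^ α := by
  rw [memℓp_gen_iff (by norm_num)]
  refine summable_congr fun x => ?_
  simp only [ENNReal.toReal_ofNat, Real.rpow_ofNat]
  rw [norm_smul, mul_pow, ← weight_sq, Real.norm_eq_abs, sq_abs, mul_comm]

lemma summable_norm_sq (Y : PhaseSpace d n α) :
    Summable fun x => ‖Y x‖ ^ 2 * (1 + latNorm x ^ 2) ^ α :=
  memlp_weight_iff.1 Y.2

/-- The element of `H_α` given by a field with finite weighted norm. -/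
def PhaseSpace.mk (Y : Site d → State n)
    (h : Summable fun x => ‖Y x‖ ^ 2 * (1 + latNorm x ^ 2) ^ α) : PhaseSpace d n α :=
  ⟨Y, memlp_weight_iff.2 h⟩

lemma PhaseSpace.ext {Y Z : PhaseSpace d n α} (h : ∀ x p, Y x p = Z x p) : Y = Z := by
  apply Subtype.ext
  funext x
  ext p
  exact h x p

instance : CompleteSpace (PhaseSpace d n α) := by
  have hiso : Isometry (toL2 d n α) :=
    AddMonoidHomClass.isometry_of_norm _ fun _ => rfl
  have hsurj : Function.Surjective (toL2 d n α) := by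
    intro f
    have hf : (fun x => weight α x • ((weight α x)⁻¹ • f x)) = fun x => f x := by
      funext x
      rw [smul_smul, mul_inv_cancel₀ (weight_pos α x).ne', one_smul]
    refine ⟨⟨fun x => (weight α x)⁻¹ • f x, ?_⟩, ?_⟩
    · change Memℓp (fun x => weight α x • ((weight α x)⁻¹ • f x)) 2
      rw [hf]
      exact lp.memℓp f
    · ext x : 2
      exact congrFun hf x
  exact (hiso.isUniformInducing.completeSpace_congr hsurj).2 inferInstance

lemma weight_mul_norm_apply_le (Y : PhaseSpace d n α) (x : Site d) :
    weight α x * ‖Y x‖ ≤ ‖Y‖ := by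
  have h := lp.norm_apply_le_norm (p := 2) (by norm_num) (toL2 d n α Y) x
  have h' : ‖toL2 d n α Y‖ = ‖Y‖ := rfl
  rw [h'] at h
  refine le_trans (le_of_eq ?_) h
  change _ = ‖weight α x • Y x‖
  rw [norm_smul, Real.norm_of_nonneg (weight_pos α x).le]

lemma norm_apply_le (Y : PhaseSpace d n α) (x : Site d) :
    ‖Y x‖ ≤ (weight α x)⁻¹ * ‖Y‖ := by
  rw [← div_eq_inv_mul, le_div_iff₀ (weight_pos α x), mul_comm]
  exact weight_mul_norm_apply_le Y x

/-- The coordinate `Y ↦ Y(x)_p` as a continuous functional on `H_α`. -/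
def coord (α : ℝ) (x : Site d) (p : Fin 2 × Fin n) : PhaseSpace d n α →L[ℝ] ℝ :=
  LinearMap.mkContinuous
    { toFun := fun Y => Y x p
      map_add' := fun _ _ => rfl
      map_smul' := fun _ _ => rfl } (weight α x)⁻¹ fun Y =>
    (PiLp.norm_apply_le (Y x) p).trans (norm_apply_le Y x)

@[simp] lemma coord_apply (x : Site d) (p : Fin 2 × Fin n) (Y : PhaseSpace d n α) :
    coord α x p Y = Y x p := rfl

lemma measurable_apply (x : Site d) : Measurable fun Y : PhaseSpace d n α => Y x := by
  have h : ∀ p, Measurable fun Y : PhaseSpace d n α => Y x p := fun p =>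
    (coord α x p).continuous.measurable
  exact (PiLp.continuousLinearEquiv 2 ℝ (fun _ : Fin 2 × Fin n => ℝ)).symm.continuous.measurable.comp
    (measurable_pi_lambda _ h)

/-- The constant in the bound for a translation by `w`. -/
def peetre (α : ℝ) (w : Site d) : ℝ := (2 * (1 + latNorm w ^ 2)) ^ |α|

lemma peetre_nonneg (w : Site d) : 0 ≤ peetre α w := by
  unfold peetre; positivity

lemma one_add_latNorm_sq_le (x y : Site d) :
    1 + latNorm (x + y) ^ 2 ≤ 2 * (1 + latNorm x ^ 2) * (1 + latNorm y ^ 2) := by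
  have h := latNorm_add_le x y
  have hx := latNorm_nonneg x
  have hy := latNorm_nonneg y
  have h0 := latNorm_nonneg (x + y)
  have h2 : latNorm (x + y) ^ 2 ≤ (latNorm x + latNorm y) ^ 2 := by gcongr
  nlinarith [sq_nonneg (latNorm x - latNorm y), mul_nonneg (sq_nonneg (latNorm x)) (sq_nonneg (latNorm y))]

/-- Peetre's inequality. -/
lemma rpow_weight_le (x w : Site d) :
    (1 + latNorm x ^ 2) ^ α ≤ peetre α w * (1 + latNorm (x - w) ^ 2) ^ α := by
  unfold peetre
  have hw : (0 : ℝ) < 2 * (1 + latNorm w ^ 2) := by positivity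
  have hx : (0 : ℝ) < 1 + latNorm x ^ 2 := by positivity
  have hxw : (0 : ℝ) < 1 + latNorm (x - w) ^ 2 := by positivity
  rcases le_total 0 α with h | h
  · rw [abs_of_nonneg h, ← Real.mul_rpow hw.le hxw.le]
    refine Real.rpow_le_rpow hx.le ?_ h
    have := one_add_latNorm_sq_le w (x - w)
    rwa [add_sub_cancel] at this
  · rw [abs_of_nonpos h, Real.rpow_neg hw.le, ← div_eq_inv_mul, ← Real.div_rpow hxw.le hw.le]
    refine Real.rpow_le_rpow_of_nonpos (by positivity) ?_ h
    rw [div_le_iff₀ hw]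
    have := one_add_latNorm_sq_le x (-w)
    rw [latNorm_neg, ← sub_eq_add_neg] at this
    linarith

/-- The elementary operator `(T Y)(x) = Y(x - w)_q e_p`, on fields. -/
def shiftFun (w : Site d) (p q : Fin 2 × Fin n) (Y : Site d → State n) (x : Site d) : State n :=
  EuclideanSpace.single p (Y (x - w) q)

lemma norm_shiftFun_sq_le (w : Site d) (p q : Fin 2 × Fin n) (Y : Site d → State n) (x : Site d) :
    ‖shiftFun w p q Y x‖ ^ 2 * (1 + latNorm x ^ 2) ^ α
      ≤ peetre α w * (‖Y (x - w)‖ ^ 2 * (1 + latNorm (x - w) ^ 2) ^ α) := by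
  have h1 : ‖shiftFun w p q Y x‖ ≤ ‖Y (x - w)‖ := by
    simpa [shiftFun] using PiLp.norm_apply_le (Y (x - w)) q
  calc _ ≤ ‖Y (x - w)‖ ^ 2 * (peetre α w * (1 + latNorm (x - w) ^ 2) ^ α) := by
        gcongr; exact rpow_weight_le x w
    _ = _ := by ring

lemma summable_shift (w : Site d) (Y : PhaseSpace d n α) :
    Summable fun x => ‖Y (x - w)‖ ^ 2 * (1 + latNorm (x - w) ^ 2) ^ α :=
  (Equiv.subRight w).summable_iff.2 (summable_norm_sq Y)

lemma summable_shiftFun (w : Site d) (p q : Fin 2 × Fin n) (Y : PhaseSpace d n α) :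
    Summable fun x => ‖shiftFun w p q Y x‖ ^ 2 * (1 + latNorm x ^ 2) ^ α :=
  Summable.of_nonneg_of_le (fun x => by positivity) (norm_shiftFun_sq_le w p q Y)
    ((summable_shift w Y).mul_left _)

/-- The bounded operator `(T Y)(x) = Y(x - w)_q e_p` on `H_α`. -/
def shiftOp (α : ℝ) (w : Site d) (p q : Fin 2 × Fin n) :
    PhaseSpace d n α →L[ℝ] PhaseSpace d n α :=
  LinearMap.mkContinuous
    { toFun := fun Y => PhaseSpace.mk (shiftFun w p q Y) (summable_shiftFun w p q Y)
      map_add' := fun Y Z => by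
        refine PhaseSpace.ext fun x r => ?_
        change (EuclideanSpace.single p (Y (x - w) q + Z (x - w) q) : State n) r =
          (EuclideanSpace.single p (Y (x - w) q) : State n) r
            + (EuclideanSpace.single p (Z (x - w) q) : State n) r
        simp only [PiLp.single_apply]
        split_ifs <;> simp
      map_smul' := fun c Y => by
        refine PhaseSpace.ext fun x r => ?_
        change (EuclideanSpace.single p (c * Y (x - w) q) : State n) r =
          c * (EuclideanSpace.single p (Y (x - w) q) : State n) r
        simp only [PiLp.single_apply]
        split_ifs <;> simp }
    (Real.sqrt (peetre α w)) fun Y => by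
      refine le_of_sq_le_sq ?_ (by positivity)
      rw [mul_pow, Real.sq_sqrt (peetre_nonneg w), norm_sq_eq, norm_sq_eq]
      refine ((summable_shiftFun w p q Y).tsum_le_tsum (norm_shiftFun_sq_le w p q Y)
        ((summable_shift w Y).mul_left _)).trans (le_of_eq ?_)
      rw [tsum_mul_left]
      congr 1
      exact (Equiv.subRight w).tsum_eq fun x => ‖Y x‖ ^ 2 * (1 + latNorm x ^ 2) ^ α

lemma shiftOp_apply (w : Site d) (p q : Fin 2 × Fin n) (Y : PhaseSpace d n α) (x : Site d)
    (r : Fin 2 × Fin n) :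
    shiftOp α w p q Y x r = if r = p then Y (x - w) q else 0 := by
  change (EuclideanSpace.single p (Y (x - w) q) : State n) r = _
  simp [PiLp.single_apply]

lemma norm_shiftOp_le (w : Site d) (p q : Fin 2 × Fin n) :
    ‖shiftOp α w p q‖ ≤ Real.sqrt (peetre α w) :=
  LinearMap.mkContinuous_norm_le _ (Real.sqrt_nonneg _) _

/-! ### The generator of the dynamics -/

/-- The convolution kernel of the generator `(u, v) ↦ (v, -V * u)`. -/
def genKernel (V : Interaction d n) (w : Site d) (p q : Fin 2 × Fin n) : ℝ :=
  (!![0, if w = 0 then 1 else 0; -V w, 0] : Matrix (Fin 2) (Fin 2) (Matrix (Fin n) (Fin n) ℝ))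
    p.1 q.1 p.2 q.2

lemma exists_abs_genKernel_le {V : Interaction d n} (hE1 : CondE1 V) :
    ∃ C > 0, ∃ a > 0, ∀ w p q, |genKernel V w p q| ≤ C * Real.exp (-a * latNorm w) := by
  obtain ⟨C, hC, a, ha, h⟩ := hE1
  refine ⟨C + 1, by positivity, a, ha, ?_⟩
  rintro w ⟨i, k⟩ ⟨j, l⟩
  have h1 : |((if w = 0 then 1 else 0 : Matrix (Fin n) (Fin n) ℝ)) k l|
      ≤ (C + 1) * Real.exp (-a * latNorm w) := by
    by_cases hw : w = 0
    · subst hw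
      simp only [if_true, latNorm_zero, mul_zero, Real.exp_zero, mul_one, Matrix.one_apply]
      split_ifs <;> simp <;> linarith
    · simp only [hw, if_false, Matrix.zero_apply, abs_zero]; positivity
  have h2 : |V w k l| ≤ (C + 1) * Real.exp (-a * latNorm w) :=
    (h w k l).trans (by gcongr; linarith)
  have h3 : (0 : ℝ) ≤ (C + 1) * Real.exp (-a * latNorm w) := by positivity
  fin_cases i <;> fin_cases j <;> simp only [genKernel] <;>
    first
      | simpa [-neg_mul] using h3
      | simpa [-neg_mul] using h1
      | simpa [-neg_mul] using h2

lemma summable_abs_genKernel_mul_rpow {V : Interaction d n} (hE1 : CondE1 V) (m : ℝ)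
    (p q : Fin 2 × Fin n) :
    Summable fun w => |genKernel V w p q| * (1 + latNorm w ^ 2) ^ m := by
  obtain ⟨C, hC, a, ha, h⟩ := exists_abs_genKernel_le hE1
  refine Summable.of_nonneg_of_le (fun w => by positivity) (fun w => ?_)
    ((summable_exp_latNorm_mul_rpow d ha m).mul_left C)
  rw [← mul_assoc]
  gcongr
  exact h w p q

lemma summable_abs_genKernel {V : Interaction d n} (hE1 : CondE1 V) (p q : Fin 2 × Fin n) :
    Summable fun w => |genKernel V w p q| := by
  simpa using summable_abs_genKernel_mul_rpow hE1 0 p q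

lemma summable_genOp {V : Interaction d n} (hE1 : CondE1 V) (α : ℝ) :
    Summable fun w : Site d => ∑ p, ∑ q, genKernel V w p q • shiftOp α w p q := by
  refine summable_sum fun p _ => summable_sum fun q _ => ?_
  refine Summable.of_norm_bounded
    ((summable_abs_genKernel_mul_rpow hE1 (|α| / 2) p q).mul_left (2 ^ (|α| / 2))) fun w => ?_
  rw [norm_smul, Real.norm_eq_abs]
  have h1 := norm_shiftOp_le (α := α) w p q
  have h2 : Real.sqrt (peetre α w) = 2 ^ (|α| / 2) * (1 + latNorm w ^ 2) ^ (|α| / 2) := by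
    rw [peetre, Real.sqrt_eq_rpow, ← Real.rpow_mul (by positivity),
      Real.mul_rpow (by norm_num) (by positivity)]
    ring_nf
  rw [h2] at h1
  calc _ ≤ |genKernel V w p q| * (2 ^ (|α| / 2) * (1 + latNorm w ^ 2) ^ (|α| / 2)) := by gcongr
    _ = _ := by ring

/-- The generator `(u, v) ↦ (v, -V * u)` of the dynamics as a bounded operator on `H_α`. -/
def genOp (V : Interaction d n) (α : ℝ) : PhaseSpace d n α →L[ℝ] PhaseSpace d n α :=
  ∑' w, ∑ p, ∑ q, genKernel V w p q • shiftOp α w p q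

lemma hasSum_genOp_apply {V : Interaction d n} (hE1 : CondE1 V) (Y : PhaseSpace d n α)
    (x : Site d) (p : Fin 2 × Fin n) :
    HasSum (fun w => ∑ q, genKernel V w p q * Y (x - w) q) (genOp V α Y x p) := by
  have h := (coord α x p).hasSum
    ((ContinuousLinearMap.apply ℝ (PhaseSpace d n α) Y).hasSum (summable_genOp hE1 α).hasSum)
  refine Eq.mp (congrArg (fun f => HasSum f _) (funext fun w => ?_)) h
  simp only [ContinuousLinearMap.apply_apply, map_sum, map_smul, coord_apply, shiftOp_apply,
    smul_eq_mul, mul_ite, mul_zero]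
  rw [Finset.sum_comm]
  simp

lemma genOp_apply_u {V : Interaction d n} (hE1 : CondE1 V) (Y : PhaseSpace d n α)
    (x : Site d) (k : Fin n) : genOp V α Y x (0, k) = Y x (1, k) := by
  refine (hasSum_genOp_apply hE1 Y x (0, k)).unique ?_
  have h : ∀ w : Site d, ∑ q, genKernel V w (0, k) q * Y (x - w) q
      = if w = 0 then Y x (1, k) else 0 := by
    intro w
    rw [Fintype.sum_prod_type, Fin.sum_univ_two]
    by_cases hw : w = 0 <;> simp [genKernel, hw, Matrix.one_apply]
  simp_rw [h]
  exact hasSum_ite_eq 0 _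

lemma genOp_apply_v {V : Interaction d n} (hE1 : CondE1 V) (Y : PhaseSpace d n α)
    (x : Site d) (k : Fin n) :
    genOp V α Y x (1, k) = -∑' y, ∑ l, V (x - y) k l * Y y (0, l) := by
  rw [← (hasSum_genOp_apply hE1 Y x (1, k)).tsum_eq, ← tsum_neg,
    ← (Equiv.subLeft x).tsum_eq]
  refine tsum_congr fun y => ?_
  rw [Fintype.sum_prod_type, Fin.sum_univ_two]
  simp [genKernel, Equiv.subLeft]

/-! ### Solutions of the Cauchy problem -/

lemma isSolution_iff {V : Interaction d n} (hE1 : CondE1 V) {Y₀ : PhaseSpace d n α}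
    {Y : ℝ → PhaseSpace d n α} :
    IsSolution V Y₀ Y ↔ Continuous Y ∧ Y 0 = Y₀ ∧
      ∀ t x p, HasDerivAt (fun s => Y s x p) (genOp V α (Y t) x p) t := by
  constructor
  · intro h
    refine ⟨h.continuous, h.initial, ?_⟩
    rintro t x ⟨i, k⟩
    fin_cases i
    · simpa [genOp_apply_u hE1] using h.deriv_u t x k
    · simpa [genOp_apply_v hE1] using h.deriv_v t x k
  · rintro ⟨h1, h2, h3⟩
    refine ⟨h1, h2, fun t x k => ?_, fun t x k => ?_⟩
    · simpa [genOp_apply_u hE1] using h3 t x (0, k)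
    · simpa [genOp_apply_v hE1] using h3 t x (1, k)

/-- A solution, which is differentiable coordinatewise only, is differentiable in `H_α`: it equals
the primitive of the continuous curve `t ↦ genOp (Y t)`. -/
lemma IsSolution.hasDerivAt {V : Interaction d n} (hE1 : CondE1 V) {Y₀ : PhaseSpace d n α}
    {Y : ℝ → PhaseSpace d n α} (h : IsSolution V Y₀ Y) (t : ℝ) :
    HasDerivAt Y (genOp V α (Y t)) t := by
  obtain ⟨hc, -, hd⟩ := (isSolution_iff hE1).1 h
  have hc' : Continuous fun s => genOp V α (Y s) := (genOp V α).continuous.comp hc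
  have hY : Y = fun t => Y 0 + ∫ s in (0 : ℝ)..t, genOp V α (Y s) := by
    funext t
    refine PhaseSpace.ext fun x p => ?_
    have h1 : ∫ s in (0 : ℝ)..t, genOp V α (Y s) x p = Y t x p - Y 0 x p :=
      intervalIntegral.integral_eq_sub_of_hasDerivAt (fun s _ => hd s x p)
        (((coord α x p).continuous.comp hc').intervalIntegrable _ _)
    have h2 := (coord α x p).intervalIntegral_comp_comm (hc'.intervalIntegrable 0 t (μ := volume))
    simp only [coord_apply] at h2
    rw [h1] at h2
    rw [← coord_apply (α := α), ← coord_apply (α := α) x p (Y 0 + _), map_add, coord_apply, coord_apply, coord_apply, ← h2]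
    ring
  have h1 := intervalIntegral.integral_hasDerivAt_right (hc'.intervalIntegrable 0 t (μ := volume))
    hc'.aestronglyMeasurable.stronglyMeasurableAtFilter hc'.continuousAt
  exact (h1.const_add (Y 0)).congr_of_eventuallyEq (Eventually.of_forall fun s => congrFun hY s)

/-- The evolution operators `U(t) = exp (t genOp)`. -/
def evol (V : Interaction d n) (α t : ℝ) : PhaseSpace d n α →L[ℝ] PhaseSpace d n α :=
  NormedSpace.exp (t • genOp V α)

lemma isSolution_evol {V : Interaction d n} (hE1 : CondE1 V) (Y₀ : PhaseSpace d n α) :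
    IsSolution V Y₀ fun t => evol V α t Y₀ := by
  have hd : ∀ t, HasDerivAt (fun t => evol V α t Y₀) (genOp V α (evol V α t Y₀)) t := fun t =>
    (ContinuousLinearMap.apply ℝ (PhaseSpace d n α) Y₀).hasFDerivAt.comp_hasDerivAt t
      (hasDerivAt_exp_smul_const' (𝕂 := ℝ) (genOp V α) t)
  refine (isSolution_iff hE1).2 ⟨?_, ?_, fun t x p => ?_⟩
  · exact continuous_iff_continuousAt.2 fun t => (hd t).continuousAt
  · simp [evol]
  · exact (coord α x p).hasFDerivAt.comp_hasDerivAt t (hd t)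

lemma IsSolution.unique {V : Interaction d n} (hE1 : CondE1 V) {Y₀ : PhaseSpace d n α}
    {Y Z : ℝ → PhaseSpace d n α} (hY : IsSolution V Y₀ Y) (hZ : IsSolution V Y₀ Z) : Y = Z :=
  ODE_solution_unique_univ (v := fun _ => genOp V α) (s := fun _ => Set.univ) (t₀ := 0)
    (fun _ => (genOp V α).lipschitz.lipschitzOnWith)
    (fun t => ⟨hY.hasDerivAt hE1 t, Set.mem_univ _⟩)
    (fun t => ⟨hZ.hasDerivAt hE1 t, Set.mem_univ _⟩) (hY.initial.trans hZ.initial.symm)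

lemma flow_eq_evol {V : Interaction d n} (hE1 : CondE1 V) (t : ℝ) (Y₀ : PhaseSpace d n α) :
    flow V t Y₀ = evol V α t Y₀ := by
  have h : IsSolution V Y₀ (Classical.epsilon (IsSolution V Y₀)) :=
    Classical.epsilon_spec ⟨_, isSolution_evol hE1 Y₀⟩
  exact congrFun (h.unique hE1 (isSolution_evol hE1 Y₀)) t

/-- The inclusion `H_α ⊆ H_β` for `β ≤ α`. -/
def incl {α β : ℝ} (h : β ≤ α) : PhaseSpace d n α →L[ℝ] PhaseSpace d n β :=
  have hle : ∀ (Y : PhaseSpace d n α) (x : Site d),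
      ‖Y x‖ ^ 2 * (1 + latNorm x ^ 2) ^ β ≤ ‖Y x‖ ^ 2 * (1 + latNorm x ^ 2) ^ α := fun Y x => by
    gcongr
    nlinarith [sq_nonneg (latNorm x)]
  have hs : ∀ Y : PhaseSpace d n α, Summable fun x => ‖Y x‖ ^ 2 * (1 + latNorm x ^ 2) ^ β :=
    fun Y => Summable.of_nonneg_of_le (fun x => by positivity) (hle Y) (summable_norm_sq Y)
  LinearMap.mkContinuous
    { toFun := fun Y => PhaseSpace.mk (fun x => Y x) (hs Y)
      map_add' := fun _ _ => rfl
      map_smul' := fun _ _ => rfl } 1 fun Y => by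
      rw [one_mul]
      refine le_of_sq_le_sq ?_ (norm_nonneg _)
      rw [norm_sq_eq, norm_sq_eq]
      exact (hs Y).tsum_le_tsum (hle Y) (summable_norm_sq Y)

@[simp] lemma incl_apply {α β : ℝ} (h : β ≤ α) (Y : PhaseSpace d n α) (x : Site d) :
    incl h Y x = Y x := rfl

lemma evol_incl {V : Interaction d n} (hE1 : CondE1 V) {α β : ℝ} (h : β ≤ α) (t : ℝ)
    (Y : PhaseSpace d n α) : evol V β t (incl h Y) = incl h (evol V α t Y) := by
  obtain ⟨h1, h2, h3⟩ := (isSolution_iff hE1).1 (isSolution_evol hE1 Y)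
  have hs : IsSolution V (incl h Y) fun t => incl h (evol V α t Y) := by
    refine ⟨(incl h).continuous.comp h1, by simp only [h2], fun t x k => ?_, fun t x k => ?_⟩
    · exact (isSolution_evol hE1 Y).deriv_u t x k
    · exact (isSolution_evol hE1 Y).deriv_v t x k
  exact congrFun ((isSolution_evol hE1 (incl h Y)).unique hE1 hs) t

/-! ### Covariance inequality for mixing measures -/

/-- The covariance inequality for two discrete random variables with values `a i`, `b j`, joint
distribution `p`, and marginals `P`, `Q`, by the Cauchy-Schwarz inequality for the weights
`|p i j - P i * Q j|`. -/
lemma discrete_covariance_le {ι κ : Type*} (I : Finset ι) (J : Finset κ) (p : ι → κ → ℝ)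
    (P : ι → ℝ) (Q : κ → ℝ) (φ : ℝ) (hφ : 0 ≤ φ) (hp : ∀ i j, 0 ≤ p i j)
    (hP : ∀ i ∈ I, ∑ j ∈ J, p i j = P i) (hP0 : ∀ i, 0 ≤ P i) (hQ0 : ∀ j, 0 ≤ Q j)
    (hQ1 : ∑ j ∈ J, Q j = 1)
    (hmix : ∀ I' ⊆ I, ∀ j, |∑ i ∈ I', p i j - (∑ i ∈ I', P i) * Q j| ≤ φ * Q j)
    (a : ι → ℝ) (b : κ → ℝ) :
    |∑ i ∈ I, ∑ j ∈ J, a i * b j * (p i j - P i * Q j)| ≤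
      2 * Real.sqrt φ * Real.sqrt (∑ i ∈ I, a i ^ 2 * P i) *
        Real.sqrt (∑ j ∈ J, b j ^ 2 * Q j) := by
  classical
  set δ : ι → κ → ℝ := fun i j => |p i j - P i * Q j| with hδ
  have hδ0 : ∀ i j, 0 ≤ δ i j := fun i j => abs_nonneg _
  have hrow : ∀ i ∈ I, ∑ j ∈ J, δ i j ≤ 2 * P i := by
    intro i hi
    calc ∑ j ∈ J, δ i j ≤ ∑ j ∈ J, (p i j + P i * Q j) := by
          refine Finset.sum_le_sum fun j _ => ?_
          have h1 := hp i j
          have h2 := mul_nonneg (hP0 i) (hQ0 j)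
          exact abs_le.2 ⟨by linarith, by linarith⟩
      _ = 2 * P i := by
          rw [Finset.sum_add_distrib, hP i hi, ← Finset.mul_sum, hQ1]; ring
  have hcol : ∀ j, ∑ i ∈ I, δ i j ≤ 2 * (φ * Q j) := by
    intro j
    have h1 := hmix (I.filter fun i => 0 ≤ p i j - P i * Q j) (Finset.filter_subset _ _) j
    have h2 := hmix (I.filter fun i => ¬ 0 ≤ p i j - P i * Q j) (Finset.filter_subset _ _) j
    rw [Finset.sum_mul, ← Finset.sum_sub_distrib] at h1 h2
    rw [← Finset.sum_filter_add_sum_filter_not I (fun i => 0 ≤ p i j - P i * Q j)]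
    have h3 : ∑ i ∈ I.filter (fun i => 0 ≤ p i j - P i * Q j), δ i j
        = ∑ i ∈ I.filter (fun i => 0 ≤ p i j - P i * Q j), (p i j - P i * Q j) :=
      Finset.sum_congr rfl fun i hi => abs_of_nonneg (Finset.mem_filter.1 hi).2
    have h4 : ∑ i ∈ I.filter (fun i => ¬ 0 ≤ p i j - P i * Q j), δ i j
        = -∑ i ∈ I.filter (fun i => ¬ 0 ≤ p i j - P i * Q j), (p i j - P i * Q j) := by
      rw [← Finset.sum_neg_distrib]
      exact Finset.sum_congr rfl fun i hi =>
        abs_of_nonpos (le_of_lt (not_le.1 (Finset.mem_filter.1 hi).2))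
    rw [h3, h4]
    linarith [(abs_le.1 h1).2, (abs_le.1 h2).1]
  have hA : ∑ x ∈ I ×ˢ J, a x.1 ^ 2 * δ x.1 x.2 ≤ 2 * ∑ i ∈ I, a i ^ 2 * P i := by
    rw [Finset.sum_product, Finset.mul_sum]
    refine Finset.sum_le_sum fun i hi => ?_
    change ∑ j ∈ J, a i ^ 2 * δ i j ≤ _
    rw [← Finset.mul_sum]
    nlinarith [hrow i hi, sq_nonneg (a i)]
  have hB : ∑ x ∈ I ×ˢ J, b x.2 ^ 2 * δ x.1 x.2 ≤ 2 * φ * ∑ j ∈ J, b j ^ 2 * Q j := by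
    rw [Finset.sum_product_right, Finset.mul_sum]
    refine Finset.sum_le_sum fun j _ => ?_
    change ∑ i ∈ I, b j ^ 2 * δ i j ≤ _
    rw [← Finset.mul_sum]
    nlinarith [hcol j, sq_nonneg (b j)]
  have hsum : |∑ i ∈ I, ∑ j ∈ J, a i * b j * (p i j - P i * Q j)|
      ≤ ∑ x ∈ I ×ˢ J, (|a x.1| * Real.sqrt (δ x.1 x.2)) * (|b x.2| * Real.sqrt (δ x.1 x.2)) := by
    rw [← Finset.sum_product']
    refine (Finset.abs_sum_le_sum_abs _ _).trans (le_of_eq (Finset.sum_congr rfl fun x _ => ?_))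
    have := Real.mul_self_sqrt (hδ0 x.1 x.2)
    rw [abs_mul, abs_mul]
    change |a x.1| * |b x.2| * δ x.1 x.2 = _
    linear_combination (- |a x.1| * |b x.2|) * this
  refine hsum.trans ((Real.sum_mul_le_sqrt_mul_sqrt _ _ _).trans ?_)
  have e1 : ∀ x : ι × κ, (|a x.1| * Real.sqrt (δ x.1 x.2)) ^ 2 = a x.1 ^ 2 * δ x.1 x.2 := by
    intro x; rw [mul_pow, sq_abs, Real.sq_sqrt (hδ0 _ _)]
  have e2 : ∀ x : ι × κ, (|b x.2| * Real.sqrt (δ x.1 x.2)) ^ 2 = b x.2 ^ 2 * δ x.1 x.2 := by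
    intro x; rw [mul_pow, sq_abs, Real.sq_sqrt (hδ0 _ _)]
  simp_rw [e1, e2]
  calc _ ≤ Real.sqrt (2 * ∑ i ∈ I, a i ^ 2 * P i) * Real.sqrt (2 * φ * ∑ j ∈ J, b j ^ 2 * Q j) := by
        gcongr
    _ = (Real.sqrt 2 * Real.sqrt 2) * Real.sqrt φ * Real.sqrt (∑ i ∈ I, a i ^ 2 * P i) *
          Real.sqrt (∑ j ∈ J, b j ^ 2 * Q j) := by
        rw [Real.sqrt_mul (by norm_num), Real.sqrt_mul (by positivity), Real.sqrt_mul (by norm_num)]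
        ring
    _ = _ := by rw [Real.mul_self_sqrt (by norm_num)]

section Covariance

variable {Ω : Type*} {m₁ m₂ m₀ : MeasurableSpace Ω} {μ : Measure Ω} [IsProbabilityMeasure μ]

lemma integral_simple_pair {ξ η : Ω → ℝ} {R S : Finset ℝ} (hR : ∀ ω, ξ ω ∈ R)
    (hS : ∀ ω, η ω ∈ S) (hξ : ∀ a, MeasurableSet[m₀] (ξ ⁻¹' {a}))
    (hη : ∀ b, MeasurableSet[m₀] (η ⁻¹' {b})) (g : ℝ → ℝ → ℝ) :
    ∫ ω, g (ξ ω) (η ω) ∂μ = ∑ a ∈ R, ∑ b ∈ S,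
      g a b * μ.real (ξ ⁻¹' {a} ∩ η ⁻¹' {b}) := by
  have hm : ∀ a b, MeasurableSet[m₀] (ξ ⁻¹' {a} ∩ η ⁻¹' {b}) := fun a b =>
    (hξ a).inter (hη b)
  have h : ∀ ω, g (ξ ω) (η ω) = ∑ a ∈ R, ∑ b ∈ S,
      (ξ ⁻¹' {a} ∩ η ⁻¹' {b}).indicator (fun _ => g a b) ω := by
    intro ω
    rw [Finset.sum_eq_single_of_mem (ξ ω) (hR ω),
      Finset.sum_eq_single_of_mem (η ω) (hS ω)]
    · simp
    · intro b _ hb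
      exact Set.indicator_of_notMem (fun h => hb h.2.symm) _
    · intro a _ ha
      exact Finset.sum_eq_zero fun b _ => Set.indicator_of_notMem (fun h => ha h.1.symm) _
  simp_rw [h]
  rw [integral_finsetSum]
  · refine Finset.sum_congr rfl fun a _ => ?_
    rw [integral_finsetSum]
    · refine Finset.sum_congr rfl fun b _ => ?_
      rw [integral_indicator_const _ (hm a b), smul_eq_mul, mul_comm]
    · exact fun b _ => (integrable_const _).indicator (hm a b)
  · exact fun a _ => integrable_finsetSum _ fun b _ => (integrable_const _).indicator (hm a b)

/-- The covariance inequality for random variables with finitely many values. -/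
lemma simple_covariance_le (h₁ : m₁ ≤ m₀) (h₂ : m₂ ≤ m₀) {φ : ℝ} (hφ : 0 ≤ φ)
    (hmix : ∀ A B, MeasurableSet[m₁] A → MeasurableSet[m₂] B →
      |μ.real (A ∩ B) - μ.real A * μ.real B| ≤ φ * μ.real B)
    {ξ η : Ω → ℝ} {R S : Finset ℝ} (hR : ∀ ω, ξ ω ∈ R) (hS : ∀ ω, η ω ∈ S)
    (hm₁ : ∀ a, MeasurableSet[m₁] (ξ ⁻¹' {a})) (hm₂ : ∀ b, MeasurableSet[m₂] (η ⁻¹' {b})) :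
    |∫ ω, ξ ω * η ω ∂μ - (∫ ω, ξ ω ∂μ) * ∫ ω, η ω ∂μ| ≤
      2 * Real.sqrt φ * Real.sqrt (∫ ω, ξ ω ^ 2 ∂μ) * Real.sqrt (∫ ω, η ω ^ 2 ∂μ) := by
  classical
  set p : ℝ → ℝ → ℝ := fun a b => μ.real (ξ ⁻¹' {a} ∩ η ⁻¹' {b}) with hp
  have hset₁ : ∀ s : Finset ℝ, MeasurableSet[m₁] (⋃ a ∈ s, ξ ⁻¹' {a}) := fun s =>
    Finset.measurableSet_biUnion s fun a _ => hm₁ a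
  have hdisj : ∀ (s : Finset ℝ) (f : Ω → ℝ) (T : Set Ω),
      (s : Set ℝ).PairwiseDisjoint fun a => f ⁻¹' {a} ∩ T := by
    intro s f T a _ b _ hab
    refine Set.disjoint_left.2 ?_
    rintro ω ⟨ha, -⟩ ⟨hb, -⟩
    exact hab (ha.symm.trans hb)
  have hU₁ : ∀ (s : Finset ℝ) (b : ℝ),
      ∑ a ∈ s, p a b = μ.real ((⋃ a ∈ s, ξ ⁻¹' {a}) ∩ η ⁻¹' {b}) := by
    intro s b
    rw [Set.iUnion₂_inter, measureReal_biUnion_finset (hdisj s ξ _)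
      (fun a _ => (h₁ _ (hm₁ a)).inter (h₂ _ (hm₂ b)))]
  have hU₀ : ∀ s : Finset ℝ, ∑ a ∈ s, μ.real (ξ ⁻¹' {a}) = μ.real (⋃ a ∈ s, ξ ⁻¹' {a}) := by
    intro s
    rw [measureReal_biUnion_finset (by simpa using hdisj s ξ Set.univ) (fun a _ => h₁ _ (hm₁ a))]
  have hrη : (⋃ b ∈ S, η ⁻¹' {b}) = Set.univ := by
    ext ω
    simpa using hS ω
  have hrξ : (⋃ a ∈ R, ξ ⁻¹' {a}) = Set.univ := by
    ext ω
    simpa using hR ω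
  have hP : ∀ a, ∑ b ∈ S, p a b = μ.real (ξ ⁻¹' {a}) := by
    intro a
    have h := measureReal_biUnion_finset (μ := μ) (hdisj S η (ξ ⁻¹' {a}))
      (fun b _ => (h₂ _ (hm₂ b)).inter (h₁ _ (hm₁ a)))
    rw [← Set.iUnion₂_inter, hrη, Set.univ_inter] at h
    rw [h]
    exact Finset.sum_congr rfl fun b _ => by rw [hp, Set.inter_comm]
  have hQ : ∀ b, ∑ a ∈ R, p a b = μ.real (η ⁻¹' {b}) := by
    intro b
    rw [hU₁, hrξ, Set.univ_inter]
  have hQ1 : ∑ b ∈ S, μ.real (η ⁻¹' {b}) = 1 := by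
    have h := measureReal_biUnion_finset (μ := μ) (hdisj S η Set.univ)
      (fun b _ => (h₂ _ (hm₂ b)).inter MeasurableSet.univ)
    simp only [Set.inter_univ] at h
    rw [← h, hrη, probReal_univ]
  have key := discrete_covariance_le R S p (fun a => μ.real (ξ ⁻¹' {a}))
    (fun b => μ.real (η ⁻¹' {b})) φ hφ (fun _ _ => measureReal_nonneg) (fun a _ => hP a)
    (fun _ => measureReal_nonneg) (fun _ => measureReal_nonneg) hQ1
    (fun s _ b => by rw [hU₁, hU₀]; exact hmix _ _ (hset₁ s) (hm₂ b)) id id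
  have i1 := integral_simple_pair (μ := μ) hR hS (fun a => h₁ _ (hm₁ a)) (fun b => h₂ _ (hm₂ b)) fun a b => a * b
  have i2 := integral_simple_pair (μ := μ) hR hS (fun a => h₁ _ (hm₁ a)) (fun b => h₂ _ (hm₂ b)) fun a _ => a
  have i3 := integral_simple_pair (μ := μ) hR hS (fun a => h₁ _ (hm₁ a)) (fun b => h₂ _ (hm₂ b)) fun _ b => b
  have i4 := integral_simple_pair (μ := μ) hR hS (fun a => h₁ _ (hm₁ a)) (fun b => h₂ _ (hm₂ b)) fun a _ => a ^ 2
  have i5 := integral_simple_pair (μ := μ) hR hS (fun a => h₁ _ (hm₁ a)) (fun b => h₂ _ (hm₂ b)) fun _ b => b ^ 2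
  rw [Finset.sum_comm] at i3 i5
  simp_rw [← Finset.mul_sum] at i2 i3 i4 i5
  have hP' : ∀ a, ∑ b ∈ S, μ.real (ξ ⁻¹' {a} ∩ η ⁻¹' {b}) = μ.real (ξ ⁻¹' {a}) := hP
  have hQ' : ∀ b, ∑ a ∈ R, μ.real (ξ ⁻¹' {a} ∩ η ⁻¹' {b}) = μ.real (η ⁻¹' {b}) := hQ
  simp_rw [hP'] at i2 i4
  simp_rw [hQ'] at i3 i5
  rw [i1, i2, i3, i4, i5]
  refine le_trans (le_of_eq ?_) key
  rw [Finset.sum_mul_sum, ← Finset.sum_sub_distrib]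
  congr 1
  refine Finset.sum_congr rfl fun a _ => ?_
  rw [← Finset.sum_sub_distrib]
  refine Finset.sum_congr rfl fun b _ => ?_
  simp only [hp, id]
  ring

/-- The covariance inequality for uniformly mixing σ-algebras: `|Cov(ξ, η)| ≤ 2 √φ ‖ξ‖₂ ‖η‖₂`. -/
lemma covariance_le_of_mixing (h₁ : m₁ ≤ m₀) (h₂ : m₂ ≤ m₀) {φ : ℝ} (hφ : 0 ≤ φ)
    (hmix : ∀ A B, MeasurableSet[m₁] A → MeasurableSet[m₂] B →
      |μ.real (A ∩ B) - μ.real A * μ.real B| ≤ φ * μ.real B)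
    {ξ η : Ω → ℝ} (hξ : StronglyMeasurable[m₁] ξ) (hη : StronglyMeasurable[m₂] η)
    (hξ2 : MemLp ξ 2 μ) (hη2 : MemLp η 2 μ) :
    |∫ ω, ξ ω * η ω ∂μ - (∫ ω, ξ ω ∂μ) * ∫ ω, η ω ∂μ| ≤
      2 * Real.sqrt φ * Real.sqrt (∫ ω, ξ ω ^ 2 ∂μ) * Real.sqrt (∫ ω, η ω ^ 2 ∂μ) := by
  have h1m : MemLp (fun _ : Ω => (1 : ℝ)) 2 μ := memLp_const 1
  have hinner : ∀ {f g : Ω → ℝ} (hf : MemLp f 2 μ) (hg : MemLp g 2 μ),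
      inner ℝ (hf.toLp f) (hg.toLp g) = ∫ ω, f ω * g ω ∂μ := by
    intro f g hf hg
    rw [L2.inner_def]
    refine integral_congr_ae ?_
    filter_upwards [hf.coeFn_toLp, hg.coeFn_toLp] with ω h1 h2
    simp [h1, h2, mul_comm]
  have hnorm : ∀ {f : Ω → ℝ} (hf : MemLp f 2 μ), ‖hf.toLp f‖ = Real.sqrt (∫ ω, f ω ^ 2 ∂μ) := by
    intro f hf
    rw [norm_eq_sqrt_real_inner, hinner hf hf]
    simp_rw [sq]
  have hmean : ∀ {f : Ω → ℝ} (hf : MemLp f 2 μ),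
      inner ℝ (h1m.toLp _) (hf.toLp f) = ∫ ω, f ω ∂μ := by
    intro f hf
    rw [hinner h1m hf]
    simp
  set S : Set (Lp ℝ 2 μ × Lp ℝ 2 μ) := {z | |inner ℝ z.1 z.2
    - inner ℝ (h1m.toLp _) z.1 * inner ℝ (h1m.toLp _) z.2| ≤ 2 * Real.sqrt φ * ‖z.1‖ * ‖z.2‖}
  have hS : IsClosed S := isClosed_le (by fun_prop) (by fun_prop)
  have happ : ∀ {m : MeasurableSpace Ω} (hm : m ≤ m₀) {f : Ω → ℝ} (_ : StronglyMeasurable[m] f)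
      (hf : MemLp f 2 μ) (ε : ℝ) (_ : 0 < ε), ∃ (g : @SimpleFunc Ω m ℝ) (hg : MemLp g 2 μ),
        ‖hg.toLp g - hf.toLp f‖ < ε := by
    intro m hm f hfm hf ε hε
    have hf' : MemLp f 2 (μ.trim hm) := ⟨hfm.aestronglyMeasurable, by
        rw [eLpNorm_trim hm hfm]; exact hf.2⟩
    obtain ⟨g, hg, hg2⟩ := MemLp.exists_simpleFunc_eLpNorm_sub_lt hf' (by norm_num)
      (ε := ENNReal.ofReal ε) (by simpa using hε)
    have hg' : MemLp g 2 μ := memLp_of_memLp_trim hm hg2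
    refine ⟨g, hg', ?_⟩
    rw [norm_sub_rev, ← MemLp.toLp_sub, Lp.norm_toLp]
    rw [eLpNorm_trim hm (hfm.sub (@SimpleFunc.stronglyMeasurable _ _ m _ g))] at hg
    exact (ENNReal.toReal_lt_of_lt_ofReal hg)
  have hmem : (hξ2.toLp ξ, hη2.toLp η) ∈ closure S := by
    refine Metric.mem_closure_iff.2 fun ε hε => ?_
    obtain ⟨f, hf, hf'⟩ := happ h₁ hξ hξ2 ε hε
    obtain ⟨g, hg, hg'⟩ := happ h₂ hη hη2 ε hε
    refine ⟨(hf.toLp f, hg.toLp g), ?_, ?_⟩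
    · simp only [S, Set.mem_ofPred_eq]
      rw [hinner hf hg, hmean hf, hmean hg, hnorm hf, hnorm hg]
      exact simple_covariance_le h₁ h₂ hφ hmix (@SimpleFunc.mem_range_self _ _ m₁ f)
        (@SimpleFunc.mem_range_self _ _ m₂ g) (@SimpleFunc.measurableSet_fiber _ _ m₁ f)
        (@SimpleFunc.measurableSet_fiber _ _ m₂ g)
    · rw [dist_comm, dist_eq_norm, Prod.norm_def]
      exact max_lt hf' hg'
  rw [hS.closure_eq] at hmem
  simp only [S, Set.mem_ofPred_eq] at hmem
  rwa [hinner hξ2 hη2, hmean hξ2, hmean hη2, hnorm hξ2, hnorm hη2] at hmem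

end Covariance

/-! ### Summability of the initial correlations -/

section Mixing

lemma abs_mixing_quotient_le_one {Ω : Type*} [MeasurableSpace Ω] (μ : Measure Ω)
    [IsProbabilityMeasure μ] (A B : Set Ω) :
    |μ.real (A ∩ B) - μ.real A * μ.real B| ≤ μ.real B := by
  have h1 : μ.real (A ∩ B) ≤ μ.real B := measureReal_mono Set.inter_subset_right
  have h2 : μ.real A ≤ 1 := measureReal_le_one
  have h3 : 0 ≤ μ.real A := measureReal_nonneg
  have h4 : 0 ≤ μ.real B := measureReal_nonneg
  have h5 : 0 ≤ μ.real (A ∩ B) := measureReal_nonneg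
  exact abs_le.2 ⟨by nlinarith, by nlinarith⟩

variable (μ : Measure (PhaseSpace d n α))

lemma bddAbove_mixing [IsProbabilityMeasure μ] (r : ℝ) :
    BddAbove {c | ∃ S T : Set (Site d), (∀ x ∈ S, ∀ y ∈ T, r ≤ latNorm (x - y)) ∧
    ∃ A B : Set (PhaseSpace d n α),
      MeasurableSet[sigmaOn S] A ∧ MeasurableSet[sigmaOn T] B ∧ 0 < μ.real B ∧
      c = |μ.real (A ∩ B) - μ.real A * μ.real B| / μ.real B} := by
  refine ⟨1, ?_⟩
  rintro c ⟨S, T, -, A, B, -, -, hB, rfl⟩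
  rw [div_le_one hB]
  exact abs_mixing_quotient_le_one μ A B

lemma mixingCoeff_nonneg (r : ℝ) : 0 ≤ mixingCoeff μ r := by
  refine Real.sSup_nonneg ?_
  rintro c ⟨S, T, -, A, B, -, -, hB, rfl⟩
  positivity

lemma mixingCoeff_antitone [IsProbabilityMeasure μ] : Antitone (mixingCoeff μ) := by
  intro r s hrs
  refine csSup_le_csSup (bddAbove_mixing μ r) ?_ ?_
  · refine ⟨_, ∅, ∅, by simp, Set.univ, Set.univ, MeasurableSet.univ, MeasurableSet.univ, ?_, rfl⟩
    simp
  · rintro c ⟨S, T, h, hc⟩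
    exact ⟨S, T, fun x hx y hy => hrs.trans (h x hx y hy), hc⟩

lemma abs_le_mixingCoeff_mul [IsProbabilityMeasure μ] {S T : Set (Site d)} {r : ℝ}
    (h : ∀ x ∈ S, ∀ y ∈ T, r ≤ latNorm (x - y)) {A B : Set (PhaseSpace d n α)}
    (hA : MeasurableSet[sigmaOn S] A) (hB : MeasurableSet[sigmaOn T] B) :
    |μ.real (A ∩ B) - μ.real A * μ.real B| ≤ mixingCoeff μ r * μ.real B := by
  rcases (measureReal_nonneg (μ := μ) (s := B)).eq_or_lt with h0 | h0
  · have := abs_mixing_quotient_le_one μ A B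
    rw [← h0] at this ⊢
    simpa using this
  · rw [← div_le_iff₀ h0]
    exact le_csSup (bddAbove_mixing μ r) ⟨S, T, h, A, B, hA, hB, h0, rfl⟩

variable {μ}

lemma memLp_coord (hS2 : CondS2 μ) (x : Site d) (p : Fin 2 × Fin n) :
    MemLp (fun Y : PhaseSpace d n α => Y x p) 2 μ := by
  have hm : Measurable fun Y : PhaseSpace d n α => Y x p := (coord α x p).continuous.measurable
  rw [memLp_two_iff_integrable_sq hm.aestronglyMeasurable]
  refine (hS2 x).mono' (hm.pow_const 2).aestronglyMeasurable (Eventually.of_forall fun Y => ?_)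
  rw [Real.norm_eq_abs, abs_pow]
  gcongr
  exact PiLp.norm_apply_le (Y x) p

lemma sigmaOn_singleton (x : Site d) : (sigmaOn {x} : MeasurableSpace (PhaseSpace d n α)) =
    MeasurableSpace.comap (fun Y : PhaseSpace d n α => Y x) inferInstance := by
  simp [sigmaOn]

lemma sigmaOn_singleton_le (x : Site d) :
    (sigmaOn {x} : MeasurableSpace (PhaseSpace d n α)) ≤ borel _ := by
  rw [sigmaOn_singleton]
  exact (measurable_apply x).comap_le

lemma stronglyMeasurable_sigmaOn (x : Site d) (p : Fin 2 × Fin n) :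
    StronglyMeasurable[sigmaOn {x}] (fun Y : PhaseSpace d n α => Y x p) := by
  rw [sigmaOn_singleton]
  have h : Measurable[MeasurableSpace.comap (fun Y : PhaseSpace d n α => Y x) inferInstance]
      (fun Y : PhaseSpace d n α => Y x) := comap_measurable _
  have h2 : Measurable fun y : State n => y p := by fun_prop
  exact (h2.comp h).stronglyMeasurable

/-- The mixing condition makes the initial correlations summable. -/
lemma summable_corrDiff [IsProbabilityMeasure μ] (hd : 1 ≤ d) (hS0 : CondS0 μ) (hS1 : CondS1 μ)
    (hS2 : CondS2 μ) (hS3 : CondS3 μ) (i j : Fin 2) (k l : Fin n) :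
    Summable fun z : Site d => |corrDiff μ i j z k l| := by
  set h : ℝ → ℝ := fun r => Real.sqrt (mixingCoeff μ r)
  have hsum : Summable fun z : Site d => h (latNorm z) := by
    refine summable_latNorm_of_integrable (fun _ => Real.sqrt_nonneg _)
      (fun r s hrs => Real.sqrt_le_sqrt (mixingCoeff_antitone μ hrs)) ?_
    have : Nonempty (Fin d) := ⟨⟨0, hd⟩⟩
    rw [integrable_fun_norm_addHaar]
    simpa using hS3.2
  have hvar : ∀ (x : Site d) (i : Fin 2) (k : Fin n),
      ∫ Y : PhaseSpace d n α, Y x (i, k) ^ 2 ∂μ = corrDiff μ i i 0 k k := by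
    intro x i k
    have := congrFun (congrFun (hS1 i i x x) k) k
    rw [sub_self] at this
    rw [← this, corr]
    simp [sq]
  refine Summable.of_nonneg_of_le (fun _ => abs_nonneg _) (fun z => ?_)
    (hsum.mul_left (2 * Real.sqrt (corrDiff μ i i 0 k k) * Real.sqrt (corrDiff μ j j 0 l l)))
  have key := covariance_le_of_mixing (μ := μ) (sigmaOn_singleton_le z) (sigmaOn_singleton_le 0)
    (mixingCoeff_nonneg μ (latNorm z))
    (fun A B hA hB => abs_le_mixingCoeff_mul μ (by simp) hA hB)
    (stronglyMeasurable_sigmaOn z (i, k)) (stronglyMeasurable_sigmaOn 0 (j, l))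
    (memLp_coord hS2 z (i, k)) (memLp_coord hS2 0 (j, l))
  rw [hS0, zero_mul, sub_zero, hvar, hvar] at key
  refine le_trans (le_of_eq ?_) (key.trans (le_of_eq (by ring)))
  simp [corrDiff, corr]

end Mixing

/-! ### Fourier series on the torus -/

lemma phase_add (z w : Site d) (θ : Fin d → ℝ) : phase (z + w) θ = phase z θ + phase w θ := by
  simp [phase, add_mul, Finset.sum_add_distrib]

lemma phase_neg (z : Site d) (θ : Fin d → ℝ) : phase (-z) θ = -phase z θ := by
  simp [phase]

lemma phase_sub (z w : Site d) (θ : Fin d → ℝ) : phase (z - w) θ = phase z θ - phase w θ := by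
  rw [sub_eq_add_neg, phase_add, phase_neg, sub_eq_add_neg]

@[fun_prop]
lemma continuous_phase (z : Site d) : Continuous (phase z) := by
  unfold phase; fun_prop

lemma norm_exp_I_mul (r : ℝ) : ‖Complex.exp (Complex.I * (r : ℂ))‖ = 1 := by
  rw [mul_comm, Complex.norm_exp_ofReal_mul_I]

lemma norm_exp_neg_I_mul (r : ℝ) : ‖Complex.exp (-(Complex.I * (r : ℂ)))‖ = 1 := by
  rw [← mul_neg, ← Complex.ofReal_neg, norm_exp_I_mul]

lemma isCompact_cube (d : ℕ) : IsCompact (cube d) := isCompact_Icc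

instance : IsFiniteMeasure (volume.restrict (cube d)) :=
  ⟨by simpa using (isCompact_cube d).measure_lt_top⟩

lemma integrableOn_cube {F : (Fin d → ℝ) → ℂ} (h : Continuous F) : IntegrableOn F (cube d) :=
  h.continuousOn.integrableOn_compact (isCompact_cube d)

lemma integral_exp_int (w : ℤ) :
    ∫ x in Set.Icc (0 : ℝ) (2 * Real.pi), Complex.exp (Complex.I * ((w * x : ℝ) : ℂ))
      = if w = 0 then ((2 * Real.pi : ℝ) : ℂ) else 0 := by
  have hpi : (0 : ℝ) ≤ 2 * Real.pi := by positivity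
  rw [integral_Icc_eq_integral_Ioc, ← intervalIntegral.integral_of_le hpi]
  split_ifs with hw
  · subst hw
    simp
  · have hc : Complex.I * (w : ℂ) ≠ 0 := mul_ne_zero Complex.I_ne_zero (by exact_mod_cast hw)
    have h := integral_exp_mul_complex (a := 0) (b := 2 * Real.pi) hc
    have h1 : ∀ x : ℝ, Complex.exp (Complex.I * ((w * x : ℝ) : ℂ))
        = Complex.exp (Complex.I * (w : ℂ) * x) := by
      intro x; push_cast; ring_nf
    simp_rw [h1, h]
    have h2 : Complex.exp (Complex.I * (w : ℂ) * ((2 * Real.pi : ℝ) : ℂ)) = 1 := by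
      rw [Complex.exp_eq_one_iff]
      exact ⟨w, by push_cast; ring⟩
    rw [h2]
    simp

/-- Orthogonality of the characters of the torus. -/
lemma integral_exp_phase (w : Site d) :
    ∫ θ in cube d, Complex.exp (Complex.I * (phase w θ : ℂ))
      = if w = 0 then ((2 * Real.pi : ℝ) : ℂ) ^ d else 0 := by
  have h1 : ∀ θ : Fin d → ℝ, Complex.exp (Complex.I * (phase w θ : ℂ))
      = ∏ i, Complex.exp (Complex.I * (((w i : ℝ) * θ i : ℝ) : ℂ)) := by
    intro θ
    rw [← Complex.exp_sum, ← Finset.mul_sum, phase]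
    push_cast
    rfl
  have h2 : (volume : Measure (Fin d → ℝ)).restrict (cube d)
      = Measure.pi fun _ => volume.restrict (Set.Icc 0 (2 * Real.pi)) := by
    rw [← Measure.restrict_pi_pi, ← volume_pi, Set.pi_univ_Icc]
    rfl
  simp_rw [h1]
  rw [h2, integral_fintype_prod_eq_prod
    (f := fun i (x : ℝ) => Complex.exp (Complex.I * (((w i : ℝ) * x : ℝ) : ℂ)))]
  simp_rw [integral_exp_int]
  split_ifs with hw
  · subst hw
    simp
  · obtain ⟨i, hi⟩ := Function.ne_iff.1 hw
    exact Finset.prod_eq_zero (Finset.mem_univ i) (by simpa using hi)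

/-- The normalized integral over the torus. -/
def torusAvg (F : (Fin d → ℝ) → ℂ) : ℂ := ((2 * Real.pi : ℝ) ^ d : ℂ)⁻¹ * ∫ θ in cube d, F θ

lemma torusAvg_exp_phase (w : Site d) :
    torusAvg (fun θ => Complex.exp (Complex.I * (phase w θ : ℂ))) = if w = 0 then 1 else 0 := by
  rw [torusAvg, integral_exp_phase]
  split_ifs
  · rw [inv_mul_cancel₀]
    exact pow_ne_zero _ (by exact_mod_cast Real.two_pi_pos.ne')
  · simp

lemma torusAvg_const_mul (c : ℂ) (F : (Fin d → ℝ) → ℂ) :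
    torusAvg (fun θ => c * F θ) = c * torusAvg F := by
  rw [torusAvg, torusAvg, integral_const_mul]
  ring

lemma torusAvg_sum {ι : Type*} (s : Finset ι) {F : ι → (Fin d → ℝ) → ℂ}
    (hF : ∀ i ∈ s, Continuous (F i)) :
    torusAvg (fun θ => ∑ i ∈ s, F i θ) = ∑ i ∈ s, torusAvg (F i) := by
  simp only [torusAvg]
  rw [integral_finsetSum _ fun i hi => integrableOn_cube (hF i hi), Finset.mul_sum]

/-- Termwise integration over the torus. -/
lemma hasSum_torusAvg {ι : Type*} [Countable ι] {F : ι → (Fin d → ℝ) → ℂ} {G : (Fin d → ℝ) → ℂ}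
    {b : ι → ℝ} (hF : ∀ i, Continuous (F i)) (hb : Summable b)
    (hle : ∀ i, ∀ θ ∈ cube d, ‖F i θ‖ ≤ b i) (hs : ∀ θ, HasSum (fun i => F i θ) (G θ)) :
    HasSum (fun i => torusAvg (F i)) (torusAvg G) := by
  have h := hasSum_integral_of_summable_integral_norm (μ := volume.restrict (cube d))
    (fun i => integrableOn_cube (hF i)) ?_
  · have hG : ∀ θ, ∑' i, F i θ = G θ := fun θ => (hs θ).tsum_eq
    simp_rw [hG] at h
    exact h.mul_left _
  · refine Summable.of_nonneg_of_le (fun i => integral_nonneg fun θ => norm_nonneg _)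
      (fun i => ?_) (hb.mul_left (volume.real (cube d)))
    refine (integral_mono_ae (integrableOn_cube (hF i)).norm (integrable_const (b i)) ?_).trans ?_
    · exact (ae_restrict_iff' measurableSet_Icc).2 (Eventually.of_forall fun θ hθ => hle i θ hθ)
    · simp [mul_comm]

/-- The Fourier series of a scalar function on the lattice. -/
def fourierSum (a : Site d → ℝ) (θ : Fin d → ℝ) : ℂ :=
  ∑' z, (a z : ℂ) * Complex.exp (Complex.I * (phase z θ : ℂ))

lemma norm_fourierSum_term (a : Site d → ℝ) (θ : Fin d → ℝ) (z : Site d) :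
    ‖(a z : ℂ) * Complex.exp (Complex.I * (phase z θ : ℂ))‖ = |a z| := by
  rw [norm_mul, norm_exp_I_mul, mul_one, Complex.norm_real, Real.norm_eq_abs]

lemma hasSum_fourierSum {a : Site d → ℝ} (ha : Summable fun z => |a z|) (θ : Fin d → ℝ) :
    HasSum (fun z => (a z : ℂ) * Complex.exp (Complex.I * (phase z θ : ℂ))) (fourierSum a θ) :=
  (Summable.of_norm (by simpa only [norm_fourierSum_term] using ha)).hasSum

lemma continuous_fourierSum {a : Site d → ℝ} (ha : Summable fun z => |a z|) :
    Continuous (fourierSum a) :=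
  continuous_tsum (fun z => by fun_prop) ha fun z θ => (norm_fourierSum_term a θ z).le

lemma torusAvg_fourierSum {a : Site d → ℝ} (ha : Summable fun z => |a z|) (z : Site d) :
    torusAvg (fun θ => Complex.exp (-(Complex.I * (phase z θ : ℂ))) * fourierSum a θ) = a z := by
  have h := hasSum_torusAvg (d := d)
    (F := fun w θ => Complex.exp (-(Complex.I * (phase z θ : ℂ))) *
      ((a w : ℂ) * Complex.exp (Complex.I * (phase w θ : ℂ)))) (b := fun w => |a w|)
    (fun w => by fun_prop) ha
    (fun w θ _ => by rw [norm_mul, norm_exp_neg_I_mul, one_mul, norm_fourierSum_term])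
    (fun θ => (hasSum_fourierSum ha θ).mul_left _)
  refine h.unique ?_
  have h2 : ∀ w, torusAvg (fun θ => Complex.exp (-(Complex.I * (phase z θ : ℂ))) *
      ((a w : ℂ) * Complex.exp (Complex.I * (phase w θ : ℂ)))) = if w = z then (a z : ℂ) else 0 := by
    intro w
    have h3 : ∀ θ : Fin d → ℝ, Complex.exp (-(Complex.I * (phase z θ : ℂ))) *
        ((a w : ℂ) * Complex.exp (Complex.I * (phase w θ : ℂ)))
        = (a w : ℂ) * Complex.exp (Complex.I * (phase (w - z) θ : ℂ)) := by
      intro θ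
      rw [mul_left_comm, ← Complex.exp_add, phase_sub]
      push_cast
      ring_nf
    simp_rw [h3, torusAvg_const_mul, torusAvg_exp_phase, sub_eq_zero]
    split_ifs with hw
    · rw [hw, mul_one]
    · simp
  simp_rw [h2]
  exact hasSum_ite_eq z _

lemma torusFourier_apply (f : Site d → Matrix (Fin n) (Fin n) ℝ) (θ : Fin d → ℝ) (k l : Fin n) :
    torusFourier f θ k l = fourierSum (fun z => f z k l) θ := rfl

/-! ### Second moments in a larger phase space -/

section SecondMoment

variable {μ : Measure (PhaseSpace d n α)}

lemma integral_norm_sq_apply (hS1 : CondS1 μ) (hS2 : CondS2 μ) (x : Site d) :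
    ∫ Y : PhaseSpace d n α, ‖Y x‖ ^ 2 ∂μ = ∑ p : Fin 2 × Fin n, corrDiff μ p.1 p.1 0 p.2 p.2 := by
  have h : ∀ Y : PhaseSpace d n α, ‖Y x‖ ^ 2 = ∑ p, Y x p ^ 2 := fun Y => by
    simp [EuclideanSpace.norm_sq_eq]
  simp_rw [h]
  rw [integral_finsetSum _ fun p _ => (memLp_coord hS2 x p).integrable_sq]
  refine Finset.sum_congr rfl fun p _ => ?_
  have := congrFun (congrFun (hS1 p.1 p.1 x x) p.2) p.2
  rw [sub_self] at this
  rw [← this, corr]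
  simp [sq]

/-- For sufficiently negative weights the mean square norm is finite. -/
lemma integrable_norm_incl_sq (hS1 : CondS1 μ) (hS2 : CondS2 μ) {β : ℝ} (hβα : β ≤ α)
    (hβ : β ≤ -d) : Integrable (fun Y : PhaseSpace d n α => ‖incl hβα Y‖ ^ 2) μ := by
  refine ⟨((incl hβα).continuous.norm.pow 2).measurable.aestronglyMeasurable, ?_⟩
  have h1 : ∀ Y : PhaseSpace d n α, ‖‖incl hβα Y‖ ^ 2‖ₑ =
      ∑' x, ENNReal.ofReal (‖Y x‖ ^ 2 * (1 + latNorm x ^ 2) ^ β) := by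
    intro Y
    rw [Real.enorm_of_nonneg (by positivity), norm_sq_eq]
    exact ENNReal.ofReal_tsum_of_nonneg (fun x => by positivity) (summable_norm_sq (incl hβα Y))
  rw [HasFiniteIntegral]
  simp_rw [h1]
  rw [lintegral_tsum fun x =>
    (((measurable_apply x).norm.pow_const 2).mul_const _).ennreal_ofReal.aemeasurable]
  have h2 : ∀ x : Site d, ∫⁻ Y : PhaseSpace d n α,
      ENNReal.ofReal (‖Y x‖ ^ 2 * (1 + latNorm x ^ 2) ^ β) ∂μ
      = ENNReal.ofReal ((∑ p : Fin 2 × Fin n, corrDiff μ p.1 p.1 0 p.2 p.2) *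
          (1 + latNorm x ^ 2) ^ β) := by
    intro x
    rw [← ofReal_integral_eq_lintegral_ofReal ((hS2 x).mul_const _)
      (Eventually.of_forall fun Y => by positivity), integral_mul_const,
      integral_norm_sq_apply hS1 hS2]
  simp_rw [h2]
  have h3 : 0 ≤ ∑ p : Fin 2 × Fin n, corrDiff μ p.1 p.1 0 p.2 p.2 := by
    rw [← integral_norm_sq_apply hS1 hS2 0]
    exact integral_nonneg fun Y => by positivity
  rw [← ENNReal.ofReal_tsum_of_nonneg (fun x => by positivity)
    ((summable_one_add_latNorm_sq d hβ).mul_left _)]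
  exact ENNReal.ofReal_lt_top

end SecondMoment

/-! ### Spectral representation of the covariances -/

section Spectral

variable {β : ℝ} (μ : Measure (PhaseSpace d n α)) (hβ : β ≤ α)

/-- The covariance `E ((K Y)(x)_p (L Y)(y)_q)` for bounded operators `K`, `L` on a larger phase
space. -/
def covar (K L : PhaseSpace d n β →L[ℝ] PhaseSpace d n β) (x : Site d) (p : Fin 2 × Fin n)
    (y : Site d) (q : Fin 2 × Fin n) : ℝ :=
  ∫ Y, K (incl hβ Y) x p * L (incl hβ Y) y q ∂μ

variable {μ} {hβ}

lemma covar_comm (K L : PhaseSpace d n β →L[ℝ] PhaseSpace d n β) (x : Site d)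
    (p : Fin 2 × Fin n) (y : Site d) (q : Fin 2 × Fin n) :
    covar μ hβ K L x p y q = covar μ hβ L K y q x p := by
  simp only [covar, mul_comm]

lemma norm_covar_integrand_le (K L : PhaseSpace d n β →L[ℝ] PhaseSpace d n β) (x : Site d)
    (p : Fin 2 × Fin n) (y : Site d) (q : Fin 2 × Fin n) (Y : PhaseSpace d n α) :
    ‖K (incl hβ Y) x p * L (incl hβ Y) y q‖ ≤
      ‖coord β x p‖ * ‖K‖ * (‖coord β y q‖ * ‖L‖) * ‖incl hβ Y‖ ^ 2 := by
  have h : ∀ (K : PhaseSpace d n β →L[ℝ] PhaseSpace d n β) x p,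
      ‖K (incl hβ Y) x p‖ ≤ ‖coord β x p‖ * (‖K‖ * ‖incl hβ Y‖) := fun K x p =>
    ((coord β x p).le_opNorm _).trans (by gcongr; exact K.le_opNorm _)
  rw [norm_mul]
  calc _ ≤ (‖coord β x p‖ * (‖K‖ * ‖incl hβ Y‖)) * (‖coord β y q‖ * (‖L‖ * ‖incl hβ Y‖)) := by
        gcongr <;> apply h
    _ = _ := by ring

lemma integrable_covar (hμ : Integrable (fun Y : PhaseSpace d n α => ‖incl hβ Y‖ ^ 2) μ)
    (K L : PhaseSpace d n β →L[ℝ] PhaseSpace d n β) (x : Site d)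
    (p : Fin 2 × Fin n) (y : Site d) (q : Fin 2 × Fin n) :
    Integrable (fun Y : PhaseSpace d n α => K (incl hβ Y) x p * L (incl hβ Y) y q) μ := by
  refine (hμ.const_mul _).mono' (Continuous.measurable ?_).aestronglyMeasurable
    (Eventually.of_forall (norm_covar_integrand_le K L x p y q))
  have h : ∀ (K : PhaseSpace d n β →L[ℝ] PhaseSpace d n β) x p,
      Continuous fun Y : PhaseSpace d n α => K (incl hβ Y) x p := fun K x p =>
    (coord β x p).continuous.comp (K.continuous.comp (incl hβ).continuous)
  exact (h K x p).mul (h L y q)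

/-- The covariance is a continuous linear function of the first operator. -/
def covarCLM (hμ : Integrable (fun Y : PhaseSpace d n α => ‖incl hβ Y‖ ^ 2) μ)
    (L : PhaseSpace d n β →L[ℝ] PhaseSpace d n β) (x : Site d)
    (p : Fin 2 × Fin n) (y : Site d) (q : Fin 2 × Fin n) :
    (PhaseSpace d n β →L[ℝ] PhaseSpace d n β) →L[ℝ] ℝ :=
  LinearMap.mkContinuous
    { toFun := fun K => covar μ hβ K L x p y q
      map_add' := fun K K' => by
        simp only [covar]
        rw [← integral_add (integrable_covar hμ K L x p y q) (integrable_covar hμ K' L x p y q)]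
        refine integral_congr_ae (Eventually.of_forall fun Y => ?_)
        exact add_mul (K (incl hβ Y) x p) (K' (incl hβ Y) x p) _
      map_smul' := fun c K => by
        simp only [covar, RingHom.id_apply, smul_eq_mul]
        rw [← integral_const_mul]
        refine integral_congr_ae (Eventually.of_forall fun Y => ?_)
        exact mul_assoc c (K (incl hβ Y) x p) _ }
    (‖coord β x p‖ * (‖coord β y q‖ * ‖L‖) * ∫ Y : PhaseSpace d n α, ‖incl hβ Y‖ ^ 2 ∂μ)
    fun K => by
      refine (norm_integral_le_of_norm_le (hμ.const_mul _)
        (Eventually.of_forall (norm_covar_integrand_le K L x p y q))).trans (le_of_eq ?_)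
      rw [integral_const_mul]
      ring

lemma covarCLM_apply (hμ : Integrable (fun Y : PhaseSpace d n α => ‖incl hβ Y‖ ^ 2) μ)
    (K L : PhaseSpace d n β →L[ℝ] PhaseSpace d n β) (x : Site d)
    (p : Fin 2 × Fin n) (y : Site d) (q : Fin 2 × Fin n) :
    covarCLM hμ L x p y q K = covar μ hβ K L x p y q := rfl

lemma covarCLM_shiftOp_comp (hμ : Integrable (fun Y : PhaseSpace d n α => ‖incl hβ Y‖ ^ 2) μ)
    (K L : PhaseSpace d n β →L[ℝ] PhaseSpace d n β) (x : Site d)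
    (p : Fin 2 × Fin n) (y : Site d) (q : Fin 2 × Fin n) (w : Site d) (r s : Fin 2 × Fin n) :
    covarCLM hμ L x p y q ((shiftOp β w r s).comp K) =
      if p = r then covar μ hβ K L (x - w) s y q else 0 := by
  rw [covarCLM_apply]
  simp only [covar, ContinuousLinearMap.comp_apply, shiftOp_apply]
  split_ifs <;> simp

variable (μ hβ) in
/-- `f` is the spectral density of the joint covariances of `K Y` and `L Y`, which are translation
invariant. -/
def HasSpectralDensity (K L : PhaseSpace d n β →L[ℝ] PhaseSpace d n β)
    (f : (Fin d → ℝ) → Matrix (Fin 2 × Fin n) (Fin 2 × Fin n) ℂ) : Prop :=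
  ∀ x p y q, (covar μ hβ K L x p y q : ℂ) =
    torusAvg fun θ => Complex.exp (-(Complex.I * (phase (x - y) θ : ℂ))) * f θ p q

/-- The symbol of the generator. -/
def symbol (V : Interaction d n) (θ : Fin d → ℝ) : Matrix (Fin 2 × Fin n) (Fin 2 × Fin n) ℂ :=
  Matrix.of fun p q => fourierSum (fun w => genKernel V w p q) θ

lemma continuous_symbol {V : Interaction d n} (hE1 : CondE1 V) : Continuous (symbol V) :=
  continuous_matrix fun p q => continuous_fourierSum (summable_abs_genKernel hE1 p q)

lemma torusAvg_conj (F : (Fin d → ℝ) → ℂ) :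
    torusAvg (fun θ => star (F θ)) = star (torusAvg F) := by
  rw [torusAvg, torusAvg, star_mul', star_inv₀]
  congr 1
  · simp
  · exact integral_conj

lemma HasSpectralDensity.symm {K L : PhaseSpace d n β →L[ℝ] PhaseSpace d n β}
    {f : (Fin d → ℝ) → Matrix (Fin 2 × Fin n) (Fin 2 × Fin n) ℂ}
    (h : HasSpectralDensity μ hβ K L f) :
    HasSpectralDensity μ hβ L K fun θ => (f θ).conjTranspose := by
  intro x p y q
  have h1 := congrArg star (h y q x p)
  rw [← torusAvg_conj] at h1
  rw [covar_comm]
  refine Eq.trans ?_ (h1.trans ?_)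
  · simp
  · congr 1
    funext θ
    change _ = _ * star (f θ q p)
    rw [star_mul']
    congr 1
    rw [← neg_sub x y, phase_neg]
    simp [← Complex.exp_conj]

/-- Application of the generator multiplies the spectral density by the symbol. -/
lemma HasSpectralDensity.genOp_comp {V : Interaction d n} (hE1 : CondE1 V)
    (hμ : Integrable (fun Y : PhaseSpace d n α => ‖incl hβ Y‖ ^ 2) μ)
    {K L : PhaseSpace d n β →L[ℝ] PhaseSpace d n β}
    {f : (Fin d → ℝ) → Matrix (Fin 2 × Fin n) (Fin 2 × Fin n) ℂ} (hf : Continuous f)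
    (h : HasSpectralDensity μ hβ K L f) :
    HasSpectralDensity μ hβ ((genOp V β).comp K) L fun θ => symbol V θ * f θ := by
  intro x p y q
  have hfc : ∀ r, Continuous fun θ => f θ r q := fun r => hf.matrix_elem r q
  have h1 : HasSum (fun w => ∑ s, genKernel V w p s * covar μ hβ K L (x - w) s y q)
      (covar μ hβ ((genOp V β).comp K) L x p y q) := by
    have := (covarCLM hμ L x p y q).hasSum
      (((ContinuousLinearMap.compL ℝ (PhaseSpace d n β) (PhaseSpace d n β)
        (PhaseSpace d n β)).flip K).hasSum (summable_genOp hE1 β).hasSum)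
    refine Eq.mp (congrArg (fun f => HasSum f _) (funext fun w => ?_)) this
    simp only [ContinuousLinearMap.flip_apply, ContinuousLinearMap.compL_apply, map_sum, map_smul,
      covarCLM_shiftOp_comp,
      smul_eq_mul, mul_ite, mul_zero]
    rw [Finset.sum_comm]
    simp
  have hbd : ∀ r, ∃ B, ∀ θ ∈ cube d, ‖f θ r q‖ ≤ B := fun r =>
    (isCompact_cube d).exists_bound_of_continuousOn (hfc r).continuousOn
  choose B hB using hbd
  have h2 : HasSum (fun w => torusAvg fun θ => Complex.exp (-(Complex.I * (phase (x - y) θ : ℂ))) *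
        ∑ s, ((genKernel V w p s : ℂ) * Complex.exp (Complex.I * (phase w θ : ℂ))) * f θ s q)
      (torusAvg fun θ => Complex.exp (-(Complex.I * (phase (x - y) θ : ℂ))) *
        (symbol V θ * f θ) p q) := by
    refine hasSum_torusAvg (b := fun w => ∑ s, |genKernel V w p s| * B s)
      (fun w => by fun_prop)
      (summable_sum fun s _ => (summable_abs_genKernel hE1 p s).mul_right _) ?_ ?_
    · intro w θ hθ
      rw [norm_mul, norm_exp_neg_I_mul, one_mul]
      refine (norm_sum_le _ _).trans (Finset.sum_le_sum fun s _ => ?_)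
      rw [norm_mul, norm_fourierSum_term (fun w => genKernel V w p s)]
      gcongr
      exact hB s θ hθ
    · intro θ
      refine HasSum.mul_left _ ?_
      rw [Matrix.mul_apply]
      exact hasSum_sum fun s _ =>
        (hasSum_fourierSum (summable_abs_genKernel hE1 p s) θ).mul_right _
  have h1' := Complex.hasSum_ofReal.2 h1
  refine h1'.unique (Eq.mp (congrArg (fun f => HasSum f _) (funext fun w => ?_)) h2)
  push_cast
  simp_rw [Finset.mul_sum]
  rw [torusAvg_sum _ fun s _ => by fun_prop]
  refine Finset.sum_congr rfl fun s _ => ?_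
  rw [h (x - w) s y q, ← torusAvg_const_mul]
  congr 1
  funext θ
  have : Complex.exp (-(Complex.I * (phase (x - w - y) θ : ℂ))) =
      Complex.exp (-(Complex.I * (phase (x - y) θ : ℂ))) *
        Complex.exp (Complex.I * (phase w θ : ℂ)) := by
    rw [← Complex.exp_add, phase_sub, phase_sub, phase_sub]
    push_cast
    ring_nf
  rw [this]
  ring

lemma HasSpectralDensity.genOp_pow_comp {V : Interaction d n} (hE1 : CondE1 V)
    (hμ : Integrable (fun Y : PhaseSpace d n α => ‖incl hβ Y‖ ^ 2) μ)
    {K L : PhaseSpace d n β →L[ℝ] PhaseSpace d n β}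
    {f : (Fin d → ℝ) → Matrix (Fin 2 × Fin n) (Fin 2 × Fin n) ℂ} (hf : Continuous f)
    (h : HasSpectralDensity μ hβ K L f) (m : ℕ) :
    HasSpectralDensity μ hβ ((genOp V β ^ m).comp K) L fun θ => symbol V θ ^ m * f θ := by
  induction m with
  | zero =>
    have : (1 : PhaseSpace d n β →L[ℝ] PhaseSpace d n β).comp K = K := rfl
    simpa [this] using h
  | succ m ih =>
    have hc : Continuous fun θ => symbol V θ ^ m * f θ :=
      ((continuous_symbol hE1).pow m).mul hf
    have := ih.genOp_comp hE1 hμ hc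
    simpa only [pow_succ', ContinuousLinearMap.mul_def, ContinuousLinearMap.comp_assoc,
      Matrix.mul_assoc] using this

section

open scoped Matrix.Norms.Operator

lemma norm_entry_le_linfty {ι : Type*} [Fintype ι] (A : Matrix ι ι ℂ) (i j : ι) :
    ‖A i j‖ ≤ ‖A‖ := by
  rw [← coe_nnnorm, ← coe_nnnorm, NNReal.coe_le_coe, Matrix.linfty_opNNNorm_def]
  exact (Finset.single_le_sum (f := fun j => ‖A i j‖₊) (fun _ _ => by positivity)
    (Finset.mem_univ j)).trans
      (Finset.le_sup (f := fun i => ∑ j, ‖A i j‖₊) (Finset.mem_univ i))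

lemma continuous_exp_smul_symbol {V : Interaction d n} (hE1 : CondE1 V) (t : ℝ) :
    Continuous fun θ => NormedSpace.exp ((t : ℂ) • symbol V θ) := by
  have h : Continuous fun θ => (t : ℂ) • symbol V θ := (continuous_symbol hE1).const_smul (t : ℂ)
  exact NormedSpace.exp_continuous.comp h

/-- The time evolution multiplies the spectral density by the exponential of the symbol. -/
lemma HasSpectralDensity.evol_comp {V : Interaction d n} (hE1 : CondE1 V)
    (hμ : Integrable (fun Y : PhaseSpace d n α => ‖incl hβ Y‖ ^ 2) μ)
    {K L : PhaseSpace d n β →L[ℝ] PhaseSpace d n β}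
    {f : (Fin d → ℝ) → Matrix (Fin 2 × Fin n) (Fin 2 × Fin n) ℂ} (hf : Continuous f)
    (h : HasSpectralDensity μ hβ K L f) (t : ℝ) :
    HasSpectralDensity μ hβ ((evol V β t).comp K) L
      fun θ => NormedSpace.exp ((t : ℂ) • symbol V θ) * f θ := by
  intro x p y q
  have h1 : HasSum (fun m : ℕ => (m.factorial : ℝ)⁻¹ * (t ^ m *
      covar μ hβ ((genOp V β ^ m).comp K) L x p y q)) (covar μ hβ ((evol V β t).comp K) L x p y q) := by
    have := (covarCLM hμ L x p y q).hasSum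
      (((ContinuousLinearMap.compL ℝ (PhaseSpace d n β) (PhaseSpace d n β)
        (PhaseSpace d n β)).flip K).hasSum
          (NormedSpace.exp_series_hasSum_exp' (𝕂 := ℝ) (t • genOp V β)))
    refine Eq.mp (congrArg (fun f => HasSum f _) (funext fun m => ?_)) this
    simp only [ContinuousLinearMap.flip_apply, ContinuousLinearMap.compL_apply, map_smul,
      smul_pow, covarCLM_apply, smul_eq_mul]
  obtain ⟨M, hM⟩ := (isCompact_cube d).exists_bound_of_continuousOn
    (continuous_symbol hE1).continuousOn
  obtain ⟨B, hB⟩ := (isCompact_cube d).exists_bound_of_continuousOn hf.continuousOn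
  have hpow : ∀ m, Continuous fun θ => symbol V θ ^ m * f θ := fun m =>
    ((continuous_symbol hE1).pow m).mul hf
  have hterm : ∀ (m : ℕ) θ, θ ∈ cube d → ‖(symbol V θ ^ m * f θ) p q‖ ≤ M ^ m * B := by
    intro m θ hθ
    have h0 : ‖symbol V θ ^ m‖ ≤ M ^ m := by
      rcases isEmpty_or_nonempty (Fin 2 × Fin n) with hn | hn
      · exact hn.elim p
      · exact (norm_pow_le _ m).trans (pow_le_pow_left₀ (norm_nonneg _) (hM θ hθ) m)
    exact (norm_entry_le_linfty _ p q).trans ((norm_mul_le _ _).trans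
      (mul_le_mul h0 (hB θ hθ) (norm_nonneg _) ((norm_nonneg _).trans h0)))
  have h2 : HasSum (fun m : ℕ => torusAvg fun θ => (((m.factorial : ℝ)⁻¹ * t ^ m : ℝ) : ℂ) *
      (Complex.exp (-(Complex.I * (phase (x - y) θ : ℂ))) * (symbol V θ ^ m * f θ) p q))
      (torusAvg fun θ => Complex.exp (-(Complex.I * (phase (x - y) θ : ℂ))) *
        (NormedSpace.exp ((t : ℂ) • symbol V θ) * f θ) p q) := by
    refine hasSum_torusAvg (b := fun m => (|t| * M) ^ m / m.factorial * B)
      (fun m => ?_) ((Real.summable_pow_div_factorial _).mul_right _) ?_ ?_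
    · have := (hpow m).matrix_elem p q
      fun_prop
    · intro m θ hθ
      rw [norm_mul, norm_mul, norm_exp_neg_I_mul, one_mul, Complex.norm_real, norm_mul, norm_inv,
        norm_pow, Real.norm_eq_abs t, Real.norm_of_nonneg (by positivity : (0 : ℝ) ≤ m.factorial)]
      calc _ ≤ ((m.factorial : ℝ)⁻¹ * |t| ^ m) * (M ^ m * B) := by gcongr; exact hterm m θ hθ
        _ = _ := by rw [mul_pow]; ring
    · intro θ
      have h3 := (NormedSpace.exp_series_hasSum_exp' (𝕂 := ℂ) ((t : ℂ) • symbol V θ)).mul_right (f θ)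
      have h4 := Pi.hasSum.1 (Pi.hasSum.1 h3 p) q
      refine Eq.mp (congrArg (fun f => HasSum f _) (funext fun m => ?_)) (h4.mul_left
        (Complex.exp (-(Complex.I * (phase (x - y) θ : ℂ)))))
      simp only [smul_pow, Matrix.smul_mul, Matrix.smul_apply, smul_eq_mul]
      push_cast
      ring
  have h1' := Complex.hasSum_ofReal.2 h1
  refine h1'.unique (Eq.mp (congrArg (fun f => HasSum f _) (funext fun m => ?_)) h2)
  rw [torusAvg_const_mul, ← h.genOp_pow_comp hE1 hμ hf m x p y q]
  push_cast
  ring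

end

end Spectral

/-- The initial spectral density as a matrix of size `2n`. -/
def qBlock (μ : Measure (PhaseSpace d n α)) (θ : Fin d → ℝ) :
    Matrix (Fin 2 × Fin n) (Fin 2 × Fin n) ℂ :=
  Matrix.of fun p q => qHat μ p.1 q.1 θ p.2 q.2

/-- The spectral density at time `t`. -/
def qBlockAt (V : Interaction d n) (μ : Measure (PhaseSpace d n α)) (t : ℝ) (θ : Fin d → ℝ) :
    Matrix (Fin 2 × Fin n) (Fin 2 × Fin n) ℂ :=
  NormedSpace.exp ((t : ℂ) • symbol V θ) * qBlock μ θ *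
    (NormedSpace.exp ((t : ℂ) • symbol V θ)).conjTranspose

section Correlations

variable {μ : Measure (PhaseSpace d n α)}

lemma continuous_qBlock (hsum : ∀ i j k l, Summable fun z : Site d => |corrDiff μ i j z k l|) :
    Continuous (qBlock μ) :=
  continuous_matrix fun p q => continuous_fourierSum (hsum p.1 q.1 p.2 q.2)

lemma continuous_qBlockAt {V : Interaction d n} (hE1 : CondE1 V)
    (hsum : ∀ i j k l, Summable fun z : Site d => |corrDiff μ i j z k l|) (t : ℝ) :
    Continuous (qBlockAt V μ t) :=
  ((continuous_exp_smul_symbol hE1 t).mul (continuous_qBlock hsum)).mul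
    (continuous_exp_smul_symbol hE1 t).matrix_conjTranspose

lemma hasSpectralDensity_one (hS1 : CondS1 μ)
    (hsum : ∀ i j k l, Summable fun z : Site d => |corrDiff μ i j z k l|) {β : ℝ} (hβ : β ≤ α) :
    HasSpectralDensity μ hβ 1 1 (qBlock μ) := by
  intro x p y q
  have h1 : covar μ hβ 1 1 x p y q = corrDiff μ p.1 q.1 (x - y) p.2 q.2 :=
    congrFun (congrFun (hS1 p.1 q.1 x y) p.2) q.2
  rw [h1]
  exact (torusAvg_fourierSum (hsum p.1 q.1 p.2 q.2) (x - y)).symm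

/-- The correlations at time `t` in terms of the initial spectral density. -/
lemma integrable_and_correlation_eq {V : Interaction d n} (hE1 : CondE1 V) (hS1 : CondS1 μ)
    (hS2 : CondS2 μ) (hsum : ∀ i j k l, Summable fun z : Site d => |corrDiff μ i j z k l|)
    (t : ℝ) (x : Site d) (p : Fin 2 × Fin n) (y : Site d) (q : Fin 2 × Fin n) :
    Integrable (fun Y : PhaseSpace d n α => Y x p * Y y q) (law V μ t) ∧
      ((∫ Y, Y x p * Y y q ∂(law V μ t) : ℝ) : ℂ) = torusAvg fun θ =>
        Complex.exp (-(Complex.I * (phase (x - y) θ : ℂ))) * qBlockAt V μ t θ p q := by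
  have hβ : min α (-d) ≤ α := min_le_left _ _
  have hμ := integrable_norm_incl_sq hS1 hS2 hβ (min_le_right _ _)
  have hflow : flow V t = evol V α t := funext fun Y => flow_eq_evol hE1 t Y
  have hmeas : Measurable (flow V t : PhaseSpace d n α → PhaseSpace d n α) := by
    rw [hflow]; exact (evol V α t).continuous.measurable
  have hcont : Continuous fun Y : PhaseSpace d n α => Y x p * Y y q :=
    (coord α x p).continuous.mul (coord α y q).continuous
  have heq : ∀ Y : PhaseSpace d n α, flow V t Y x p * flow V t Y y q
      = evol V (min α (-d)) t (incl hβ Y) x p * evol V (min α (-d)) t (incl hβ Y) y q := by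
    intro Y
    rw [evol_incl hE1, flow_eq_evol hE1]
    rfl
  have hfun : ((fun Y : PhaseSpace d n α => Y x p * Y y q) ∘ flow V t) =
      fun Y => evol V (min α (-d)) t (incl hβ Y) x p * evol V (min α (-d)) t (incl hβ Y) y q :=
    funext heq
  constructor
  · rw [law, integrable_map_measure hcont.measurable.aestronglyMeasurable hmeas.aemeasurable, hfun]
    exact integrable_covar hμ _ _ x p y q
  · have hq := continuous_qBlock hsum
    have hG := continuous_exp_smul_symbol hE1 t
    have h1 := (hasSpectralDensity_one hS1 hsum hβ).evol_comp hE1 hμ hq t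
    have h2 := h1.symm.evol_comp hE1 hμ (hG.mul hq).matrix_conjTranspose t
    have h3 := h2.symm x p y q
    rw [law, integral_map hmeas.aemeasurable hcont.measurable.aestronglyMeasurable]
    simp_rw [heq]
    refine Eq.trans h3 ?_
    simp only [Matrix.conjTranspose_mul, Matrix.conjTranspose_conjTranspose, qBlockAt]
    rfl

end Correlations

/-! ### Zero sets of real-analytic functions -/

lemma volume_zeros_analytic_line {g : ℝ → ℝ} {I : Set ℝ} (hI : IsOpen I) (hc : IsPreconnected I)
    (hg : AnalyticOnNhd ℝ g I) {r : ℝ} (hr : r ∈ I) (h0 : g r ≠ 0) :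
    volume (I ∩ g ⁻¹' {0}) = 0 := by
  have h1 : g ⁻¹' {0}ᶜ ∈ codiscreteWithin I :=
    hg.preimage_zero_mem_codiscreteWithin h0 hr ⟨⟨r, hr⟩, hc⟩
  have h2 := ae_restrict_le_codiscreteWithin (μ := volume) hI.measurableSet h1
  rw [mem_ae_iff, Measure.restrict_apply' hI.measurableSet] at h2
  rw [Set.inter_comm]
  simpa using h2

section NullZeros

variable {E : Type*} [NormedAddCommGroup E] [NormedSpace ℝ E] [FiniteDimensional ℝ E]
  [MeasurableSpace E] [BorelSpace E] (μ : Measure E) [μ.IsAddHaarMeasure]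

/-- A set is a null set if its intersections with the lines through the origin are, by integration in
polar coordinates. -/
lemma measure_zero_of_rays [Nontrivial E] {Z : Set E} (hZ : MeasurableSet Z)
    (h : ∀ s : E, volume {r : ℝ | r • s ∈ Z} = 0) : μ Z = 0 := by
  have hmp := μ.measurePreserving_homeomorphUnitSphereProd
  have h1 : μ (Z ∩ {0}ᶜ) = 0 := by
    have hme : MeasurableSet ((homeomorphUnitSphereProd E).symm ⁻¹' (Subtype.val ⁻¹' Z)) :=
      (homeomorphUnitSphereProd E).symm.measurable (measurable_subtype_coe hZ)
    have h2 : (μ.comap (Subtype.val : ({0}ᶜ : Set E) → E)) (Subtype.val ⁻¹' Z) = μ (Z ∩ {0}ᶜ) := by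
      rw [comap_subtype_coe_apply (measurableSet_singleton _).compl, Subtype.image_preimage_coe,
        Set.inter_comm]
    rw [← h2]
    have h3 : (Subtype.val ⁻¹' Z : Set ({0}ᶜ : Set E)) = homeomorphUnitSphereProd E ⁻¹'
        ((homeomorphUnitSphereProd E).symm ⁻¹' (Subtype.val ⁻¹' Z)) := by
      ext x; simp
    rw [h3, hmp.measure_preimage hme.nullMeasurableSet, Measure.measure_prod_null hme]
    refine Eventually.of_forall fun s => ?_
    refine withDensity_absolutelyContinuous _ _ ?_
    rw [comap_subtype_coe_apply measurableSet_Ioi]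
    refine measure_mono_null ?_ (h s)
    rintro _ ⟨r, hr, rfl⟩
    simpa using hr
  rw [← Set.inter_union_compl Z {0}ᶜ]
  refine measure_union_null h1 ?_
  rw [compl_compl]
  exact measure_mono_null Set.inter_subset_right (measure_singleton _)

/-- The zero set of a real-analytic function on a convex open set is a null set unless the function
vanishes identically: on each line through a point at which the function does not vanish, the zeros
are isolated. -/
lemma measure_zeros_analytic [Nontrivial E] {f : E → ℝ} {U : Set E} (hU : IsOpen U)
    (hc : Convex ℝ U) (hf : AnalyticOnNhd ℝ f U) {x : E} (hx : x ∈ U) (h0 : f x ≠ 0) :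
    μ (U ∩ f ⁻¹' {0}) = 0 := by
  have hm : MeasurableSet (U ∩ f ⁻¹' {0}) := by
    have h1 : U ∩ f ⁻¹' {0} = U \ (U ∩ f ⁻¹' {0}ᶜ) := by
      ext y; simp
    rw [h1]
    exact hU.measurableSet.diff
      (hf.continuousOn.isOpen_inter_preimage hU isOpen_compl_singleton).measurableSet
  have h2 : μ ((fun y => x + y) ⁻¹' (U ∩ f ⁻¹' {0})) = 0 := by
    refine measure_zero_of_rays μ (measurable_const_add x hm) fun s => ?_
    set L : ℝ → E := fun r => x + r • s
    have hLc : Continuous L := by fun_prop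
    have hL : AnalyticOnNhd ℝ L Set.univ := fun r _ => by
      exact analyticAt_const.add (analyticAt_id.smul analyticAt_const)
    refine volume_zeros_analytic_line (I := L ⁻¹' U) (hU.preimage hLc) ?_
      (hf.comp (hL.mono (Set.subset_univ _)) fun r hr => hr) (r := 0) (by simpa [L] using hx)
      (by simpa [L] using h0)
    refine Convex.isPreconnected ?_
    intro a ha b hb p q hp hq hpq
    have := hc ha hb hp hq hpq
    have h3 : p • L a + q • L b = L (p • a + q • b) := by
      simp only [L, smul_add, add_smul, smul_smul, smul_eq_mul]
      rw [add_add_add_comm, ← add_smul, hpq, one_smul]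
    rw [h3] at this
    exact this
  rwa [measure_preimage_add] at h2

end NullZeros

/-! ### Analyticity of exponentially convergent Fourier series -/

/-- The linear map `θ ↦ i z·θ`. -/
def phaseCLM (z : Site d) : (Fin d → ℝ) →L[ℝ] ℂ :=
  ∑ i, (ContinuousLinearMap.proj (R := ℝ) (φ := fun _ : Fin d => ℝ) i).smulRight
    (Complex.I * (z i : ℂ))

lemma phaseCLM_apply (z : Site d) (θ : Fin d → ℝ) :
    phaseCLM z θ = Complex.I * (phase z θ : ℂ) := by
  simp only [phaseCLM, phase, sum_apply, ContinuousLinearMap.smulRight_apply,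
    ContinuousLinearMap.proj_apply, Complex.real_smul]
  push_cast
  rw [Finset.mul_sum]
  exact Finset.sum_congr rfl fun i _ => by ring

lemma norm_phaseCLM_le (z : Site d) : ‖phaseCLM z‖ ≤ d * latNorm z := by
  refine ContinuousLinearMap.opNorm_le_bound _ (by have := latNorm_nonneg z; positivity) fun θ => ?_
  rw [phaseCLM_apply, norm_mul, Complex.norm_I, one_mul, Complex.norm_real, phase]
  refine (norm_sum_le _ _).trans ?_
  calc ∑ i, ‖(z i : ℝ) * θ i‖ ≤ ∑ _i : Fin d, latNorm z * ‖θ‖ := by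
        refine Finset.sum_le_sum fun i _ => ?_
        rw [norm_mul]
        exact mul_le_mul (abs_coord_le_latNorm z i) (norm_le_pi_norm θ i) (norm_nonneg _)
          (latNorm_nonneg z)
    _ = _ := by simp; ring

/-- The power series of `θ ↦ exp (i z·θ)` at the origin. -/
def phaseSeries (z : Site d) : FormalMultilinearSeries ℝ (Fin d → ℝ) ℂ :=
  (NormedSpace.expSeries ℝ ℂ).compContinuousLinearMap (phaseCLM z)

lemma phaseSeries_apply (z : Site d) (m : ℕ) (θ : Fin d → ℝ) :
    phaseSeries z m (fun _ => θ) = (m.factorial : ℂ)⁻¹ * (Complex.I * (phase z θ : ℂ)) ^ m := by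
  rw [phaseSeries, FormalMultilinearSeries.compContinuousLinearMap_apply]
  have : (phaseCLM z ∘ fun _ : Fin m => θ) = fun _ => phaseCLM z θ := rfl
  rw [this, NormedSpace.expSeries_apply_eq, phaseCLM_apply, Complex.real_smul]
  push_cast
  rfl

lemma norm_phaseSeries_le (z : Site d) (m : ℕ) :
    ‖phaseSeries z m‖ ≤ (d * latNorm z) ^ m / m.factorial := by
  have h1 : ‖phaseSeries z m‖ ≤ ‖NormedSpace.expSeries ℝ ℂ m‖ * ‖phaseCLM z‖ ^ m := by
    refine (ContinuousMultilinearMap.norm_compContinuousLinearMap_le _ _).trans (le_of_eq ?_)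
    simp
  have h2 : ‖NormedSpace.expSeries ℝ ℂ m‖ ≤ (m.factorial : ℝ)⁻¹ := by
    rw [NormedSpace.expSeries, norm_smul, ContinuousMultilinearMap.norm_mkPiAlgebraFin, mul_one]
    simp
  calc _ ≤ _ := h1
    _ ≤ (m.factorial : ℝ)⁻¹ * (d * latNorm z) ^ m := by
        gcongr
        exact norm_phaseCLM_le z
    _ = _ := by rw [div_eq_inv_mul]

/-- A Fourier series with exponentially decaying coefficients is real-analytic. -/
lemma analyticAt_fourierSum {a : Site d → ℝ} {C b : ℝ} (hb : 0 < b)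
    (ha : ∀ z, |a z| ≤ C * Real.exp (-b * latNorm z)) (θ₀ : Fin d → ℝ) :
    AnalyticAt ℝ (fourierSum a) θ₀ := by
  have hC : 0 ≤ C := by
    have := (abs_nonneg _).trans (ha 0)
    rw [latNorm_zero] at this
    simpa using this
  -- a radius for which `∑ |a z| exp (d r |z|)` converges
  set r : NNReal := ⟨b / (2 * (d + 1)), by positivity⟩ with hr
  have hr0 : (0 : ℝ) < r := by rw [hr]; change 0 < b / (2 * (d + 1)); positivity
  have hdr : (d : ℝ) * r ≤ b / 2 := by
    change (d : ℝ) * (b / (2 * (d + 1))) ≤ b / 2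
    rw [← mul_div_assoc, div_le_div_iff₀ (by positivity) (by positivity)]
    nlinarith
  set S : Site d → ℝ := fun z => |a z| * Real.exp (d * latNorm z * r) with hS
  have hSs : Summable S := by
    refine Summable.of_nonneg_of_le (fun z => by positivity) (fun z => ?_)
      ((summable_exp_latNorm_mul_rpow d (half_pos hb) 0).mul_left C)
    simp only [Real.rpow_zero, mul_one, hS]
    calc |a z| * Real.exp (d * latNorm z * r)
        ≤ C * Real.exp (-b * latNorm z) * Real.exp (b / 2 * latNorm z) := by
          refine mul_le_mul (ha z) (Real.exp_le_exp.2 ?_) (Real.exp_nonneg _) (by positivity)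
          have := mul_le_mul_of_nonneg_right hdr (latNorm_nonneg z)
          linarith
      _ = _ := by rw [mul_assoc, ← Real.exp_add]; ring_nf
  have hterm : ∀ z (m : ℕ), |a z| * ((d * latNorm z) ^ m / m.factorial) * (r : ℝ) ^ m ≤ S z := by
    intro z m
    have h := Real.pow_div_factorial_le_exp (d * latNorm z * r)
      (by have := latNorm_nonneg z; positivity) m
    calc _ = |a z| * ((d * latNorm z * r) ^ m / m.factorial) := by rw [mul_pow _ (r : ℝ)]; ring
      _ ≤ _ := by simp only [hS]; gcongr
  set c : Site d → ℂ := fun z => (a z : ℂ) * Complex.exp (Complex.I * (phase z θ₀ : ℂ)) with hc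
  have hcn : ∀ z, ‖c z‖ = |a z| := norm_fourierSum_term a θ₀
  have hnorm : ∀ (m : ℕ) z, ‖c z • phaseSeries z m‖ ≤ S z * ((r : ℝ) ^ m)⁻¹ := by
    intro m z
    rw [norm_smul, hcn, ← div_eq_mul_inv, le_div_iff₀ (by positivity)]
    refine le_trans ?_ (hterm z m)
    gcongr
    exact norm_phaseSeries_le z m
  have hps : ∀ m : ℕ, Summable fun z => c z • phaseSeries z m := fun m =>
    Summable.of_norm_bounded (hSs.mul_right _) (hnorm m)
  refine ⟨fun m => ∑' z, c z • phaseSeries z m, r, ?_, by exact_mod_cast hr0, ?_⟩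
  · refine FormalMultilinearSeries.le_radius_of_bound _ (∑' z, S z) fun m => ?_
    have h1 := tsum_of_norm_bounded (hSs.mul_right ((r : ℝ) ^ m)⁻¹).hasSum (hnorm m)
    rw [tsum_mul_right, ← div_eq_mul_inv, le_div_iff₀ (by positivity)] at h1
    exact h1
  · intro y hy
    have hy' : ‖y‖ ≤ r := by
      have h1 : edist y 0 < r := hy
      rw [edist_zero_right, ← ofReal_norm, ENNReal.ofReal_lt_coe_iff (norm_nonneg _)] at h1
      exact h1.le
    set F : Site d × ℕ → ℂ := fun x => c x.1 * ((x.2.factorial : ℂ)⁻¹ *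
      (Complex.I * (phase x.1 y : ℂ)) ^ x.2) with hF
    have hphase : ∀ z, |phase z y| ≤ d * latNorm z * r := by
      intro z
      have h1 := (phaseCLM z).le_opNorm y
      rw [phaseCLM_apply, norm_mul, Complex.norm_I, one_mul, Complex.norm_real] at h1
      refine h1.trans ?_
      have := latNorm_nonneg z
      exact mul_le_mul (norm_phaseCLM_le z) hy' (norm_nonneg _) (by positivity)
    have hFn : ∀ z m, ‖F (z, m)‖ = |a z| * (|phase z y| ^ m / m.factorial) := by
      intro z m
      simp only [hF]
      rw [norm_mul, hcn, norm_mul, norm_pow, norm_mul, Complex.norm_I, one_mul, norm_inv,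
        Complex.norm_real, Complex.norm_natCast, Real.norm_eq_abs, div_eq_inv_mul]
    have hexp : ∀ z, HasSum (fun m : ℕ => |a z| * (|phase z y| ^ m / m.factorial))
        (|a z| * Real.exp |phase z y|) := by
      intro z
      refine HasSum.mul_left _ ?_
      have := NormedSpace.expSeries_div_hasSum_exp (𝔸 := ℝ) |phase z y|
      rwa [← Real.exp_eq_exp_ℝ] at this
    have hFs : Summable F := by
      refine Summable.of_norm ((summable_prod_of_nonneg fun _ => norm_nonneg _).2 ⟨fun z => ?_, ?_⟩)
      · simp only [hFn]; exact (hexp z).summable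
      · simp only [hFn, (hexp _).tsum_eq]
        refine Summable.of_nonneg_of_le (fun z => by positivity) (fun z => ?_) hSs
        simp only [hS]
        gcongr
        exact hphase z
    have h1 : HasSum F (fourierSum a (θ₀ + y)) := by
      have h2 := hFs.hasSum.prod_fiberwise (g := fun z => (a z : ℂ) *
        Complex.exp (Complex.I * (phase z (θ₀ + y) : ℂ))) ?_
      · have h3 : HasSum (fun z => (a z : ℂ) *
            Complex.exp (Complex.I * (phase z (θ₀ + y) : ℂ))) (fourierSum a (θ₀ + y)) :=
          h2.summable.hasSum
        rw [← h2.unique h3]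
        exact hFs.hasSum
      · intro z
        have h4 := (NormedSpace.expSeries_div_hasSum_exp (𝔸 := ℂ)
          (Complex.I * (phase z y : ℂ))).mul_left (c z)
        rw [← Complex.exp_eq_exp_ℂ] at h4
        have h5 : (a z : ℂ) * Complex.exp (Complex.I * (phase z (θ₀ + y) : ℂ))
            = c z * Complex.exp (Complex.I * (phase z y : ℂ)) := by
          simp only [hc, mul_assoc]
          rw [← Complex.exp_add]
          congr 2
          rw [show phase z (θ₀ + y) = phase z θ₀ + phase z y by
            simp [phase, mul_add, Finset.sum_add_distrib]]
          push_cast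
          ring
        rw [h5]
        refine Eq.mp (congrArg (fun f => HasSum f _) (funext fun m => ?_)) h4
        simp only [hF, div_eq_inv_mul]
    have h6 := ((Equiv.prodComm ℕ (Site d)).hasSum_iff.2 h1)
    refine h6.prod_fiberwise fun m => ?_
    have h7 := (ContinuousMultilinearMap.apply ℝ (fun _ : Fin m => (Fin d → ℝ)) ℂ
      fun _ => y).hasSum (hps m).hasSum
    refine Eq.mp (congrArg (fun f => HasSum f _) (funext fun z => ?_)) h7
    simp only [hF, Function.comp, Equiv.prodComm_apply, Prod.swap,
      ContinuousMultilinearMap.apply_apply, smul_apply, phaseSeries_apply,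
      smul_eq_mul]

/-! ### Oscillatory integrals -/

section RiemannLebesgue

variable {X : Type*} [MeasurableSpace X] {ρ : Measure X} {ψ : X → ℝ}

/-- For a nonnegative amplitude `g` the integral is the Fourier transform of the image of the measure
`g ρ` under `ψ`, which has an integrable density. -/
lemma tendsto_integral_exp_of_nonneg (hψ : AEMeasurable ψ ρ)
    (hac : ∀ N : Set ℝ, volume N = 0 → ρ (ψ ⁻¹' N) = 0) {g : X → ℝ} (hg : Integrable g ρ)
    (hg0 : ∀ x, 0 ≤ g x) :
    Tendsto (fun t : ℝ => ∫ x, Complex.exp (Complex.I * ((t * ψ x : ℝ) : ℂ)) * (g x : ℂ) ∂ρ)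
      atTop (𝓝 0) := by
  set ρ' := ρ.withDensity fun x => ENNReal.ofReal (g x) with hρ'
  have hfin : IsFiniteMeasure ρ' := isFiniteMeasure_withDensity_ofReal hg.2
  have hψ' : AEMeasurable ψ ρ' := hψ.mono_ac (withDensity_absolutelyContinuous _ _)
  set ν := ρ'.map ψ with hν
  have hνac : ν ≪ volume := by
    refine Measure.AbsolutelyContinuous.mk fun N hN h0 => ?_
    rw [hν, Measure.map_apply_of_aemeasurable hψ' hN]
    exact withDensity_absolutelyContinuous _ _ (hac N h0)
  set f : ℝ → ℂ := fun y => ((ν.rnDeriv volume y).toReal : ℂ)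
  have h1 : ∀ t : ℝ, ∫ x, Complex.exp (Complex.I * ((t * ψ x : ℝ) : ℂ)) * (g x : ℂ) ∂ρ
      = ∫ y, Real.fourierChar (-(y * (-t / (2 * Real.pi)))) • f y := by
    intro t
    have h2 : ∫ x, Complex.exp (Complex.I * ((t * ψ x : ℝ) : ℂ)) * (g x : ℂ) ∂ρ
        = ∫ x, Complex.exp (Complex.I * ((t * ψ x : ℝ) : ℂ)) ∂ρ' := by
      rw [hρ', integral_withDensity_eq_integral_toReal_smul₀ hg.1.aemeasurable.ennreal_ofReal
        (Eventually.of_forall fun x => ENNReal.ofReal_lt_top)]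
      refine integral_congr_ae (Eventually.of_forall fun x => ?_)
      simp only [ENNReal.toReal_ofReal (hg0 x), Complex.real_smul]
      ring
    have h3 : ∫ x, Complex.exp (Complex.I * ((t * ψ x : ℝ) : ℂ)) ∂ρ'
        = ∫ y, Complex.exp (Complex.I * ((t * y : ℝ) : ℂ)) ∂ν := by
      rw [hν, integral_map hψ']
      exact Continuous.aestronglyMeasurable (by fun_prop)
    rw [h2, h3]
    conv_lhs => rw [← Measure.withDensity_rnDeriv_eq ν volume hνac]
    rw [integral_withDensity_eq_integral_toReal_smul (Measure.measurable_rnDeriv _ _)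
      (Measure.rnDeriv_lt_top _ _)]
    refine integral_congr_ae (Eventually.of_forall fun y => ?_)
    simp only [f, Circle.smul_def, Real.fourierChar_apply, smul_eq_mul, Complex.real_smul]
    rw [mul_comm]
    congr 2
    have : (Real.pi : ℂ) ≠ 0 := by exact_mod_cast Real.pi_ne_zero
    push_cast
    field_simp
  simp_rw [h1]
  refine (Real.tendsto_integral_exp_smul_cocompact f).comp ?_
  have h4 : Tendsto (fun t : ℝ => -t / (2 * Real.pi)) atTop atBot :=
    (tendsto_neg_atTop_atBot).atBot_div_const (by positivity)
  exact h4.mono_right atBot_le_cocompact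

/-- The Riemann-Lebesgue lemma for a phase function under which the image of the measure is
absolutely continuous. -/
lemma tendsto_integral_exp_phase (hψ : AEMeasurable ψ ρ)
    (hac : ∀ N : Set ℝ, volume N = 0 → ρ (ψ ⁻¹' N) = 0) {a : X → ℂ} (ha : Integrable a ρ) :
    Tendsto (fun t : ℝ => ∫ x, Complex.exp (Complex.I * ((t * ψ x : ℝ) : ℂ)) * a x ∂ρ)
      atTop (𝓝 0) := by
  have hint : ∀ {g : X → ℝ}, Integrable g ρ → ∀ t : ℝ,
      Integrable (fun x => Complex.exp (Complex.I * ((t * ψ x : ℝ) : ℂ)) * (g x : ℂ)) ρ := by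
    intro g hg t
    refine hg.ofReal.bdd_mul (c := 1) ?_ (Eventually.of_forall fun x => (norm_exp_I_mul _).le)
    have hm : Measurable fun y : ℝ => Complex.exp (Complex.I * ((t * y : ℝ) : ℂ)) := by fun_prop
    exact (hm.comp_aemeasurable hψ).aestronglyMeasurable
  have hreal : ∀ {g : X → ℝ}, Integrable g ρ → Tendsto (fun t : ℝ =>
      ∫ x, Complex.exp (Complex.I * ((t * ψ x : ℝ) : ℂ)) * (g x : ℂ) ∂ρ) atTop (𝓝 0) := by
    intro g hg
    have h1 := (tendsto_integral_exp_of_nonneg hψ hac hg.pos_part fun x => le_max_right _ _).sub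
      (tendsto_integral_exp_of_nonneg hψ hac hg.neg_part fun x => le_max_right _ _)
    rw [sub_zero] at h1
    refine h1.congr fun t => ?_
    rw [← integral_sub (hint hg.pos_part t) (hint hg.neg_part t)]
    refine integral_congr_ae (Eventually.of_forall fun x => ?_)
    simp only
    rw [← mul_sub, ← Complex.ofReal_sub]
    congr 2
    rcases le_total 0 (g x) with h | h
    · simp [h]
    · simp [h]
  have h2 := (hreal ha.re).add ((hreal ha.im).const_mul Complex.I)
  rw [mul_zero, add_zero] at h2
  refine h2.congr fun t => ?_
  rw [← integral_const_mul, ← integral_add (hint ha.re t) ((hint ha.im t).const_mul _)]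
  refine integral_congr_ae (Eventually.of_forall fun x => ?_)
  simp only
  conv_rhs => rw [← Complex.re_add_im (a x)]
  simp only [RCLike.re_to_complex, RCLike.im_to_complex]
  ring

end RiemannLebesgue

section NonconstantPhase

/-- The inverse image of a null set under a function of class `C¹` is a null set near a point with
`∂ψ/∂θ_j ≠ 0`: replacing the `j`-th coordinate by `ψ` is a local diffeomorphism. -/
lemma exists_nhds_measure_preimage_zero {ψ : (Fin d → ℝ) → ℝ} {θ : Fin d → ℝ}
    (hψ : ContDiffAt ℝ 1 ψ θ) {j : Fin d} (hj : fderiv ℝ ψ θ (Pi.single j 1) ≠ 0) {N : Set ℝ}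
    (hN : volume N = 0) : ∃ W ∈ 𝓝 θ, volume (W ∩ ψ ⁻¹' N) = 0 := by
  set e : Fin d → ℝ := Pi.single j 1 with he
  set Φ : (Fin d → ℝ) → (Fin d → ℝ) := fun x => x + (ψ x - x j) • e with hΦ
  have hΦj : ∀ x, Φ x j = ψ x := fun x => by simp [hΦ, he]
  set L : (Fin d → ℝ) →L[ℝ] (Fin d → ℝ) := ContinuousLinearMap.id ℝ _ +
    (fderiv ℝ ψ θ - ContinuousLinearMap.proj j).smulRight e with hL
  have hd1 : HasFDerivAt Φ L θ := by
    have h1 : HasFDerivAt ψ (fderiv ℝ ψ θ) θ := (hψ.differentiableAt (by norm_num)).hasFDerivAt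
    have h2 : HasFDerivAt (fun x : Fin d → ℝ => x j)
      (ContinuousLinearMap.proj (R := ℝ) (φ := fun _ : Fin d => ℝ) j) θ := hasFDerivAt_apply j θ
    exact (hasFDerivAt_id θ).add ((h1.sub h2).smul_const e)
  have hLinj : Function.Injective L := by
    refine (injective_iff_map_eq_zero L).2 fun w hw => ?_
    have h1 : w = -(fderiv ℝ ψ θ w - w j) • e := by
      have h2 : w + (fderiv ℝ ψ θ w - w j) • e = 0 := hw
      rw [neg_smul]
      exact eq_neg_of_add_eq_zero_left h2
    obtain ⟨s, hs⟩ : ∃ s : ℝ, w = s • e := ⟨_, h1⟩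
    have h3 := congrFun h1 j
    rw [hs] at h3
    simp only [map_smul, he, Pi.smul_apply, Pi.single_eq_same, smul_eq_mul, mul_one] at h3
    have h4 : s * fderiv ℝ ψ θ e = 0 := by rw [he]; linarith
    rw [hs, (mul_eq_zero.1 h4).resolve_right hj, zero_smul]
  set L' : (Fin d → ℝ) ≃L[ℝ] (Fin d → ℝ) :=
    (LinearEquiv.ofInjectiveEndo L.toLinearMap hLinj).toContinuousLinearEquiv with hL'
  have hLL' : (L' : (Fin d → ℝ) →L[ℝ] (Fin d → ℝ)) = L := by
    ext x : 1
    rfl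
  have hc : ContDiffAt ℝ 1 Φ θ := by
    have : ContDiffAt ℝ 1 (fun x : Fin d → ℝ => x j) θ := by fun_prop
    exact contDiffAt_id.add ((hψ.sub this).smul contDiffAt_const)
  have hd2 : HasFDerivAt Φ (L' : (Fin d → ℝ) →L[ℝ] (Fin d → ℝ)) θ := by rw [hLL']; exact hd1
  set H := hc.toOpenPartialHomeomorph Φ hd2 (by norm_num)
  have hcoe : ∀ x, H x = Φ x := fun x => by
    rw [show (H : (Fin d → ℝ) → (Fin d → ℝ)) = Φ from
      hc.toOpenPartialHomeomorph_coe hd2 (by norm_num)]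
  have hsource : θ ∈ H.source := hc.mem_toOpenPartialHomeomorph_source hd2 (by norm_num)
  have hinv : ContDiffAt ℝ 1 H.symm (Φ θ) := hc.to_localInverse hd2 (by norm_num)
  have hev : ∀ᶠ y in 𝓝 (Φ θ), DifferentiableAt ℝ H.symm y :=
    (hinv.eventually (by norm_num)).mono fun y hy => hy.differentiableAt (by norm_num)
  have hcont : ContinuousAt Φ θ := hc.continuousAt
  refine ⟨H.source ∩ {x | DifferentiableAt ℝ H.symm (Φ x)},
    inter_mem (H.open_source.mem_nhds hsource) (hcont.eventually hev), ?_⟩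
  set T : Set (Fin d → ℝ) := {y | DifferentiableAt ℝ H.symm y} ∩ {y | y j ∈ N}
  have hT : volume T = 0 := by
    refine measure_mono_null Set.inter_subset_right ?_
    exact (Measure.quasiMeasurePreserving_eval (fun _ : Fin d => (volume : Measure ℝ)) j).preimage_null hN
  have himg : volume (H.symm '' T) = 0 :=
    addHaar_image_eq_zero_of_differentiableOn_of_addHaar_eq_zero _
      (fun y hy => hy.1.differentiableWithinAt) hT
  refine measure_mono_null ?_ himg
  rintro x ⟨⟨hx1, hx2⟩, hx3⟩
  refine ⟨Φ x, ⟨hx2, ?_⟩, ?_⟩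
  · change Φ x j ∈ N
    rw [hΦj]
    exact hx3
  · rw [← hcoe, H.left_inv hx1]

/-- The image of Lebesgue measure under a nonconstant real-analytic function is absolutely
continuous. -/
lemma measure_preimage_zero_of_analytic {ψ : (Fin d → ℝ) → ℝ} {O : Set (Fin d → ℝ)}
    (hO : IsOpen O) (hc : Convex ℝ O) (hψ : AnalyticOnNhd ℝ ψ O) {θ₁ θ₂ : Fin d → ℝ}
    (h₁ : θ₁ ∈ O) (h₂ : θ₂ ∈ O) (hne : ψ θ₁ ≠ ψ θ₂) {N : Set ℝ} (hN : volume N = 0) :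
    volume (O ∩ ψ ⁻¹' N) = 0 := by
  have hd : Nontrivial (Fin d → ℝ) := ⟨θ₁, θ₂, fun h => hne (by rw [h])⟩
  obtain ⟨θ₃, h₃, hθ₃⟩ : ∃ θ ∈ O, fderiv ℝ ψ θ ≠ 0 := by
    by_contra! h
    refine hne (hO.is_const_of_fderiv_eq_zero hc.isPreconnected
      (fun x hx => (hψ x hx).differentiableAt.differentiableWithinAt) (fun x hx => h x hx) h₁ h₂)
  obtain ⟨j, hj⟩ : ∃ j, fderiv ℝ ψ θ₃ (Pi.single j 1) ≠ 0 := by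
    by_contra! h
    refine hθ₃ (ContinuousLinearMap.coe_injective ?_)
    refine LinearMap.pi_ext' fun i => LinearMap.ext_ring ?_
    simpa using h i
  have hder : AnalyticOnNhd ℝ (fun θ => fderiv ℝ ψ θ (Pi.single j 1)) O := fun θ hθ =>
    ((ContinuousLinearMap.apply ℝ ℝ (Pi.single j 1 : Fin d → ℝ)).analyticAt _).comp (hψ.fderiv θ hθ)
  have hz := measure_zeros_analytic volume hO hc hder h₃ hj
  have h4 : volume ((O ∩ {θ | fderiv ℝ ψ θ (Pi.single j 1) ≠ 0}) ∩ ψ ⁻¹' N) = 0 := by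
    refine measure_null_of_locally_null _ fun θ hθ => ?_
    obtain ⟨W, hW, hW0⟩ := exists_nhds_measure_preimage_zero
      ((hψ θ hθ.1.1).contDiffAt) hθ.1.2 hN
    refine ⟨W ∩ ψ ⁻¹' N, ?_, hW0⟩
    exact mem_nhdsWithin.2 ⟨interior W, isOpen_interior, mem_interior_iff_mem_nhds.2 hW,
      fun x hx => ⟨interior_subset hx.1, hx.2.2⟩⟩
  refine measure_mono_null ?_ (measure_union_null hz h4)
  intro θ hθ
  by_cases h : fderiv ℝ ψ θ (Pi.single j 1) = 0
  · exact Or.inl ⟨hθ.1, h⟩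
  · exact Or.inr ⟨⟨hθ.1, h⟩, hθ.2⟩

/-- Oscillatory integrals with a nonconstant real-analytic phase tend to zero. -/
lemma tendsto_oscillatory_integral {ψ : (Fin d → ℝ) → ℝ} {O A : Set (Fin d → ℝ)}
    (hO : IsOpen O) (hc : Convex ℝ O) (hψ : AnalyticOnNhd ℝ ψ O) {θ₁ θ₂ : Fin d → ℝ}
    (h₁ : θ₁ ∈ O) (h₂ : θ₂ ∈ O) (hne : ψ θ₁ ≠ ψ θ₂) (hA : A ⊆ O) {a : (Fin d → ℝ) → ℂ}
    (ha : IntegrableOn a A) :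
    Tendsto (fun t : ℝ => ∫ θ in A, Complex.exp (Complex.I * ((t * ψ θ : ℝ) : ℂ)) * a θ)
      atTop (𝓝 0) := by
  refine tendsto_integral_exp_phase ?_ (fun N hN => ?_) ha
  · exact (hψ.continuousOn.aemeasurable hO.measurableSet).mono_measure (Measure.restrict_mono hA le_rfl)
  · have h := measure_preimage_zero_of_analytic hO hc hψ h₁ h₂ hne hN
    refine Measure.absolutelyContinuous_of_le (Measure.restrict_mono hA le_rfl) ?_
    rw [Measure.restrict_apply' hO.measurableSet, Set.inter_comm]
    exact h

end NonconstantPhase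

/-! ### Functions of a Hermitian matrix -/

section Hermitian

variable {A : Matrix (Fin n) (Fin n) ℂ}

lemma continuousOn_spectrum (f : ℝ → ℝ) : ContinuousOn f (spectrum ℝ A) :=
  (Matrix.finite_real_spectrum (A := A)).continuousOn f

lemma trace_cfc (hA : A.IsHermitian) (f : ℝ → ℝ) :
    (cfc f A).trace = ∑ k, (f (hA.eigenvalues k) : ℂ) := by
  rw [hA.cfc_eq, Matrix.IsHermitian.cfc, Unitary.conjStarAlgAut_apply, Matrix.trace_mul_comm,
    ← mul_assoc]
  simp [Matrix.trace]

/-- The set of eigenvalues of a Hermitian matrix. -/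
def eigSet (hA : A.IsHermitian) : Finset ℝ := Finset.univ.image hA.eigenvalues

lemma mem_eigSet (hA : A.IsHermitian) {r : ℝ} : r ∈ eigSet hA ↔ ∃ k, hA.eigenvalues k = r := by
  simp [eigSet]

lemma coe_eigSet (hA : A.IsHermitian) : (eigSet hA : Set ℝ) = spectrum ℝ A := by
  rw [hA.spectrum_real_eq_range_eigenvalues]
  ext r
  simp [eigSet]

lemma card_eigSet_le (hA : A.IsHermitian) : (eigSet hA).card ≤ n := by
  exact Finset.card_image_le.trans (by simp)

/-- The power sums of the eigenvalues. -/
def powSum (hA : A.IsHermitian) (j : ℕ) : ℝ := ∑ k, hA.eigenvalues k ^ j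

lemma powSum_eq_re_trace (hA : A.IsHermitian) (j : ℕ) : powSum hA j = (A ^ j).trace.re := by
  rw [← cfc_pow_id (R := ℝ) A j hA.isSelfAdjoint, trace_cfc hA]
  simp only [powSum, Complex.re_sum, Complex.ofReal_re]

/-- The Hankel matrix of the power sums of the eigenvalues; it is a Gram matrix. -/
def hankel (hA : A.IsHermitian) (s : ℕ) : Matrix (Fin s) (Fin s) ℝ :=
  Matrix.of fun i j => powSum hA (i + j)

/-- The rectangular Vandermonde matrix of the eigenvalues. -/
def eigVandermonde (hA : A.IsHermitian) (s : ℕ) : Matrix (Fin n) (Fin s) ℝ :=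
  Matrix.of fun k i => hA.eigenvalues k ^ (i : ℕ)

lemma hankel_eq (hA : A.IsHermitian) (s : ℕ) :
    hankel hA s = (eigVandermonde hA s).transpose * eigVandermonde hA s := by
  ext i j
  simp [hankel, powSum, eigVandermonde, Matrix.mul_apply, pow_add]

lemma eigVandermonde_mulVec (hA : A.IsHermitian) (s : ℕ) (q : Polynomial ℝ)
    (hq : q.natDegree < s) (k : Fin n) :
    (eigVandermonde hA s).mulVec (fun i => q.coeff i) k = q.eval (hA.eigenvalues k) := by
  rw [Polynomial.eval_eq_sum_range' hq, Matrix.mulVec, dotProduct,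
    Finset.sum_range fun i => q.coeff i * hA.eigenvalues k ^ i]
  exact Finset.sum_congr rfl fun i _ => mul_comm _ _

/-- The Hankel determinant of size `s` vanishes iff there are less than `s` distinct eigenvalues. -/
lemma hankel_det_eq_zero_iff (hA : A.IsHermitian) (s : ℕ) :
    (hankel hA s).det = 0 ↔ (eigSet hA).card < s := by
  rw [← Matrix.exists_mulVec_eq_zero_iff]
  constructor
  · rintro ⟨v, hv, h⟩
    have h1 : (eigVandermonde hA s).mulVec v = 0 := by
      have h2 : v ∈ LinearMap.ker ((eigVandermonde hA s).transpose * eigVandermonde hA s).mulVecLin := by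
        rw [LinearMap.mem_ker, Matrix.mulVecLin_apply, ← hankel_eq]
        exact h
      rw [Matrix.ker_mulVecLin_transpose_mul_self] at h2
      exact h2
    set q : Polynomial ℝ := ∑ i : Fin s, Polynomial.monomial (i : ℕ) (v i) with hq
    have hcoeff : ∀ i : Fin s, q.coeff i = v i := by
      intro i
      simp only [hq, Polynomial.finsetSum_coeff, Polynomial.coeff_monomial]
      simp [Fin.val_inj]
    have hq0 : q ≠ 0 := by
      intro h0
      refine hv (funext fun i => ?_)
      rw [← hcoeff i, h0]
      simp
    have hdeg : q.degree < s := by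
      refine (Polynomial.degree_lt_iff_coeff_zero _ _).2 fun m hm => ?_
      simp only [hq, Polynomial.finsetSum_coeff, Polynomial.coeff_monomial]
      exact Finset.sum_eq_zero fun i _ => if_neg (by omega)
    have hnat : q.natDegree < s := (Polynomial.natDegree_lt_iff_degree_lt hq0).2 hdeg
    refine lt_of_le_of_lt ?_ hnat
    refine Polynomial.card_le_degree_of_subset_roots fun r hr => ?_
    obtain ⟨k, rfl⟩ := (mem_eigSet hA).1 hr
    rw [Polynomial.mem_roots hq0, Polynomial.IsRoot, ← eigVandermonde_mulVec hA s q hnat]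
    simp only [hcoeff]
    exact congrFun h1 k
  · intro h
    set q : Polynomial ℝ := ∏ r ∈ eigSet hA, (Polynomial.X - Polynomial.C r) with hq
    have hdeg : q.natDegree = (eigSet hA).card := by
      rw [hq, Polynomial.natDegree_prod_of_monic _ _ fun r _ => Polynomial.monic_X_sub_C r]
      simp
    have hmonic : q.Monic := Polynomial.monic_prod_of_monic _ _ fun r _ => Polynomial.monic_X_sub_C r
    refine ⟨fun i => q.coeff i, ?_, ?_⟩
    · intro h0
      have h1 := congrFun h0 ⟨(eigSet hA).card, h⟩
      simp only [Pi.zero_apply] at h1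
      rw [← hdeg] at h1
      exact one_ne_zero (hmonic.coeff_natDegree.symm.trans h1)
    · rw [hankel_eq, ← Matrix.mulVec_mulVec]
      have h1 : (eigVandermonde hA s).mulVec (fun i : Fin s => q.coeff i) = 0 := by
        funext k
        rw [eigVandermonde_mulVec hA s q (hdeg ▸ h), hq, Polynomial.eval_prod]
        exact Finset.prod_eq_zero ((mem_eigSet hA).2 ⟨k, rfl⟩) (by simp)
      rw [h1, Matrix.mulVec_zero]

/-- The coefficients of the minimal polynomial solve a linear system with the Hankel matrix. -/
lemma eval_minpoly_eq (hA : A.IsHermitian) (x : ℝ) :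
    x ^ (eigSet hA).card - ∑ j : Fin (eigSet hA).card,
      ((hankel hA (eigSet hA).card)⁻¹.mulVec fun i : Fin _ => powSum hA (i + (eigSet hA).card)) j * x ^ (j : ℕ)
      = ∏ r ∈ eigSet hA, (x - r) := by
  set s := (eigSet hA).card with hs
  set q : Polynomial ℝ := ∏ r ∈ eigSet hA, (Polynomial.X - Polynomial.C r) with hq
  have hdeg : q.natDegree = s := by
    rw [hq, Polynomial.natDegree_prod_of_monic _ _ fun r _ => Polynomial.monic_X_sub_C r]
    simp [hs]
  have hmonic : q.Monic := Polynomial.monic_prod_of_monic _ _ fun r _ => Polynomial.monic_X_sub_C r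
  have heval : ∀ x, q.eval x = x ^ s + ∑ j : Fin s, q.coeff j * x ^ (j : ℕ) := by
    intro x
    rw [Polynomial.eval_eq_sum_range, hdeg, Finset.sum_range_succ,
      Finset.sum_range fun i => q.coeff i * x ^ i, add_comm]
    congr 1
    have := hmonic.coeff_natDegree
    rw [hdeg] at this
    rw [this, one_mul]
  have hdet : IsUnit (hankel hA s).det := by
    rw [isUnit_iff_ne_zero, Ne, hankel_det_eq_zero_iff]
    exact lt_irrefl _
  have hsys : (hankel hA s).mulVec (fun j : Fin s => -q.coeff j) = fun i : Fin s => powSum hA (i + s) := by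
    have h1 : (eigVandermonde hA s).mulVec (fun j : Fin s => -q.coeff j) = fun k => hA.eigenvalues k ^ s := by
      funext k
      have h2 := heval (hA.eigenvalues k)
      have h3 : q.eval (hA.eigenvalues k) = 0 := by
        rw [hq, Polynomial.eval_prod]
        exact Finset.prod_eq_zero ((mem_eigSet hA).2 ⟨k, rfl⟩) (by simp)
      rw [h3] at h2
      simp only [Matrix.mulVec, dotProduct, eigVandermonde, Matrix.of_apply]
      have h4 : ∑ j : Fin s, hA.eigenvalues k ^ (j : ℕ) * -q.coeff j
          = -∑ j : Fin s, q.coeff j * hA.eigenvalues k ^ (j : ℕ) := by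
        rw [← Finset.sum_neg_distrib]
        exact Finset.sum_congr rfl fun j _ => by ring
      rw [h4]
      linarith
    rw [hankel_eq, ← Matrix.mulVec_mulVec, h1]
    funext i
    simp [Matrix.mulVec, dotProduct, eigVandermonde, powSum, pow_add]
  have hsol : (hankel hA s)⁻¹.mulVec (fun i : Fin s => powSum hA (i + s)) = fun j : Fin s => -q.coeff j := by
    rw [← hsys, Matrix.mulVec_mulVec, Matrix.nonsing_inv_mul _ hdet, Matrix.one_mulVec]
  have hprod : ∏ r ∈ eigSet hA, (x - r) = q.eval x := by
    rw [hq, Polynomial.eval_prod]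
    simp
  rw [hprod, heval, hsol]
  simp [Finset.sum_neg_distrib]

end Hermitian

/-! ### Analytic branches of eigenvalues -/

section Branches

variable {E : Type*} [NormedAddCommGroup E] [NormedSpace ℝ E]

lemma analyticAt_det {ι 𝕜 : Type*} [Fintype ι] [DecidableEq ι] [RCLike 𝕜] {M : E → Matrix ι ι 𝕜}
    {θ : E} (h : ∀ i j, AnalyticAt ℝ (fun θ => M θ i j) θ) :
    AnalyticAt ℝ (fun θ => (M θ).det) θ := by
  simp only [Matrix.det_apply']
  exact Finset.analyticAt_fun_sum _ fun σ _ =>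
    analyticAt_const.mul (Finset.analyticAt_fun_prod _ fun i _ => h _ _)

lemma analyticAt_inv_apply {ι : Type*} [Fintype ι] [DecidableEq ι] {M : E → Matrix ι ι ℝ}
    {θ : E} (h : ∀ i j, AnalyticAt ℝ (fun θ => M θ i j) θ) (h0 : (M θ).det ≠ 0) (i j : ι) :
    AnalyticAt ℝ (fun θ => (M θ)⁻¹ i j) θ := by
  simp only [Matrix.inv_def, Matrix.smul_apply, smul_eq_mul, Ring.inverse_eq_inv',
    Matrix.adjugate_apply]
  refine ((analyticAt_det h).inv h0).mul (analyticAt_det fun k l => ?_)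
  simp only [Matrix.updateRow_apply]
  split_ifs
  · exact analyticAt_const
  · exact h k l

lemma analyticAt_pow_apply {ι : Type*} [Fintype ι] [DecidableEq ι] {M : E → Matrix ι ι ℂ}
    {θ : E} (h : ∀ i j, AnalyticAt ℝ (fun θ => M θ i j) θ) (m : ℕ) (i j : ι) :
    AnalyticAt ℝ (fun θ => (M θ ^ m) i j) θ := by
  induction m generalizing i j with
  | zero => simpa using analyticAt_const
  | succ m ih =>
    simp only [pow_succ, Matrix.mul_apply]
    exact Finset.analyticAt_fun_sum _ fun k _ => (ih i k).mul (h k j)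

variable [CompleteSpace E]

/-- The implicit function theorem for a simple root. -/
lemma exists_analytic_root {F : E × ℝ → ℝ} {θ : E} {r F' : ℝ} (hF : AnalyticAt ℝ F (θ, r))
    (h0 : F (θ, r) = 0) (hd : HasDerivAt (fun x => F (θ, x)) F' r) (hF' : F' ≠ 0) :
    ∃ ψ : E → ℝ, AnalyticAt ℝ ψ θ ∧ ψ θ = r ∧ ∀ᶠ x in 𝓝 θ, F (x, ψ x) = 0 := by
  have hc : ContDiffAt ℝ ⊤ F (θ, r) := hF.contDiffAt
  have hinv : (fderiv ℝ F (θ, r) ∘L .inr ℝ E ℝ).IsInvertible := by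
    refine ⟨ContinuousLinearEquiv.unitsEquivAut ℝ (Units.mk0 F' hF'), ?_⟩
    have h1 : HasFDerivAt (fun x => F (θ, x)) (fderiv ℝ F (θ, r) ∘L .inr ℝ E ℝ) r :=
      hF.differentiableAt.hasFDerivAt.comp r (hasFDerivAt_prodMk_right θ r)
    refine ContinuousLinearMap.ext_ring ?_
    have h2 := h1.hasDerivAt.unique hd
    rw [h2]
    simp
  have hne : (⊤ : WithTop ℕ∞) ≠ 0 := by simp
  refine ⟨hc.implicitFunction hne hinv, ?_, hc.implicitFunction_apply_self hne hinv, ?_⟩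
  · exact (hc.contDiffAt_implicitFunction hne hinv).analyticAt
  · have := hc.eventually_apply_implicitFunction hne hinv
    rwa [h0] at this

end Branches

section Multiplicities

/-- The multiplicity of `r` as an eigenvalue of a Hermitian matrix. -/
def eigMult {A : Matrix (Fin n) (Fin n) ℂ} (hA : A.IsHermitian) (r : ℝ) : ℕ :=
  (Finset.univ.filter fun k => hA.eigenvalues k = r).card

lemma sum_eigenvalues_eq {A : Matrix (Fin n) (Fin n) ℂ} (hA : A.IsHermitian) (f : ℝ → ℝ) :
    ∑ k, f (hA.eigenvalues k) = ∑ r ∈ eigSet hA, eigMult hA r * f r := by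
  simpa [eigMult, eigSet] using Finset.sum_comp (s := Finset.univ) f hA.eigenvalues

lemma eigMult_le {A : Matrix (Fin n) (Fin n) ℂ} (hA : A.IsHermitian) (r : ℝ) :
    eigMult hA r ≤ n :=
  (Finset.card_filter_le _ _).trans (by simp)

variable {E : Type*} [NormedAddCommGroup E] [NormedSpace ℝ E] {A : E → Matrix (Fin n) (Fin n) ℂ}
  {hA : ∀ θ, (A θ).IsHermitian} {θ₀ : E}

lemma analyticAt_powSum (h : ∀ i j, AnalyticAt ℝ (fun θ => A θ i j) θ₀) (m : ℕ) :
    AnalyticAt ℝ (fun θ => powSum (hA θ) m) θ₀ := by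
  simp only [powSum_eq_re_trace, Matrix.trace, Matrix.diag_apply]
  exact (Complex.reCLM.analyticAt _).comp
    (Finset.analyticAt_fun_sum _ fun k _ => analyticAt_pow_apply h m k k)

lemma analyticAt_hankel_det (h : ∀ i j, AnalyticAt ℝ (fun θ => A θ i j) θ₀) (s : ℕ) :
    AnalyticAt ℝ (fun θ => (hankel (hA θ) s).det) θ₀ :=
  analyticAt_det fun _ _ => analyticAt_powSum h _

lemma continuousAt_sum_eval (h : ∀ i j, AnalyticAt ℝ (fun θ => A θ i j) θ₀) (q : Polynomial ℝ) :
    ContinuousAt (fun θ => ∑ k, q.eval ((hA θ).eigenvalues k)) θ₀ := by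
  have h1 : ∀ θ, ∑ k, q.eval ((hA θ).eigenvalues k)
      = ∑ i ∈ Finset.range (q.natDegree + 1), q.coeff i * powSum (hA θ) i := by
    intro θ
    simp only [Polynomial.eval_eq_sum_range, powSum, Finset.mul_sum]
    exact Finset.sum_comm
  simp_rw [h1]
  exact tendsto_finsetSum _ fun i _ =>
    (analyticAt_powSum (hA := hA) h i).continuousAt.const_mul (q.coeff i)

variable [CompleteSpace E]

/-- Where the number of distinct eigenvalues of an analytic family of Hermitian matrices is locally
constant, the eigenvalues are analytic functions of constant multiplicity. -/
lemma exists_branches (h : ∀ i j, AnalyticAt ℝ (fun θ => A θ i j) θ₀)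
    (hcard : ∀ᶠ θ in 𝓝 θ₀, (eigSet (hA θ)).card = (eigSet (hA θ₀)).card) :
    ∃ ψ : ℝ → E → ℝ, (∀ r ∈ eigSet (hA θ₀), AnalyticAt ℝ (ψ r) θ₀ ∧ ψ r θ₀ = r) ∧
      ∀ᶠ θ in 𝓝 θ₀, Set.InjOn (fun r => ψ r θ) (eigSet (hA θ₀)) ∧
        eigSet (hA θ) = (eigSet (hA θ₀)).image (fun r => ψ r θ) ∧
        ∀ r ∈ eigSet (hA θ₀), eigMult (hA θ) (ψ r θ) = eigMult (hA θ₀) r := by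
  classical
  set S := eigSet (hA θ₀) with hS
  set s := S.card with hs
  set F : E × ℝ → ℝ := fun p => p.2 ^ s - ∑ j : Fin s,
    ((hankel (hA p.1) s)⁻¹.mulVec fun i : Fin s => powSum (hA p.1) (i + s)) j * p.2 ^ (j : ℕ) with hF
  have hFprod : ∀ θ, (eigSet (hA θ)).card = s → ∀ x, F (θ, x) = ∏ r ∈ eigSet (hA θ), (x - r) := by
    intro θ hθ x
    rw [← eval_minpoly_eq, hθ]
  have hdet : (hankel (hA θ₀) s).det ≠ 0 := by
    rw [Ne, hankel_det_eq_zero_iff]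
    exact lt_irrefl _
  have hFan : ∀ r, AnalyticAt ℝ F (θ₀, r) := by
    intro r
    have h1 : ∀ {g : E → ℝ}, AnalyticAt ℝ g θ₀ →
        AnalyticAt ℝ (fun p : E × ℝ => g p.1) (θ₀, r) := fun hg =>
      AnalyticAt.comp (g := _) (f := Prod.fst) hg analyticAt_fst
    refine (analyticAt_snd.pow s).sub (Finset.analyticAt_fun_sum _ fun j _ =>
      AnalyticAt.mul ?_ (analyticAt_snd.pow _))
    simp only [Matrix.mulVec, dotProduct]
    exact Finset.analyticAt_fun_sum _ fun i _ =>
      (h1 (analyticAt_inv_apply (fun _ _ => analyticAt_powSum h _) hdet j i)).mul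
        (h1 (analyticAt_powSum h _))
  have hroot : ∀ r ∈ S, ∃ ψ : E → ℝ, AnalyticAt ℝ ψ θ₀ ∧ ψ θ₀ = r ∧
      ∀ᶠ x in 𝓝 θ₀, F (x, ψ x) = 0 := by
    intro r hr
    have h1 : ∀ x, F (θ₀, x) = (x - r) * ∏ r' ∈ S.erase r, (x - r') := fun x => by
      rw [hFprod θ₀ rfl, Finset.mul_prod_erase S (fun r' => x - r') hr]
    refine exists_analytic_root (F' := ∏ r' ∈ S.erase r, (r - r')) (hFan r) ?_ ?_ ?_
    · rw [h1, sub_self, zero_mul]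
    · simp_rw [h1]
      have h2 : DifferentiableAt ℝ (fun x : ℝ => ∏ r' ∈ S.erase r, (x - r')) r := by fun_prop
      have h3 := ((hasDerivAt_id r).sub_const r).fun_mul h2.hasDerivAt
      simp only [id, sub_self, one_mul, zero_mul, add_zero] at h3
      exact h3
    · exact Finset.prod_ne_zero_iff.2 fun r' hr' => sub_ne_zero.2 (Finset.ne_of_mem_erase hr').symm
  choose! ψ hψ hψ0 hψF using hroot
  have hinj : ∀ᶠ θ in 𝓝 θ₀, Set.InjOn (fun r => ψ r θ) S := by
    have h1 : ∀ᶠ θ in 𝓝 θ₀, ∀ r ∈ S, ∀ r' ∈ S, r ≠ r' → ψ r θ ≠ ψ r' θ := by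
      refine (Finset.eventually_all S).2 fun r hr => (Finset.eventually_all S).2 fun r' hr' => ?_
      by_cases hrr : r = r'
      · exact Eventually.of_forall fun θ h => absurd hrr h
      · refine (((hψ r hr).sub (hψ r' hr')).continuousAt.eventually_ne (y := 0) ?_).mono
          fun θ h _ => sub_ne_zero.1 h
        rw [Pi.sub_apply, hψ0 r hr, hψ0 r' hr']
        exact sub_ne_zero.2 hrr
    filter_upwards [h1] with θ hθ r hr r' hr' heq
    by_contra hne
    exact hθ r hr r' hr' hne heq
  have himage : ∀ᶠ θ in 𝓝 θ₀, eigSet (hA θ) = S.image (fun r => ψ r θ) := by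
    filter_upwards [hinj, hcard, (Finset.eventually_all S).2 fun r hr => hψF r hr] with θ h1 h2 h3
    symm
    refine Finset.eq_of_subset_of_card_le (fun x hx => ?_) ?_
    · obtain ⟨r, hr, rfl⟩ := Finset.mem_image.1 hx
      have h4 := h3 r hr
      rw [hFprod θ h2, Finset.prod_eq_zero_iff] at h4
      obtain ⟨r', hr', h5⟩ := h4
      rwa [sub_eq_zero.1 h5]
    · rw [h2, Finset.card_image_of_injOn h1]
  refine ⟨ψ, fun r hr => ⟨hψ r hr, hψ0 r hr⟩, ?_⟩
  have hmult : ∀ᶠ θ in 𝓝 θ₀, ∀ r ∈ S, eigMult (hA θ) (ψ r θ) = eigMult (hA θ₀) r := by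
    refine (Finset.eventually_all S).2 fun r hr => ?_
    set L : Polynomial ℝ := Lagrange.basis S id r with hL
    have hL1 : L.eval r = 1 := Lagrange.eval_basis_self (v := id) Function.injective_id.injOn hr
    have hL0 : ∀ r' ∈ S, r' ≠ r → L.eval r' = 0 := fun r' hr' hne =>
      Lagrange.eval_basis_of_ne (v := id) hne.symm hr'
    have hsum : ∀ θ, Set.InjOn (fun r => ψ r θ) S → eigSet (hA θ) = S.image (fun r => ψ r θ) →
        ∑ k, L.eval ((hA θ).eigenvalues k)
          = ∑ r' ∈ S, (eigMult (hA θ) (ψ r' θ) : ℝ) * L.eval (ψ r' θ) := by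
      intro θ h1 h2
      rw [sum_eigenvalues_eq (hA θ) fun x => L.eval x, h2, Finset.sum_image h1]
    have hsum0 : ∑ k, L.eval ((hA θ₀).eigenvalues k) = eigMult (hA θ₀) r := by
      rw [sum_eigenvalues_eq (hA θ₀) fun x => L.eval x, Finset.sum_eq_single_of_mem r hr, hL1, mul_one]
      intro r' hr' hne
      rw [hL0 r' hr' hne, mul_zero]
    -- the deviation of the values of the Lagrange polynomial on the branches from `0` and `1`
    set ε : E → ℝ := fun θ => ∑ r' ∈ S, n * |L.eval (ψ r' θ) - L.eval r'| with hε
    have hε0 : Tendsto ε (𝓝 θ₀) (𝓝 0) := by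
      have h1 : ∀ r' ∈ S, Tendsto (fun θ => (n : ℝ) * |L.eval (ψ r' θ) - L.eval r'|) (𝓝 θ₀) (𝓝 0) := by
        intro r' hr'
        have h2 : ContinuousAt (fun θ => (n : ℝ) * |L.eval (ψ r' θ) - L.eval r'|) θ₀ := by
          have h3 := (hψ r' hr').continuousAt
          have h4 : ContinuousAt (fun θ => L.eval (ψ r' θ)) θ₀ :=
            L.continuous.continuousAt.comp (f := ψ r') h3
          fun_prop
        have h5 := h2.tendsto
        rwa [hψ0 r' hr', sub_self, abs_zero, mul_zero] at h5
      simpa using tendsto_finsetSum S h1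
    have hc := (continuousAt_sum_eval (hA := hA) h L).tendsto
    rw [hsum0] at hc
    filter_upwards [hinj, himage, hε0.eventually_lt_const (show (0 : ℝ) < 1 / 2 by norm_num),
      (tendsto_iff_dist_tendsto_zero.1 hc).eventually_lt_const (show (0 : ℝ) < 1 / 2 by norm_num)]
      with θ h1 h2 h3 h4
    rw [hsum θ h1 h2, Real.dist_eq] at h4
    have h5 : |∑ r' ∈ S, (eigMult (hA θ) (ψ r' θ) : ℝ) * L.eval (ψ r' θ)
        - eigMult (hA θ) (ψ r θ)| ≤ ε θ := by
      have h6 : (eigMult (hA θ) (ψ r θ) : ℝ)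
          = ∑ r' ∈ S, (eigMult (hA θ) (ψ r' θ) : ℝ) * L.eval r' := by
        rw [Finset.sum_eq_single_of_mem r hr, hL1, mul_one]
        intro r' hr' hne
        rw [hL0 r' hr' hne, mul_zero]
      rw [h6, ← Finset.sum_sub_distrib]
      refine (Finset.abs_sum_le_sum_abs _ _).trans (Finset.sum_le_sum fun r' _ => ?_)
      rw [← mul_sub, abs_mul, Nat.abs_cast]
      gcongr
      exact eigMult_le _ _
    have h7 : |(eigMult (hA θ) (ψ r θ) : ℝ) - eigMult (hA θ₀) r| < 1 := by
      rw [abs_lt] at h4 ⊢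
      rw [abs_le] at h5
      constructor <;> linarith
    have h8 : |(eigMult (hA θ) (ψ r θ) : ℤ) - eigMult (hA θ₀) r| < 1 := by exact_mod_cast h7
    have h9 := Int.abs_lt_one_iff.1 h8
    omega
  filter_upwards [hinj, himage, hmult] with θ h1 h2 h3 using ⟨h1, h2, h3⟩

end Multiplicities

section MaxCard

variable {X : Type*} {B : X → Matrix (Fin n) (Fin n) ℂ}

/-- The generic number of distinct eigenvalues of a family of Hermitian matrices. -/
def maxCard (hA : ∀ θ, (B θ).IsHermitian) : ℕ := sSup (Set.range fun θ => (eigSet (hA θ)).card)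

lemma card_eigSet_le_maxCard (hA : ∀ θ, (B θ).IsHermitian) (θ : X) :
    (eigSet (hA θ)).card ≤ maxCard hA :=
  le_csSup ⟨n, by rintro _ ⟨θ, rfl⟩; exact card_eigSet_le (hA θ)⟩ ⟨θ, rfl⟩

lemma exists_card_eigSet_eq_maxCard [Nonempty X] (hA : ∀ θ, (B θ).IsHermitian) :
    ∃ θ, (eigSet (hA θ)).card = maxCard hA :=
  Nat.sSup_mem (Set.range_nonempty fun θ => (eigSet (hA θ)).card) ⟨n, by rintro _ ⟨θ, rfl⟩; exact card_eigSet_le (hA θ)⟩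

/-- The number of distinct eigenvalues is maximal outside the zeros of a Hankel determinant. -/
lemma card_eigSet_eq_maxCard_iff (hA : ∀ θ, (B θ).IsHermitian) (θ : X) :
    (eigSet (hA θ)).card = maxCard hA ↔ (hankel (hA θ) (maxCard hA)).det ≠ 0 := by
  rw [Ne, hankel_det_eq_zero_iff, not_lt]
  exact ⟨fun h => h.ge, fun h => le_antisymm (card_eigSet_le_maxCard hA θ) h⟩

end MaxCard

section EigenBranches

variable {E : Type*} [NormedAddCommGroup E] [NormedSpace ℝ E] {A : E → Matrix (Fin n) (Fin n) ℂ}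

/-- On the convex open neighbourhood `O` of `θ₀`, the distinct eigenvalues of the Hermitian matrices
`A θ` are the values of the analytic functions `ψ r`, which are indexed by the eigenvalues
`r = ψ r θ₀` at `θ₀` and have constant multiplicities. -/
structure EigenBranches (hA : ∀ θ, (A θ).IsHermitian) (O : Set E) (θ₀ : E) (ψ : ℝ → E → ℝ) :
    Prop where
  isOpen : IsOpen O
  convex : Convex ℝ O
  mem : θ₀ ∈ O
  analytic : ∀ r ∈ eigSet (hA θ₀), AnalyticOnNhd ℝ (ψ r) O
  apply_self : ∀ r ∈ eigSet (hA θ₀), ψ r θ₀ = r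
  injOn : ∀ θ ∈ O, Set.InjOn (fun r => ψ r θ) (eigSet (hA θ₀))
  image_eq : ∀ θ ∈ O, eigSet (hA θ) = (eigSet (hA θ₀)).image fun r => ψ r θ
  eigMult_eq : ∀ θ ∈ O, ∀ r ∈ eigSet (hA θ₀), eigMult (hA θ) (ψ r θ) = eigMult (hA θ₀) r

variable {hA : ∀ θ, (A θ).IsHermitian} {θ₀ : E} {O : Set E} {ψ : ℝ → E → ℝ}

lemma EigenBranches.exists_subset (h : EigenBranches hA O θ₀ ψ) {P : E → Prop}
    (hP : ∀ᶠ θ in 𝓝 θ₀, P θ) : ∃ O', EigenBranches hA O' θ₀ ψ ∧ ∀ θ ∈ O', P θ := by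
  obtain ⟨ε, hε, hb⟩ := Metric.eventually_nhds_iff_ball.1 (hP.and (h.isOpen.mem_nhds h.mem))
  exact ⟨Metric.ball θ₀ ε,
    ⟨Metric.isOpen_ball, convex_ball θ₀ ε, Metric.mem_ball_self hε,
      fun r hr θ hθ => h.analytic r hr θ (hb θ hθ).2, h.apply_self,
      fun θ hθ => h.injOn θ (hb θ hθ).2, fun θ hθ => h.image_eq θ (hb θ hθ).2,
      fun θ hθ => h.eigMult_eq θ (hb θ hθ).2⟩, fun θ hθ => (hb θ hθ).1⟩

lemma EigenBranches.prod_eq {M : Type*} [CommMonoid M] (h : EigenBranches hA O θ₀ ψ) {θ : E}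
    (hθ : θ ∈ O) (g : ℝ → M) :
    ∏ k, g ((hA θ).eigenvalues k) = ∏ k, g (ψ ((hA θ₀).eigenvalues k) θ) := by
  rw [Finset.prod_comp (s := Finset.univ) g (hA θ).eigenvalues,
    Finset.prod_comp (s := Finset.univ) (fun r => g (ψ r θ)) (hA θ₀).eigenvalues]
  change ∏ r ∈ eigSet (hA θ), g r ^ eigMult (hA θ) r
    = ∏ r ∈ eigSet (hA θ₀), g (ψ r θ) ^ eigMult (hA θ₀) r
  rw [h.image_eq θ hθ, Finset.prod_image (h.injOn θ hθ)]
  exact Finset.prod_congr rfl fun r hr => by rw [h.eigMult_eq θ hθ r hr]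

lemma exists_eigenBranches [CompleteSpace E] (h : ∀ i j, AnalyticAt ℝ (fun θ => A θ i j) θ₀)
    (hcard : ∀ᶠ θ in 𝓝 θ₀, (eigSet (hA θ)).card = (eigSet (hA θ₀)).card) :
    ∃ O ψ, EigenBranches hA O θ₀ ψ := by
  obtain ⟨ψ, h1, h2⟩ := exists_branches h hcard
  obtain ⟨ε, hε, hb⟩ := Metric.eventually_nhds_iff_ball.1 (h2.and ((Finset.eventually_all _).2
    fun r hr => (h1 r hr).1.eventually_analyticAt))
  exact ⟨Metric.ball θ₀ ε, ψ, Metric.isOpen_ball, convex_ball θ₀ ε, Metric.mem_ball_self hε,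
    fun r hr θ hθ => (hb θ hθ).2 r hr, fun r hr => (h1 r hr).2, fun θ hθ => (hb θ hθ).1.1,
    fun θ hθ => (hb θ hθ).1.2.1, fun θ hθ => (hb θ hθ).1.2.2⟩

lemma eventually_card_eigSet_eq (h : ∀ i j, AnalyticAt ℝ (fun θ => A θ i j) θ₀)
    (hc : (eigSet (hA θ₀)).card = maxCard hA) :
    ∀ᶠ θ in 𝓝 θ₀, (eigSet (hA θ)).card = (eigSet (hA θ₀)).card := by
  simp_rw [hc, card_eigSet_eq_maxCard_iff]
  exact (analyticAt_hankel_det h _).continuousAt.eventually_ne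
    ((card_eigSet_eq_maxCard_iff hA θ₀).1 hc)

end EigenBranches

/-! ### Local systems of dispersion relations -/

section Dispersion

variable {V : Interaction d n}

open scoped ComplexOrder in
lemma isHermitian_torusFourier (hE3 : CondE3 V) (θ : Fin d → ℝ) :
    (torusFourier V θ).IsHermitian := (hE3 θ).isHermitian

lemma analyticAt_torusFourier (hE1 : CondE1 V) (θ : Fin d → ℝ) (k l : Fin n) :
    AnalyticAt ℝ (fun θ => torusFourier V θ k l) θ := by
  obtain ⟨C, -, a, ha, h⟩ := hE1
  exact analyticAt_fourierSum ha (fun z => h z k l) θ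

open scoped ComplexOrder in
lemma nonneg_of_mem_eigSet {A : Matrix (Fin n) (Fin n) ℂ} (hA : A.IsHermitian) (h : A.PosSemidef)
    {r : ℝ} (hr : r ∈ eigSet hA) : 0 ≤ r := by
  obtain ⟨k, rfl⟩ := (mem_eigSet _).1 hr
  exact h.eigenvalues_nonneg k

lemma zero_mem_eigSet_iff {A : Matrix (Fin n) (Fin n) ℂ} (hA : A.IsHermitian) :
    0 ∈ eigSet hA ↔ A.det = 0 := by
  rw [hA.det_eq_prod_eigenvalues, Finset.prod_eq_zero_iff, mem_eigSet]
  simp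

lemma hessian_eq_zero {f : (Fin d → ℝ) → ℝ} {c : ℝ} {O : Set (Fin d → ℝ)} (hO : IsOpen O)
    (h : ∀ θ ∈ O, f θ = c) {θ : Fin d → ℝ} (hθ : θ ∈ O) : hessian f θ = 0 := by
  have h1 : f =ᶠ[𝓝 θ] fun _ => c := by
    filter_upwards [hO.mem_nhds hθ] with x hx using h x hx
  ext i j
  rw [hessian, Matrix.of_apply, (h1.iteratedFDeriv ℝ 2).eq_of_nhds,
    iteratedFDeriv_const_of_ne two_ne_zero]
  rfl

variable {hV : ∀ θ, (torusFourier V θ).IsHermitian} {O : Set (Fin d → ℝ)} {θ₀ : Fin d → ℝ}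
  {ψ : ℝ → (Fin d → ℝ) → ℝ}

lemma EigenBranches.nonneg (hE3 : CondE3 V) (h : EigenBranches hV O θ₀ ψ)
    {θ : Fin d → ℝ} (hθ : θ ∈ O) {r : ℝ} (hr : r ∈ eigSet (hV θ₀)) :
    0 ≤ ψ r θ := by
  refine nonneg_of_mem_eigSet (hV θ) (hE3 θ) ?_
  rw [h.image_eq θ hθ]
  exact Finset.mem_image_of_mem _ hr

/-- The square roots of the eigenvalue branches of `V̂` are dispersion relations, if each branch
is nowhere or identically zero. -/
lemma EigenBranches.isLocalDispersion
    (h : EigenBranches hV O θ₀ ψ)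
    (h0 : ∀ r ∈ eigSet (hV θ₀),
      (∀ θ ∈ O, ψ r θ ≠ 0) ∨ ∀ θ ∈ O, ψ r θ = 0) :
    IsLocalDispersion V O fun k θ =>
      Real.sqrt (ψ ((hV θ₀).eigenvalues k) θ) := by
  refine ⟨h.isOpen, h.convex.isConnected ⟨θ₀, h.mem⟩, fun k θ hθ => ?_, fun θ hθ => ?_⟩
  · have hk := (mem_eigSet (hV θ₀)).2 ⟨k, rfl⟩
    rcases h0 _ hk with h1 | h1
    · have h2 : ContDiffAt ℝ ⊤ (fun θ =>
          Real.sqrt (ψ ((hV θ₀).eigenvalues k) θ)) θ :=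
        (h.analytic _ hk θ hθ).contDiffAt.sqrt (h1 θ hθ)
      exact h2.analyticAt
    · refine (analyticAt_const (v := (0 : ℝ))).congr ?_
      filter_upwards [h.isOpen.mem_nhds hθ] with x hx
      rw [h1 x hx, Real.sqrt_zero]
  · rw [Om, (hV θ).charpoly_cfc_eq]
    exact h.prod_eq hθ fun r => Polynomial.X - Polynomial.C ((Real.sqrt r : ℝ) : ℂ)

/-- By the Hessian condition, `0` is not an eigenvalue of `V̂(θ)` for all `θ`. -/
lemma exists_det_ne_zero (hd : 1 ≤ d) (hE1 : CondE1 V) (hE3 : CondE3 V) (hE4 : CondE4 V) :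
    ∃ θ, (torusFourier V θ).det ≠ 0 := by
  have hV := isHermitian_torusFourier hE3
  by_contra! hdet
  obtain ⟨θ₀, hmax⟩ := exists_card_eigSet_eq_maxCard hV
  have han := analyticAt_torusFourier hE1 θ₀
  obtain ⟨O₁, ψ, h₁⟩ := exists_eigenBranches han
    (eventually_card_eigSet_eq han hmax)
  set S := eigSet (hV θ₀) with hS
  have hne : ∀ᶠ θ in 𝓝 θ₀, ∀ r ∈ S, r ≠ 0 → ψ r θ ≠ 0 := by
    refine (Finset.eventually_all S).2 fun r hr => ?_
    by_cases hr0 : r = 0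
    · exact Eventually.of_forall fun θ h => absurd hr0 h
    · refine ((h₁.analytic r hr θ₀ h₁.mem).continuousAt.eventually_ne ?_).mono fun θ h _ => h
      rwa [h₁.apply_self r hr]
  obtain ⟨O, h, hO⟩ := h₁.exists_subset hne
  have h0S : (0 : ℝ) ∈ S := (zero_mem_eigSet_iff _).2 (hdet θ₀)
  have hzero : ∀ θ ∈ O, ψ 0 θ = 0 := by
    intro θ hθ
    have h2 := (zero_mem_eigSet_iff (hV θ)).2 (hdet θ)
    rw [h.image_eq θ hθ] at h2
    obtain ⟨r, hr, h3⟩ := Finset.mem_image.1 h2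
    by_cases hr0 : r = 0
    · rwa [hr0] at h3
    · exact absurd h3 (hO θ hθ r hr hr0)
  obtain ⟨k, hk⟩ := (mem_eigSet _).1 h0S
  have hdisp := h.isLocalDispersion fun r hr => by
    by_cases hr0 : r = 0
    · exact Or.inr (hr0 ▸ hzero)
    · exact Or.inl fun θ hθ => hO θ hθ r hr hr0
  obtain ⟨θ, hθ, h4⟩ := hE4 O _ hdisp k
  refine h4 ?_
  rw [hessian_eq_zero (c := 0) h.isOpen (fun x hx => ?_) hθ]
  · have : Nonempty (Fin d) := ⟨⟨0, hd⟩⟩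
    exact Matrix.det_zero
  · simp only [hk, hzero x hx, Real.sqrt_zero]

/-- The points `θ` where the number of distinct eigenvalues of `V̂(θ)` is maximal and `V̂(θ)` is
invertible. -/
def regularSet (hV : ∀ θ, (torusFourier V θ).IsHermitian) : Set (Fin d → ℝ) :=
  {θ | (eigSet (hV θ)).card = maxCard hV ∧
    (torusFourier V θ).det ≠ 0}

/-- Almost all points are regular, the others being zeros of a Hankel determinant or of `det V̂`. -/
lemma volume_compl_regularSet (hd : 1 ≤ d) (hE1 : CondE1 V) (hE3 : CondE3 V) (hE4 : CondE4 V) :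
    volume (regularSet hV)ᶜ = 0 := by
  have : Nonempty (Fin d) := ⟨⟨0, hd⟩⟩
  obtain ⟨θ₁, h₁⟩ := exists_card_eigSet_eq_maxCard hV
  obtain ⟨θ₂, h₂⟩ := exists_det_ne_zero hd hE1 hE3 hE4
  have hz1 := measure_zeros_analytic volume isOpen_univ convex_univ
    (f := fun θ => (hankel (hV θ) (maxCard hV)).det)
    (fun θ _ => analyticAt_hankel_det (analyticAt_torusFourier hE1 θ) _) (Set.mem_univ θ₁)
    ((card_eigSet_eq_maxCard_iff _ θ₁).1 h₁)
  have hz2 := measure_zeros_analytic volume isOpen_univ convex_univ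
    (f := fun θ => Complex.normSq (torusFourier V θ).det) (fun θ _ => ?_) (Set.mem_univ θ₂)
    (Complex.normSq_pos.2 h₂).ne'
  swap
  · have h := analyticAt_det (analyticAt_torusFourier hE1 θ)
    have hre := (Complex.reCLM.analyticAt _).comp h
    have him := (Complex.imCLM.analyticAt _).comp h
    exact (hre.mul hre).add (him.mul him)
  refine measure_mono_null (fun θ hθ => ?_) (measure_union_null hz1 hz2)
  simp only [regularSet, card_eigSet_eq_maxCard_iff, Set.mem_compl_iff, Set.mem_ofPred_eq,
    not_and_or, not_not] at hθ
  simpa using hθ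

/-- Invertible eigenvalue branches exist near all regular points. -/
lemma exists_eigenBranches_of_mem_regularSet (hE1 : CondE1 V) (hθ₀ : θ₀ ∈ regularSet hV) :
    ∃ O ψ, EigenBranches hV O θ₀ ψ ∧
      ∀ θ ∈ O, (torusFourier V θ).det ≠ 0 := by
  have han := analyticAt_torusFourier hE1 θ₀
  obtain ⟨O₁, ψ, h₁⟩ := exists_eigenBranches han (eventually_card_eigSet_eq han hθ₀.1)
  obtain ⟨O, h⟩ := h₁.exists_subset
    ((analyticAt_det han).continuousAt.eventually_ne hθ₀.2)
  exact ⟨O, ψ, h⟩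

lemma EigenBranches.pos (hE3 : CondE3 V) (h : EigenBranches hV O θ₀ ψ)
    (hdet : ∀ θ ∈ O, (torusFourier V θ).det ≠ 0) {θ : Fin d → ℝ} (hθ : θ ∈ O) {r : ℝ}
    (hr : r ∈ eigSet (hV θ₀)) : 0 < ψ r θ := by
  refine lt_of_le_of_ne (h.nonneg hE3 hθ hr) fun h0 => hdet θ hθ ?_
  rw [← zero_mem_eigSet_iff (hV θ), h.image_eq θ hθ]
  exact Finset.mem_image.2 ⟨r, hr, h0.symm⟩

lemma EigenBranches.analyticOnNhd_sqrt (hE3 : CondE3 V)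
    (h : EigenBranches hV O θ₀ ψ)
    (hdet : ∀ θ ∈ O, (torusFourier V θ).det ≠ 0) {r : ℝ}
    (hr : r ∈ eigSet (hV θ₀)) :
    AnalyticOnNhd ℝ (fun θ => Real.sqrt (ψ r θ)) O := by
  intro θ hθ
  have h2 : ContDiffAt ℝ ⊤ (fun θ => Real.sqrt (ψ r θ)) θ :=
    (h.analytic _ hr θ hθ).contDiffAt.sqrt (h.pos hE3 hdet hθ hr).ne'
  exact h2.analyticAt

/-- The phases of the nonresonant terms are not constant. -/
lemma EigenBranches.exists_phase_ne (hd : 1 ≤ d) (hE3 : CondE3 V)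
    (hE4 : CondE4 V) (hE5 : CondE5 V)
    (h : EigenBranches hV O θ₀ ψ)
    (hdet : ∀ θ ∈ O, (torusFourier V θ).det ≠ 0) {r r' : ℝ}
    (hr : r ∈ eigSet (hV θ₀))
    (hr' : r' ∈ eigSet (hV θ₀)) {ε ε' : ℤˣ}
    (hne : (ε, r) ≠ (ε', r')) :
    ∃ θ ∈ O, ((ε : ℤ) : ℝ) * Real.sqrt (ψ r θ) - ((ε' : ℤ) : ℝ) * Real.sqrt (ψ r' θ) ≠
      ((ε : ℤ) : ℝ) * Real.sqrt (ψ r θ₀) - ((ε' : ℤ) : ℝ) * Real.sqrt (ψ r' θ₀) := by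
  have : Nonempty (Fin d) := ⟨⟨0, hd⟩⟩
  have hdisp := h.isLocalDispersion fun r hr => Or.inl fun θ hθ => (h.pos hE3 hdet hθ hr).ne'
  obtain ⟨k, hk⟩ := (mem_eigSet _).1 hr
  obtain ⟨l, hl⟩ := (mem_eigSet _).1 hr'
  have hw : 0 < Real.sqrt (ψ r θ₀) := Real.sqrt_pos.2 (h.pos hE3 hdet h.mem hr)
  have hw' : 0 < Real.sqrt (ψ r' θ₀) := Real.sqrt_pos.2 (h.pos hE3 hdet h.mem hr')
  by_contra! hall
  by_cases hrr : r = r'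
  · -- the phase is `± 2 ω`, and `ω` is not constant by the Hessian condition
    subst hrr
    obtain ⟨θ, hθ, h4⟩ := hE4 O _ hdisp k
    refine h4 ?_
    rw [hessian_eq_zero (c := Real.sqrt (ψ r θ₀)) h.isOpen (fun x hx => ?_) hθ]
    · exact Matrix.det_zero
    · have h1 := hall x hx
      have h2 : ((ε : ℤ) : ℝ) - ((ε' : ℤ) : ℝ) ≠ 0 := by
        rw [sub_ne_zero]
        intro h3
        exact hne (congrArg (·, r) (Units.ext (by exact_mod_cast h3)))
      rw [← sub_mul, ← sub_mul] at h1
      simp only [hk]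
      exact mul_left_cancel₀ h2 h1
  · have hkl : k ≠ l := fun h1 => hrr (by rw [← hk, ← hl, h1])
    have hsub : Real.sqrt (ψ r θ₀) - Real.sqrt (ψ r' θ₀) ≠ 0 := by
      rw [sub_ne_zero, h.apply_self r hr, h.apply_self r' hr', Ne,
        Real.sqrt_inj (nonneg_of_mem_eigSet (hV θ₀) (hE3 θ₀) hr) (nonneg_of_mem_eigSet (hV θ₀) (hE3 θ₀) hr')]
      exact hrr
    have h1 := (hE5 O _ hdisp k l hkl _ hsub).1
    have h2 := (hE5 O _ hdisp k l hkl _ (add_pos hw hw').ne').2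
    simp only [hk, hl] at h1 h2
    rcases Int.units_eq_one_or ε with rfl | rfl <;> rcases Int.units_eq_one_or ε' with rfl | rfl <;>
      simp only [Units.val_one, Units.val_neg, Int.cast_one, Int.cast_neg, one_mul, neg_mul] at hall
    · exact h1 hall
    · exact h2 fun θ hθ => by have := hall θ hθ; linarith
    · exact h2 fun θ hθ => by have := hall θ hθ; linarith
    · exact h1 fun θ hθ => by have := hall θ hθ; linarith

end Dispersion

/-! ### Spectral projections -/

section SpectralProj

variable {A : Matrix (Fin n) (Fin n) ℂ}

lemma mem_spectrum_iff (hA : A.IsHermitian) {r : ℝ} : r ∈ spectrum ℝ A ↔ r ∈ eigSet hA := by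
  rw [← coe_eigSet hA, Finset.mem_coe]

/-- The functional calculus in terms of the spectral projections. -/
lemma cfc_eq_sum_spectralProj (hA : A.IsHermitian) (f : ℝ → ℝ) :
    cfc f A = ∑ r ∈ eigSet hA, f r • spectralProj A r := by
  have h1 : cfc f A = cfc (∑ r ∈ eigSet hA, fun x => f r • (Set.indicator {r} 1 : ℝ → ℝ) x) A := by
    refine cfc_congr fun x hx => ?_
    rw [Finset.sum_apply, Finset.sum_eq_single_of_mem x ((mem_spectrum_iff hA).1 hx)]
    · simp
    · intro r _ hne
      simp [hne.symm]
  rw [h1, cfc_sum _ _ _ fun _ _ => continuousOn_spectrum _]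
  exact Finset.sum_congr rfl fun r _ => cfc_smul (f r) _ A (continuousOn_spectrum _)

lemma cfc_mul_spectralProj (A : Matrix (Fin n) (Fin n) ℂ) (f : ℝ → ℝ) (r : ℝ) :
    cfc f A * spectralProj A r = f r • spectralProj A r := by
  rw [spectralProj, ← cfc_mul _ _ _ (continuousOn_spectrum _) (continuousOn_spectrum _),
    ← cfc_smul _ _ _ (continuousOn_spectrum _)]
  refine cfc_congr fun x _ => ?_
  by_cases hx : x = r
  · simp [hx]
  · simp [hx]

lemma spectralProj_mul_cfc (A : Matrix (Fin n) (Fin n) ℂ) (f : ℝ → ℝ) (r : ℝ) :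
    spectralProj A r * cfc f A = f r • spectralProj A r := by
  rw [← cfc_mul_spectralProj, spectralProj]
  exact (cfc_commute_cfc _ _ A).eq

lemma sum_spectralProj (hA : A.IsHermitian) : ∑ r ∈ eigSet hA, spectralProj A r = 1 := by
  have h := cfc_eq_sum_spectralProj hA fun _ => 1
  rw [cfc_const_one ℝ A hA.isSelfAdjoint] at h
  simpa using h.symm

lemma mul_spectralProj (hA : A.IsHermitian) (r : ℝ) : A * spectralProj A r = r • spectralProj A r := by
  simpa [cfc_id' ℝ A hA.isSelfAdjoint] using cfc_mul_spectralProj A (fun x => x) r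

lemma isHermitian_spectralProj (A : Matrix (Fin n) (Fin n) ℂ) (r : ℝ) :
    (spectralProj A r).IsHermitian :=
  (cfc_predicate (R := ℝ) (p := IsSelfAdjoint) _ A : IsSelfAdjoint _)

lemma spectralProj_mul_self (A : Matrix (Fin n) (Fin n) ℂ) (r : ℝ) :
    spectralProj A r * spectralProj A r = spectralProj A r := by
  refine (cfc_mul_spectralProj A (Set.indicator {r} 1) r).trans ?_
  have h : Set.indicator {r} (1 : ℝ → ℝ) r = 1 := by simp
  rw [h, one_smul]

lemma norm_spectralProj_apply_le (A : Matrix (Fin n) (Fin n) ℂ) (r : ℝ) (k l : Fin n) :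
    ‖spectralProj A r k l‖ ≤ 1 := by
  set P := spectralProj A r with hP
  have h1 : P k k = ((∑ a, ‖P k a‖ ^ 2 : ℝ) : ℂ) := by
    conv_lhs => rw [hP, ← spectralProj_mul_self A r, Matrix.mul_apply]
    push_cast
    refine Finset.sum_congr rfl fun a _ => ?_
    rw [← (isHermitian_spectralProj A r).apply a k, Complex.star_def, ← Complex.ofReal_pow,
      ← Complex.normSq_eq_norm_sq, Complex.mul_conj]
  have h2 : ∀ a, ‖P k a‖ ^ 2 ≤ ‖P k k‖ := by
    intro a
    have h3 : ‖P k k‖ = ∑ a, ‖P k a‖ ^ 2 := by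
      conv_lhs => rw [h1]
      rw [Complex.norm_real, Real.norm_of_nonneg (by positivity)]
    rw [h3]
    exact Finset.single_le_sum (f := fun a => ‖P k a‖ ^ 2) (fun _ _ => by positivity)
      (Finset.mem_univ a)
  have h4 : ‖P k k‖ ≤ 1 := by nlinarith [h2 k, norm_nonneg (P k k)]
  nlinarith [h2 l, norm_nonneg (P k l)]

lemma spectralProj_cfc (hA : A.IsHermitian) {f : ℝ → ℝ} (hf : Set.InjOn f (spectrum ℝ A)) {r : ℝ}
    (hr : r ∈ spectrum ℝ A) : spectralProj (cfc f A) (f r) = spectralProj A r := by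
  rw [spectralProj, spectralProj, ← cfc_comp _ _ _ hA.isSelfAdjoint
    ((((Matrix.finite_real_spectrum (A := A)).image f)).continuousOn _) (continuousOn_spectrum _)]
  refine cfc_congr fun x hx => ?_
  by_cases hxr : x = r
  · simp [hxr]
  · have : f x ≠ f r := fun h => hxr (hf hx hr h)
    simp [hxr, this]

lemma norm_mul_mul_apply_le {B C : Matrix (Fin n) (Fin n) ℂ} {b c : ℝ} (hb : 0 ≤ b)
    (hB : ∀ k l, ‖B k l‖ ≤ b) (hC : ∀ k l, ‖C k l‖ ≤ c) (N : Matrix (Fin n) (Fin n) ℂ)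
    (k l : Fin n) : ‖(B * N * C) k l‖ ≤ b * c * ∑ x, ∑ y, ‖N x y‖ := by
  simp only [Matrix.mul_apply, Finset.sum_mul, Finset.mul_sum]
  rw [Finset.sum_comm]
  refine (norm_sum_le _ _).trans (Finset.sum_le_sum fun x _ => (norm_sum_le _ _).trans
    (Finset.sum_le_sum fun y _ => ?_))
  rw [norm_mul, norm_mul]
  calc _ ≤ b * ‖N x y‖ * c := by gcongr <;> apply_assumption
    _ = _ := by ring

end SpectralProj

/-! ### Normal modes -/

section Modes

open Matrix Kronecker

/-- The two normal modes, with `ε = ±1`, of an oscillator with frequency `w`: the projections onto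
the eigenvectors `(1, i ε w)` of its generator. -/
def oscProj (ε : ℤˣ) (w : ℝ) : Matrix (Fin 2) (Fin 2) ℂ :=
  !![1 / 2, -(Complex.I * (ε : ℤ) / w) / 2; Complex.I * (ε : ℤ) * w / 2, 1 / 2]

lemma sum_oscProj (w : ℝ) : ∑ ε : ℤˣ, oscProj ε w = 1 := by
  ext i j
  fin_cases i <;> fin_cases j <;> simp [oscProj, UnitsInt.univ] <;> ring

lemma mul_oscProj (ε : ℤˣ) {w : ℝ} (hw : w ≠ 0) :
    !![0, 1; -((w ^ 2 : ℝ) : ℂ), 0] * oscProj ε w = (Complex.I * ((ε : ℤ) * w)) • oscProj ε w := by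
  have hw' : (w : ℂ) ≠ 0 := by exact_mod_cast hw
  ext i j
  rcases Int.units_eq_one_or ε with rfl | rfl <;> fin_cases i <;> fin_cases j <;>
    simp [oscProj] <;> field_simp <;> simp

/-- The normal modes of the crystal: the modes of the oscillator with the squared frequency `r`,
with amplitudes in the eigenspace of `A` for the eigenvalue `r`. -/
def modeProj (A : Matrix (Fin n) (Fin n) ℂ) (ε : ℤˣ) (r : ℝ) :
    Matrix (Fin 2 × Fin n) (Fin 2 × Fin n) ℂ :=
  oscProj ε (Real.sqrt r) ⊗ₖ spectralProj A r

/-- The generator of the dynamics of oscillators with the matrix `A` of force constants. -/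
def generator (A : Matrix (Fin n) (Fin n) ℂ) : Matrix (Fin 2 × Fin n) (Fin 2 × Fin n) ℂ :=
  !![0, 1; 0, 0] ⊗ₖ (1 : Matrix (Fin n) (Fin n) ℂ) + !![0, 0; -1, 0] ⊗ₖ A

variable {A : Matrix (Fin n) (Fin n) ℂ}

lemma sum_modeProj (hA : A.IsHermitian) :
    ∑ r ∈ eigSet hA, ∑ ε : ℤˣ, modeProj A ε r = 1 := by
  have h : ∀ r, ∑ ε : ℤˣ, modeProj A ε r = 1 ⊗ₖ spectralProj A r := by
    intro r
    rw [← sum_oscProj (Real.sqrt r)]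
    simp [modeProj, UnitsInt.univ, add_kronecker]
  simp_rw [h]
  rw [← one_kronecker_one, ← sum_spectralProj hA]
  ext p q
  simp [Matrix.sum_apply, Finset.mul_sum]

lemma generator_mul_modeProj (hA : A.IsHermitian) (ε : ℤˣ) {r : ℝ} (hr : 0 < r) :
    generator A * modeProj A ε r =
      (Complex.I * ((ε : ℤ) * (Real.sqrt r : ℝ))) • modeProj A ε r := by
  have h1 : (r : ℂ) = ((Real.sqrt r ^ 2 : ℝ) : ℂ) := by rw [Real.sq_sqrt hr.le]
  have h2 : (!![0, 0; -1, 0] : Matrix (Fin 2) (Fin 2) ℂ) ⊗ₖ A * modeProj A ε r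
      = ((!![0, 0; -((Real.sqrt r ^ 2 : ℝ) : ℂ), 0] : Matrix (Fin 2) (Fin 2) ℂ)
          * oscProj ε (Real.sqrt r)) ⊗ₖ spectralProj A r := by
    rw [modeProj, ← mul_kronecker_mul, mul_spectralProj hA, ← h1]
    have h3 : (!![0, 0; -(r : ℂ), 0] : Matrix (Fin 2) (Fin 2) ℂ) = (r : ℂ) • !![0, 0; -1, 0] := by
      ext i j
      fin_cases i <;> fin_cases j <;> simp
    rw [h3, Matrix.smul_mul, smul_kronecker, ← Complex.coe_smul, kronecker_smul]
  rw [generator, add_mul, h2, modeProj, ← mul_kronecker_mul, one_mul, ← add_kronecker, ← add_mul,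
    ← smul_kronecker, ← mul_oscProj ε (Real.sqrt_pos.2 hr).ne']
  congr 2
  ext i j
  fin_cases i <;> fin_cases j <;> simp

open scoped Matrix.Norms.Operator in
lemma exp_mul_eq_smul {ι : Type*} [Fintype ι] [DecidableEq ι] {M P : Matrix ι ι ℂ} {c : ℂ}
    (h : M * P = c • P) : NormedSpace.exp M * P = Complex.exp c • P := by
  have h1 := (NormedSpace.exp_series_hasSum_exp' (𝕂 := ℂ) M).mul_right P
  have h2 := (NormedSpace.exp_series_hasSum_exp' (𝕂 := ℂ) c).smul_const P
  rw [← Complex.exp_eq_exp_ℂ] at h2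
  refine h1.unique (Eq.mp (congrArg (fun f => HasSum f _) (funext fun m => ?_)) h2)
  have h3 : M ^ m * P = c ^ m • P := by
    induction m with
    | zero => simp
    | succ m ih => rw [pow_succ, mul_assoc, h, mul_smul_comm, ih, smul_smul, pow_succ, mul_comm]
  rw [smul_mul_assoc, h3, smul_smul, smul_eq_mul]

lemma exp_smul_generator (hA : A.IsHermitian) (hpos : ∀ r ∈ eigSet hA, 0 < r) (t : ℝ) :
    NormedSpace.exp ((t : ℂ) • generator A) = ∑ r ∈ eigSet hA, ∑ ε : ℤˣ,
      Complex.exp (Complex.I * ((t * ((ε : ℤ) * Real.sqrt r) : ℝ) : ℂ)) • modeProj A ε r := by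
  conv_lhs => rw [← mul_one (NormedSpace.exp _), ← sum_modeProj hA]
  simp_rw [Finset.mul_sum]
  refine Finset.sum_congr rfl fun r hr => Finset.sum_congr rfl fun ε _ => ?_
  refine exp_mul_eq_smul ?_
  rw [smul_mul_assoc, generator_mul_modeProj hA ε (hpos r hr), smul_smul]
  congr 1
  push_cast
  ring

/-- The amplitude of the interference term of two normal modes in the evolution of the spectral
density `q`. -/
def modeAmp (A : Matrix (Fin n) (Fin n) ℂ) (q : Matrix (Fin 2 × Fin n) (Fin 2 × Fin n) ℂ)
    (ε ε' : ℤˣ) (r r' : ℝ) : Matrix (Fin 2 × Fin n) (Fin 2 × Fin n) ℂ :=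
  modeProj A ε r * q * (modeProj A ε' r')ᴴ

lemma exp_mul_mul_exp_eq (hA : A.IsHermitian) (hpos : ∀ r ∈ eigSet hA, 0 < r) (t : ℝ)
    (q : Matrix (Fin 2 × Fin n) (Fin 2 × Fin n) ℂ) :
    NormedSpace.exp ((t : ℂ) • generator A) * q * (NormedSpace.exp ((t : ℂ) • generator A))ᴴ
      = ∑ r ∈ eigSet hA, ∑ ε : ℤˣ, ∑ r' ∈ eigSet hA, ∑ ε' : ℤˣ,
        Complex.exp (Complex.I *
          ((t * ((ε : ℤ) * Real.sqrt r - (ε' : ℤ) * Real.sqrt r') : ℝ) : ℂ)) •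
          modeAmp A q ε ε' r r' := by
  rw [exp_smul_generator hA hpos]
  simp_rw [conjTranspose_sum, Finset.sum_mul, Finset.mul_sum]
  refine Finset.sum_congr rfl fun r hr => Finset.sum_congr rfl fun ε _ =>
    Finset.sum_congr rfl fun r' hr' => Finset.sum_congr rfl fun ε' _ => ?_
  rw [conjTranspose_smul, smul_mul_assoc, smul_mul_assoc, mul_smul_comm, smul_smul, modeAmp,
    Complex.star_def, ← Complex.exp_conj, ← Complex.exp_add]
  congr 2
  simp only [map_mul, Complex.conj_I, Complex.conj_ofReal]
  push_cast
  ring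

/-- The block `(i, j)` of a matrix. -/
def block (q : Matrix (Fin 2 × Fin n) (Fin 2 × Fin n) ℂ) (i j : Fin 2) : Matrix (Fin n) (Fin n) ℂ :=
  of fun k l => q (i, k) (j, l)

lemma modeAmp_apply (q : Matrix (Fin 2 × Fin n) (Fin 2 × Fin n) ℂ) (ε ε' : ℤˣ) (r r' : ℝ)
    (i j : Fin 2) (k l : Fin n) :
    modeAmp A q ε ε' r r' (i, k) (j, l) = ∑ a, ∑ b,
      oscProj ε (Real.sqrt r) i a * star (oscProj ε' (Real.sqrt r') j b) *
        (spectralProj A r * block q a b * spectralProj A r') k l := by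
  have hH : ∀ x, star (spectralProj A r' l x) = spectralProj A r' x l := fun x =>
    (isHermitian_spectralProj A r').apply x l
  simp only [modeAmp, modeProj, mul_apply, conjTranspose_apply, kronecker_apply, star_mul',
    Fintype.sum_prod_type, block, of_apply, hH, Finset.sum_mul, Finset.mul_sum]
  rw [Finset.sum_congr rfl fun b _ => Finset.sum_comm, Finset.sum_comm]
  refine Finset.sum_congr rfl fun a _ => Finset.sum_congr rfl fun b _ =>
    Finset.sum_congr rfl fun y _ => Finset.sum_congr rfl fun x _ => ?_
  ring

end Modes

section ModeBounds

variable {A : Matrix (Fin n) (Fin n) ℂ}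

lemma inv_cfc_sqrt (hA : A.IsHermitian) (hpos : ∀ r ∈ eigSet hA, 0 < r) :
    (cfc Real.sqrt A)⁻¹ = cfc (fun x => (Real.sqrt x)⁻¹) A := by
  refine Matrix.inv_eq_right_inv ?_
  rw [← cfc_mul _ _ _ (continuousOn_spectrum _) (continuousOn_spectrum _),
    ← cfc_const_one ℝ A hA.isSelfAdjoint]
  refine cfc_congr fun x hx => ?_
  exact mul_inv_cancel₀ (Real.sqrt_pos.2 (hpos x ((mem_spectrum_iff hA).1 hx))).ne'

/-- The sum of the resonant terms with a fixed frequency. -/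
lemma sum_modeAmp_self (q : Matrix (Fin 2 × Fin n) (Fin 2 × Fin n) ℂ) {r : ℝ} (hr : 0 < r)
    (i j : Fin 2) (k l : Fin n) :
    ∑ ε : ℤˣ, modeAmp A q ε ε r r (i, k) (j, l) =
      (spectralProj A r * ((1 / 2 : ℂ) • (!![
        block q 0 0 + (Real.sqrt r)⁻¹ • (Real.sqrt r)⁻¹ • block q 1 1, block q 0 1 - block q 1 0;
        block q 1 0 - block q 0 1, block q 1 1 + Real.sqrt r • Real.sqrt r • block q 0 0] i j)) *
        spectralProj A r) k l := by
  have hw : ((Real.sqrt r : ℝ) : ℂ) ≠ 0 := by exact_mod_cast (Real.sqrt_pos.2 hr).ne'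
  have hI : Complex.I * Complex.I = -1 := Complex.I_mul_I
  simp only [modeAmp_apply, UnitsInt.univ, Fin.sum_univ_two, oscProj]
  fin_cases i <;> fin_cases j <;>
    simp [Matrix.mul_add, Matrix.add_mul, Matrix.mul_sub, Matrix.sub_mul, ← Complex.coe_smul] <;>
    field_simp <;> ring_nf <;> simp <;> ring

lemma norm_oscProj_mul_le (ε : ℤˣ) {w : ℝ} (hw : 0 < w) (i a : Fin 2) :
    ‖oscProj ε w i a‖ * w ^ (a : ℕ) ≤ 1 + w := by
  rcases Int.units_eq_one_or ε with rfl | rfl <;> fin_cases i <;> fin_cases a <;>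
    simp [oscProj, abs_of_pos hw] <;> field_simp <;> linarith

/-- The amplitudes are controlled by the matrices `Ω^{-a} q^{ab} Ω^{-b}`. -/
lemma norm_modeAmp_apply_le (hA : A.IsHermitian) (hpos : ∀ r ∈ eigSet hA, 0 < r)
    (q : Matrix (Fin 2 × Fin n) (Fin 2 × Fin n) ℂ) (ε ε' : ℤˣ) {r r' : ℝ}
    (hr : r ∈ eigSet hA) (hr' : r' ∈ eigSet hA) (p p' : Fin 2 × Fin n) :
    ‖modeAmp A q ε ε' r r' p p'‖ ≤ (1 + Real.sqrt r) * (1 + Real.sqrt r') *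
      ∑ a : Fin 2, ∑ b : Fin 2, ∑ k, ∑ l, ‖((cfc Real.sqrt A)⁻¹ ^ (a : ℕ) * block q a b *
        (cfc Real.sqrt A)⁻¹ ^ (b : ℕ)) k l‖ := by
  obtain ⟨i, k⟩ := p
  obtain ⟨j, l⟩ := p'
  have hw := Real.sqrt_pos.2 (hpos r hr)
  have hw' := Real.sqrt_pos.2 (hpos r' hr')
  set w := Real.sqrt r with hwdef
  set w' := Real.sqrt r' with hwdef'
  set N : Fin 2 → Fin 2 → Matrix (Fin n) (Fin n) ℂ := fun a b =>
    (cfc Real.sqrt A)⁻¹ ^ (a : ℕ) * block q a b * (cfc Real.sqrt A)⁻¹ ^ (b : ℕ) with hN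
  have h1 : ∀ a : Fin 2, spectralProj A r * (cfc Real.sqrt A)⁻¹ ^ (a : ℕ)
      = (w ^ (a : ℕ))⁻¹ • spectralProj A r := by
    intro a
    fin_cases a
    · simp
    · simp [inv_cfc_sqrt hA hpos, spectralProj_mul_cfc, hwdef]
  have h2 : ∀ b : Fin 2, (cfc Real.sqrt A)⁻¹ ^ (b : ℕ) * spectralProj A r'
      = (w' ^ (b : ℕ))⁻¹ • spectralProj A r' := by
    intro b
    fin_cases b
    · simp
    · simp [inv_cfc_sqrt hA hpos, cfc_mul_spectralProj, hwdef']
  have h3 : ∀ a b, spectralProj A r * block q a b * spectralProj A r'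
      = (w ^ (a : ℕ) * w' ^ (b : ℕ)) • (spectralProj A r * N a b * spectralProj A r') := by
    intro a b
    have h4 : spectralProj A r * N a b * spectralProj A r'
        = (spectralProj A r * (cfc Real.sqrt A)⁻¹ ^ (a : ℕ)) * block q a b *
          ((cfc Real.sqrt A)⁻¹ ^ (b : ℕ) * spectralProj A r') := by
      simp only [hN, mul_assoc]
    rw [h4, h1, h2, smul_mul_assoc, smul_mul_assoc, mul_smul_comm, smul_smul, smul_smul]
    have h5 : w ^ (a : ℕ) ≠ 0 := by positivity
    have h6 : w' ^ (b : ℕ) ≠ 0 := by positivity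
    have h7 : w ^ (a : ℕ) * w' ^ (b : ℕ) * (w ^ (a : ℕ))⁻¹ * (w' ^ (b : ℕ))⁻¹ = 1 := by
      field_simp
    rw [h7, one_smul]
  rw [modeAmp_apply, Finset.mul_sum]
  refine (norm_sum_le _ _).trans (Finset.sum_le_sum fun a _ => ?_)
  rw [Finset.mul_sum]
  refine (norm_sum_le _ _).trans (Finset.sum_le_sum fun b _ => ?_)
  have h8 := norm_mul_mul_apply_le zero_le_one (norm_spectralProj_apply_le A r)
    (norm_spectralProj_apply_le A r') (N a b) k l
  rw [one_mul, one_mul] at h8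
  have h9 := norm_oscProj_mul_le ε hw i a
  have h10 := norm_oscProj_mul_le ε' hw' j b
  rw [h3, Matrix.smul_apply, norm_mul, norm_mul, norm_star, norm_smul, norm_mul, norm_pow, norm_pow,
    Real.norm_of_nonneg hw.le, Real.norm_of_nonneg hw'.le]
  calc _ = (‖oscProj ε w i a‖ * w ^ (a : ℕ)) * (‖oscProj ε' w' j b‖ * w' ^ (b : ℕ)) *
        ‖(spectralProj A r * N a b * spectralProj A r') k l‖ := by ring
    _ ≤ _ := by gcongr

end ModeBounds

/-! ### The spectral density in terms of normal modes -/

section NormalModes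

variable {V : Interaction d n} {μ : Measure (PhaseSpace d n α)}

lemma fourierSum_zero (θ : Fin d → ℝ) : fourierSum (fun _ => 0) θ = 0 := by
  simp [fourierSum]

lemma symbol_eq_generator (V : Interaction d n) (θ : Fin d → ℝ) :
    symbol V θ = generator (torusFourier V θ) := by
  have h1 : ∀ k l : Fin n, fourierSum (fun w : Site d =>
      (if w = 0 then (1 : Matrix (Fin n) (Fin n) ℝ) else 0) k l) θ
        = (1 : Matrix (Fin n) (Fin n) ℂ) k l := by
    intro k l
    rw [fourierSum, tsum_eq_single 0]
    · by_cases hkl : k = l <;> simp [hkl, phase, Matrix.one_apply]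
    · intro w hw
      simp [hw]
  have h2 : ∀ k l : Fin n, fourierSum (fun w : Site d => (-V w) k l) θ = -torusFourier V θ k l := by
    intro k l
    rw [torusFourier_apply, fourierSum, fourierSum, ← tsum_neg]
    simp
  ext ⟨i, k⟩ ⟨j, l⟩
  fin_cases i <;> fin_cases j <;>
    simp [symbol, genKernel, generator, h1, fourierSum_zero, Matrix.kroneckerMap_apply] <;> exact h2 k l

lemma block_qBlock (i j : Fin 2) (θ : Fin d → ℝ) : block (qBlock μ θ) i j = qHat μ i j θ := rfl

variable {hV : ∀ θ, (torusFourier V θ).IsHermitian} {θ : Fin d → ℝ}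

lemma qInfHat_eq_sum (hpos : ∀ r ∈ eigSet (hV θ), 0 < r) (i j : Fin 2) :
    qInfHat V μ i j θ = ∑ r ∈ eigSet (hV θ), spectralProj (torusFourier V θ) r * M0 V μ i j θ *
      spectralProj (torusFourier V θ) r := by
  have hinj : Set.InjOn Real.sqrt (eigSet (hV θ)) := fun r hr r' hr' h =>
    (Real.sqrt_inj (hpos r hr).le (hpos r' hr').le).1 h
  have h1 : spectrum ℝ (Om V θ) = ((eigSet (hV θ)).image Real.sqrt : Finset ℝ) := by
    rw [Om, cfc_map_spectrum Real.sqrt _ (hV θ).isSelfAdjoint, Finset.coe_image, coe_eigSet]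
  rw [qInfHat, h1, finsum_mem_coe_finset, Finset.sum_image hinj]
  rw [coe_eigSet] at hinj
  refine Finset.sum_congr rfl fun r hr => ?_
  rw [Om, spectralProj_cfc (hV θ) hinj ((mem_spectrum_iff (hV θ)).2 hr)]

/-- The limit spectral density is the sum of the resonant terms. -/
lemma qInfHat_apply_eq_sum (hpos : ∀ r ∈ eigSet (hV θ), 0 < r) (i j : Fin 2) (k l : Fin n) :
    qInfHat V μ i j θ k l = ∑ r ∈ eigSet (hV θ), ∑ ε : ℤˣ,
      modeAmp (torusFourier V θ) (qBlock μ θ) ε ε r r (i, k) (j, l) := by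
  rw [qInfHat_eq_sum hpos, Matrix.sum_apply]
  refine Finset.sum_congr rfl fun r hr => ?_
  rw [sum_modeAmp_self _ (hpos r hr)]
  simp only [block_qBlock]
  set P := spectralProj (torusFourier V θ) r with hP
  have hinv := inv_cfc_sqrt (hV θ) hpos
  have h1 : Om V θ * P = Real.sqrt r • P := cfc_mul_spectralProj _ _ _
  have h2 : P * Om V θ = Real.sqrt r • P := spectralProj_mul_cfc _ _ _
  have h3 : (Om V θ)⁻¹ * P = (Real.sqrt r)⁻¹ • P := by
    rw [Om, hinv]; exact cfc_mul_spectralProj _ _ _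
  have h4 : P * (Om V θ)⁻¹ = (Real.sqrt r)⁻¹ • P := by
    rw [Om, hinv]; exact spectralProj_mul_cfc _ _ _
  have h5 : ∀ X Y Z : Matrix (Fin n) (Fin n) ℂ, P * (X * Y * Z) * P = (P * X) * Y * (Z * P) :=
    fun X Y Z => by simp only [mul_assoc]
  have hw : Real.sqrt r ≠ 0 := (Real.sqrt_pos.2 (hpos r hr)).ne'
  have h6 : M0 V μ i j θ = (1 / 2 : ℂ) • (!![
    qHat μ 0 0 θ + (Om V θ)⁻¹ * qHat μ 1 1 θ * (Om V θ)⁻¹,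
    qHat μ 0 1 θ - (Om V θ)⁻¹ * qHat μ 1 0 θ * Om V θ;
    qHat μ 1 0 θ - Om V θ * qHat μ 0 1 θ * (Om V θ)⁻¹,
    qHat μ 1 1 θ + Om V θ * qHat μ 0 0 θ * Om V θ] i j) := rfl
  rw [h6]
  rw [mul_smul_comm, mul_smul_comm, smul_mul_assoc, smul_mul_assoc]
  fin_cases i <;> fin_cases j <;>
    simp [mul_add, add_mul, mul_sub, sub_mul, h5, h1, h2, h3, h4, smul_smul, hw]

end NormalModes

/-! ### Continuity of the amplitudes -/

section Continuity

variable {E : Type*} [NormedAddCommGroup E] [NormedSpace ℝ E] {A : E → Matrix (Fin n) (Fin n) ℂ}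
  {hA : ∀ θ, (A θ).IsHermitian} {θ₀ : E} {O : Set E} {ψ : ℝ → E → ℝ}

/-- The spectral projections are continuous, being polynomials in the matrix with coefficients
depending continuously on the distinct eigenvalues. -/
lemma EigenBranches.continuousOn_spectralProj (h : EigenBranches hA O θ₀ ψ)
    (hc : ContinuousOn A O) {r : ℝ} (hr : r ∈ eigSet (hA θ₀)) :
    ContinuousOn (fun θ => spectralProj (A θ) (ψ r θ)) O := by
  classical
  have hψ : ∀ r' ∈ eigSet (hA θ₀), ContinuousOn (ψ r') O := fun r' hr' =>
    (h.analytic r' hr').continuousOn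
  have hprod : ∀ T ⊆ eigSet (hA θ₀),
      ContinuousOn (fun θ => cfc (fun x => ∏ r' ∈ T, (x - ψ r' θ)) (A θ)) O := by
    intro T
    induction T using Finset.induction_on with
    | empty =>
      intro _
      simp only [Finset.prod_empty]
      refine continuousOn_const (c := (1 : Matrix (Fin n) (Fin n) ℂ)) |>.congr fun θ _ => ?_
      exact cfc_const_one ℝ (A θ) (hA θ).isSelfAdjoint
    | insert r' T hr' ih =>
      intro hT
      have h1 : ∀ θ, cfc (fun x => ∏ r'' ∈ insert r' T, (x - ψ r'' θ)) (A θ)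
          = (A θ - (ψ r' θ) • 1) * cfc (fun x => ∏ r'' ∈ T, (x - ψ r'' θ)) (A θ) := by
        intro θ
        simp only [Finset.prod_insert hr']
        rw [cfc_mul _ _ _ (continuousOn_spectrum _) (continuousOn_spectrum _),
          cfc_sub _ _ _ (continuousOn_spectrum _) (continuousOn_spectrum _),
          cfc_id' ℝ (A θ) (hA θ).isSelfAdjoint, cfc_const _ _ (hA θ).isSelfAdjoint,
          Algebra.algebraMap_eq_smul_one]
      simp_rw [h1]
      exact (hc.sub ((hψ r' (hT (Finset.mem_insert_self _ _))).smul continuousOn_const)).mul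
        (ih ((Finset.subset_insert _ _).trans hT))
  set T := (eigSet (hA θ₀)).erase r with hT
  have h2 : ∀ θ ∈ O, ∏ r' ∈ T, (ψ r θ - ψ r' θ) ≠ 0 := by
    intro θ hθ
    refine Finset.prod_ne_zero_iff.2 fun r' hr' => sub_ne_zero.2 fun heq => ?_
    exact Finset.ne_of_mem_erase hr' (h.injOn θ hθ (Finset.mem_of_mem_erase hr') hr heq.symm)
  have h3 : ContinuousOn (fun θ => ∏ r' ∈ T, (ψ r θ - ψ r' θ)) O :=
    continuousOn_finsetProd _ fun r' hr' => (hψ r hr).sub (hψ r' (Finset.mem_of_mem_erase hr'))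
  refine ((h3.inv₀ h2).smul (hprod T (Finset.erase_subset _ _))).congr fun θ hθ => ?_
  change _ = (∏ r' ∈ T, (ψ r θ - ψ r' θ))⁻¹ • cfc (fun x => ∏ r' ∈ T, (x - ψ r' θ)) (A θ)
  rw [← cfc_smul _ _ _ (continuousOn_spectrum _), spectralProj]
  refine cfc_congr fun x hx => ?_
  rw [mem_spectrum_iff (hA θ), h.image_eq θ hθ] at hx
  obtain ⟨r₁, hr₁, rfl⟩ := Finset.mem_image.1 hx
  by_cases heq : r₁ = r
  · subst heq
    simp [inv_mul_cancel₀ (h2 θ hθ)]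
  · have h4 : ψ r₁ θ ≠ ψ r θ := fun h5 => heq (h.injOn θ hθ hr₁ hr h5)
    have h5 : ∏ r' ∈ T, (ψ r₁ θ - ψ r' θ) = 0 :=
      Finset.prod_eq_zero (Finset.mem_erase.2 ⟨heq, hr₁⟩ : r₁ ∈ T) (sub_self _)
    simp [h4, h5]

lemma EigenBranches.continuousOn_modeAmp (h : EigenBranches hA O θ₀ ψ)
    (hc : ContinuousOn A O) {q : E → Matrix (Fin 2 × Fin n) (Fin 2 × Fin n) ℂ}
    (hq : ContinuousOn q O) (ε ε' : ℤˣ) {r r' : ℝ} (hr : r ∈ eigSet (hA θ₀))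
    (hr' : r' ∈ eigSet (hA θ₀)) (hpos : ∀ θ ∈ O, 0 < ψ r θ) (hpos' : ∀ θ ∈ O, 0 < ψ r' θ)
    (p p' : Fin 2 × Fin n) :
    ContinuousOn (fun θ => modeAmp (A θ) (q θ) ε ε' (ψ r θ) (ψ r' θ) p p') O := by
  have h1 : ∀ (ε : ℤˣ) {r : ℝ}, r ∈ eigSet (hA θ₀) → (∀ θ ∈ O, 0 < ψ r θ) → ∀ i j,
      ContinuousOn (fun θ => oscProj ε (Real.sqrt (ψ r θ)) i j) O := by
    intro ε r hr hpos i j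
    have hw : ContinuousOn (fun θ => ((Real.sqrt (ψ r θ) : ℝ) : ℂ)) O :=
      Complex.continuous_ofReal.comp_continuousOn (h.analytic r hr).continuousOn.sqrt
    have hw0 : ∀ θ ∈ O, ((Real.sqrt (ψ r θ) : ℝ) : ℂ) ≠ 0 := fun θ hθ => by
      exact_mod_cast (Real.sqrt_pos.2 (hpos θ hθ)).ne'
    fin_cases i <;> fin_cases j
    · exact continuousOn_const
    · exact ((continuousOn_const.div hw hw0).neg).div_const _
    · exact (continuousOn_const.mul hw).div_const _
    · exact continuousOn_const
  have h2 : ∀ {r : ℝ}, r ∈ eigSet (hA θ₀) → ∀ k l,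
      ContinuousOn (fun θ => spectralProj (A θ) (ψ r θ) k l) O := fun hr k l =>
    ((continuous_apply_apply k l).comp_continuousOn (h.continuousOn_spectralProj hc hr) :)
  have h3 : ∀ p p', ContinuousOn (fun θ => q θ p p') O := fun p p' =>
    ((continuous_apply_apply p p').comp_continuousOn hq :)
  obtain ⟨i, k⟩ := p
  obtain ⟨j, l⟩ := p'
  simp only [modeAmp_apply, Matrix.mul_apply, block, Matrix.of_apply]
  refine continuousOn_finsetSum _ fun a _ => continuousOn_finsetSum _ fun b _ => ?_
  refine ((h1 ε hr hpos i a).mul (h1 ε' hr' hpos' j b).star).mul ?_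
  exact continuousOn_finsetSum _ fun y _ => (continuousOn_finsetSum _ fun x _ =>
    (h2 hr k x).mul (h3 _ _)).mul (h2 hr' y l)

end Continuity

/-! ### Integrable bounds for the amplitudes -/

section Bounds

variable {V : Interaction d n} {μ : Measure (PhaseSpace d n α)}

lemma continuous_torusFourier (hE1 : CondE1 V) : Continuous (torusFourier V) :=
  continuous_matrix fun k l => continuous_iff_continuousAt.2 fun θ =>
    (analyticAt_torusFourier hE1 θ k l).continuousAt

lemma le_norm_trace_cfc {A : Matrix (Fin n) (Fin n) ℂ} (hA : A.IsHermitian) {f : ℝ → ℝ}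
    (hf : ∀ r ∈ eigSet hA, 0 ≤ f r) {r : ℝ} (hr : r ∈ eigSet hA) : f r ≤ ‖(cfc f A).trace‖ := by
  have hf' : ∀ k, 0 ≤ f (hA.eigenvalues k) := fun k => hf _ ((mem_eigSet hA).2 ⟨k, rfl⟩)
  obtain ⟨k, rfl⟩ := (mem_eigSet hA).1 hr
  rw [trace_cfc hA, ← Complex.ofReal_sum, Complex.norm_real,
    Real.norm_of_nonneg (Finset.sum_nonneg fun k _ => hf' k)]
  exact Finset.single_le_sum (f := fun k => f (hA.eigenvalues k)) (fun k _ => hf' k)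
    (Finset.mem_univ k)

/-- The eigenvalues of `V̂` are bounded. -/
lemma exists_eigSet_le (hE1 : CondE1 V) (hE3 : CondE3 V)
    (hV : ∀ θ, (torusFourier V θ).IsHermitian) :
    ∃ C, ∀ θ ∈ cube d, ∀ r ∈ eigSet (hV θ), r ≤ C := by
  obtain ⟨C, hC⟩ := (isCompact_cube d).exists_bound_of_continuousOn
    (continuous_torusFourier hE1).matrix_trace.continuousOn
  refine ⟨C, fun θ hθ r hr => le_trans ?_ (hC θ hθ)⟩
  have := le_norm_trace_cfc (hV θ) (f := fun x => x)
    (fun r hr => nonneg_of_mem_eigSet (hV θ) (hE3 θ) hr) hr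
  rwa [cfc_id' ℝ _ (hV θ).isSelfAdjoint] at this

lemma inv_eq_cfc {A : Matrix (Fin n) (Fin n) ℂ} (hA : A.IsHermitian)
    (hpos : ∀ r ∈ eigSet hA, 0 < r) : A⁻¹ = cfc (fun x : ℝ => x⁻¹) A := by
  refine Matrix.inv_eq_right_inv ?_
  have h := cfc_mul (fun x : ℝ => x) (fun x => x⁻¹) A (continuousOn_spectrum _)
    (continuousOn_spectrum _)
  rw [cfc_id' ℝ A hA.isSelfAdjoint] at h
  rw [← h, ← cfc_const_one ℝ A hA.isSelfAdjoint]
  exact cfc_congr fun x hx => mul_inv_cancel₀ (hpos x ((mem_spectrum_iff hA).1 hx)).ne'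

lemma pos_of_mem_eigSet (hE3 : CondE3 V) (hV : ∀ θ, (torusFourier V θ).IsHermitian)
    {θ : Fin d → ℝ} (hdet : (torusFourier V θ).det ≠ 0) {r : ℝ} (hr : r ∈ eigSet (hV θ)) :
    0 < r := by
  refine lt_of_le_of_ne (nonneg_of_mem_eigSet (hV θ) (hE3 θ) hr) fun h0 => hdet ?_
  rwa [← zero_mem_eigSet_iff (hV θ), h0]

lemma norm_cfc_apply_le {A : Matrix (Fin n) (Fin n) ℂ} (hA : A.IsHermitian) {f : ℝ → ℝ} {C : ℝ}
    (hf : ∀ r ∈ eigSet hA, |f r| ≤ C) (k l : Fin n) : ‖cfc f A k l‖ ≤ n * C := by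
  have hC : ∀ r ∈ eigSet hA, 0 ≤ C := fun r hr => (abs_nonneg _).trans (hf r hr)
  rcases (eigSet hA).eq_empty_or_nonempty with h0 | ⟨r₀, hr₀⟩
  · refine absurd ((mem_eigSet hA).2 ⟨k, rfl⟩) ?_
    rw [h0]
    exact Finset.notMem_empty _
  rw [cfc_eq_sum_spectralProj hA, Matrix.sum_apply]
  refine (norm_sum_le _ _).trans ((Finset.sum_le_sum (g := fun _ => C) fun r hr => ?_).trans ?_)
  · rw [Matrix.smul_apply, norm_smul, Real.norm_eq_abs]
    exact (mul_le_of_le_one_right (abs_nonneg _) (norm_spectralProj_apply_le A r k l)).trans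
      (hf r hr)
  · rw [Finset.sum_const, nsmul_eq_mul]
    have := hC r₀ hr₀
    gcongr
    exact card_eigSet_le hA

/-- The matrices `Ω^{-a} q̂^{ab} Ω^{-b}` are dominated by an integrable function: this is assumed if
`V̂` is singular somewhere, and otherwise they are bounded. -/
lemma exists_integrableOn_bound (hE1 : CondE1 V) (hE3 : CondE3 V)
    (hsum : ∀ i j k l, Summable fun z : Site d => |corrDiff μ i j z k l|)
    (hES : (∃ θ, (torusFourier V θ).det = 0) → CondES V μ) :
    ∃ g : (Fin d → ℝ) → ℝ, IntegrableOn g (cube d) ∧ ∀ θ ∈ cube d,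
      ∑ a : Fin 2, ∑ b : Fin 2, ∑ k, ∑ l, ‖((Om V θ)⁻¹ ^ (a : ℕ) * block (qBlock μ θ) a b *
        (Om V θ)⁻¹ ^ (b : ℕ)) k l‖ ≤ g θ := by
  by_cases hdet : ∃ θ, (torusFourier V θ).det = 0
  · refine ⟨_, ?_, fun θ _ => le_rfl⟩
    exact integrable_finsetSum _ fun a _ => integrable_finsetSum _ fun b _ =>
      integrable_finsetSum _ fun k _ => integrable_finsetSum _ fun l _ => (hES hdet a b k l).norm
  push Not at hdet
  have hV := isHermitian_torusFourier hE3
  have hpos : ∀ θ, ∀ r ∈ eigSet (hV θ), 0 < r := fun θ r hr => pos_of_mem_eigSet hE3 hV (hdet θ) hr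
  have hinv : Continuous fun θ => (torusFourier V θ)⁻¹.trace := by
    simp only [Matrix.inv_def, Ring.inverse_eq_inv']
    exact (((continuous_torusFourier hE1).matrix_det.inv₀ hdet).smul
      (continuous_torusFourier hE1).matrix_adjugate).matrix_trace
  obtain ⟨T, hT⟩ := (isCompact_cube d).exists_bound_of_continuousOn hinv.continuousOn
  have hq : ∀ p p', ∃ B, ∀ θ ∈ cube d, ‖qBlock μ θ p p'‖ ≤ B := fun p p' =>
    (isCompact_cube d).exists_bound_of_continuousOn
      ((continuous_qBlock hsum).matrix_elem p p').continuousOn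
  choose B hB using hq
  set D : ℝ := 1 + n * Real.sqrt T with hD
  have hD0 : 0 ≤ D := by positivity
  have hOm : ∀ θ ∈ cube d, ∀ (a : Fin 2) k l, ‖((Om V θ)⁻¹ ^ (a : ℕ)) k l‖ ≤ D := by
    intro θ hθ a k l
    fin_cases a
    · refine le_trans ?_ (le_add_of_nonneg_right (by positivity))
      by_cases hkl : k = l <;> simp [hkl]
    · refine le_trans ?_ (le_add_of_nonneg_left zero_le_one)
      change ‖((Om V θ)⁻¹ ^ 1) k l‖ ≤ _
      rw [pow_one, Om, inv_cfc_sqrt (hV θ) (hpos θ)]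
      refine norm_cfc_apply_le (hV θ) (fun r hr => ?_) k l
      rw [abs_of_nonneg (by positivity), ← Real.sqrt_inv]
      refine Real.sqrt_le_sqrt (le_trans ?_ (hT θ hθ))
      rw [inv_eq_cfc (hV θ) (hpos θ)]
      exact le_norm_trace_cfc (hV θ) (f := fun x => x⁻¹)
        (fun r hr => (inv_pos.2 (hpos θ r hr)).le) hr
  refine ⟨fun _ => ∑ a : Fin 2, ∑ b : Fin 2, ∑ k : Fin n, ∑ l : Fin n,
    D * D * ∑ x, ∑ y, B (a, x) (b, y), integrableOn_const (isCompact_cube d).measure_lt_top.ne,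
    fun θ hθ => ?_⟩
  refine Finset.sum_le_sum fun a _ => Finset.sum_le_sum fun b _ => Finset.sum_le_sum fun k _ =>
    Finset.sum_le_sum fun l _ => ?_
  refine (norm_mul_mul_apply_le hD0 (hOm θ hθ a) (hOm θ hθ b) _ k l).trans ?_
  gcongr
  exact hB _ _ θ hθ

/-- All amplitudes are dominated by an integrable function. -/
lemma exists_modeAmp_bound (hE1 : CondE1 V) (hE3 : CondE3 V)
    (hV : ∀ θ, (torusFourier V θ).IsHermitian)
    (hsum : ∀ i j k l, Summable fun z : Site d => |corrDiff μ i j z k l|)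
    (hES : (∃ θ, (torusFourier V θ).det = 0) → CondES V μ) :
    ∃ G : (Fin d → ℝ) → ℝ, IntegrableOn G (cube d) ∧ ∀ θ ∈ cube d, (torusFourier V θ).det ≠ 0 →
      ∀ ε ε' : ℤˣ, ∀ r ∈ eigSet (hV θ), ∀ r' ∈ eigSet (hV θ), ∀ p p',
        ‖modeAmp (torusFourier V θ) (qBlock μ θ) ε ε' r r' p p'‖ ≤ G θ := by
  obtain ⟨g, hg, hle⟩ := exists_integrableOn_bound hE1 hE3 hsum hES
  obtain ⟨C, hC⟩ := exists_eigSet_le hE1 hE3 hV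
  refine ⟨fun θ => (1 + Real.sqrt C) * (1 + Real.sqrt C) * g θ, hg.const_mul _, ?_⟩
  intro θ hθ hdet ε ε' r hr r' hr' p p'
  refine (norm_modeAmp_apply_le (hV θ) (fun r hr => pos_of_mem_eigSet hE3 hV hdet hr)
    (qBlock μ θ) ε ε' hr hr' p p').trans ?_
  change _ ≤ (1 + Real.sqrt C) * (1 + Real.sqrt C) * g θ
  gcongr
  · exact hC θ hθ r hr
  · exact hC θ hθ r' hr'
  · exact hle θ hθ

end Bounds

/-! ### The spectral density as a superposition of oscillating terms -/

section Expansion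

/-- The labels `(ε, r)` of the normal modes: the mode has the frequency `ε √r`, where `r` is an
eigenvalue of the matrix of force constants. -/
def modes {A : Matrix (Fin n) (Fin n) ℂ} (hA : A.IsHermitian) : Finset (ℤˣ × ℝ) :=
  Finset.univ ×ˢ eigSet hA

lemma mem_eigSet_of_mem_modes {A : Matrix (Fin n) (Fin n) ℂ} {hA : A.IsHermitian} {m : ℤˣ × ℝ}
    (hm : m ∈ modes hA) : m.2 ∈ eigSet hA := (Finset.mem_product.1 hm).2

variable {V : Interaction d n} {μ : Measure (PhaseSpace d n α)}
  {hV : ∀ θ, (torusFourier V θ).IsHermitian} {θ : Fin d → ℝ}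

/-- The spectral density at time `t` as a superposition of oscillating terms, indexed by the pairs of
normal modes. -/
lemma qBlockAt_apply_eq_sum (hpos : ∀ r ∈ eigSet (hV θ), 0 < r) (t : ℝ) (p p' : Fin 2 × Fin n) :
    qBlockAt V μ t θ p p' = ∑ m ∈ modes (hV θ), ∑ m' ∈ modes (hV θ),
      Complex.exp (Complex.I * ((t * (((m.1 : ℤ) : ℝ) * Real.sqrt m.2
        - ((m'.1 : ℤ) : ℝ) * Real.sqrt m'.2) : ℝ) : ℂ)) *
        modeAmp (torusFourier V θ) (qBlock μ θ) m.1 m'.1 m.2 m'.2 p p' := by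
  rw [qBlockAt, symbol_eq_generator, exp_mul_mul_exp_eq (hV θ) hpos]
  simp only [modes, Finset.sum_product_right, Matrix.sum_apply, Matrix.smul_apply, smul_eq_mul]

lemma qInfHat_apply_eq_sum_modes (hpos : ∀ r ∈ eigSet (hV θ), 0 < r) (i j : Fin 2) (k l : Fin n) :
    qInfHat V μ i j θ k l = ∑ m ∈ modes (hV θ),
      modeAmp (torusFourier V θ) (qBlock μ θ) m.1 m.1 m.2 m.2 (i, k) (j, l) := by
  rw [qInfHat_apply_eq_sum hpos, modes, Finset.sum_product_right]

lemma qBlockAt_sub_qInfHat (hpos : ∀ r ∈ eigSet (hV θ), 0 < r) (t : ℝ) (i j : Fin 2) (k l : Fin n) :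
    qBlockAt V μ t θ (i, k) (j, l) - qInfHat V μ i j θ k l =
      ∑ m ∈ modes (hV θ), ∑ m' ∈ modes (hV θ),
        if m = m' then 0 else Complex.exp (Complex.I * ((t * (((m.1 : ℤ) : ℝ) * Real.sqrt m.2
          - ((m'.1 : ℤ) : ℝ) * Real.sqrt m'.2) : ℝ) : ℂ)) *
          modeAmp (torusFourier V θ) (qBlock μ θ) m.1 m'.1 m.2 m'.2 (i, k) (j, l) := by
  rw [qBlockAt_apply_eq_sum hpos, qInfHat_apply_eq_sum_modes hpos,
    ← Finset.sum_sub_distrib]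
  refine Finset.sum_congr rfl fun m hm => ?_
  rw [sub_eq_iff_eq_add, ← Finset.sum_erase_add _ _ hm, ← Finset.sum_erase_add (modes _) (fun m' => ite (m = m') _ _) hm]
  rw [if_pos rfl, add_zero]
  congr 1
  · refine Finset.sum_congr rfl fun m' hm' => ?_
    rw [if_neg (Finset.ne_of_mem_erase hm').symm]
  · simp

lemma norm_qBlockAt_apply_le (hpos : ∀ r ∈ eigSet (hV θ), 0 < r) {C : ℝ} (hC : 0 ≤ C)
    {p p' : Fin 2 × Fin n} (h : ∀ ε ε' : ℤˣ, ∀ r ∈ eigSet (hV θ), ∀ r' ∈ eigSet (hV θ),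
      ‖modeAmp (torusFourier V θ) (qBlock μ θ) ε ε' r r' p p'‖ ≤ C) (t : ℝ) :
    ‖qBlockAt V μ t θ p p'‖ ≤ (2 * n) * ((2 * n) * C) := by
  have hcard : ((modes (hV θ)).card : ℝ) ≤ 2 * n := by
    have h1 : (Finset.univ : Finset ℤˣ).card = 2 := rfl
    rw [modes, Finset.card_product, h1]
    exact_mod_cast Nat.mul_le_mul_left 2 (card_eigSet_le (hV θ))
  rw [qBlockAt_apply_eq_sum hpos]
  refine (norm_sum_le _ _).trans ((Finset.sum_le_card_nsmul _ _ ((2 * n) * C) fun m hm => ?_).trans ?_)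
  · refine (norm_sum_le _ _).trans ((Finset.sum_le_card_nsmul _ _ C fun m' hm' => ?_).trans ?_)
    · rw [norm_mul, norm_exp_I_mul, one_mul]
      exact h _ _ _ (mem_eigSet_of_mem_modes hm) _ (mem_eigSet_of_mem_modes hm')
    · rw [nsmul_eq_mul]
      gcongr
  · rw [nsmul_eq_mul]
    gcongr

lemma norm_qInfHat_apply_le (hpos : ∀ r ∈ eigSet (hV θ), 0 < r) {C : ℝ} (hC : 0 ≤ C)
    {i j : Fin 2} {k l : Fin n} (h : ∀ ε ε' : ℤˣ, ∀ r ∈ eigSet (hV θ), ∀ r' ∈ eigSet (hV θ),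
      ‖modeAmp (torusFourier V θ) (qBlock μ θ) ε ε' r r' (i, k) (j, l)‖ ≤ C) :
    ‖qInfHat V μ i j θ k l‖ ≤ n * (2 * C) := by
  rw [qInfHat_apply_eq_sum hpos]
  refine (norm_sum_le _ _).trans ((Finset.sum_le_card_nsmul _ _ (2 * C) fun r hr => ?_).trans ?_)
  · refine (norm_sum_le _ _).trans ((Finset.sum_le_card_nsmul _ _ C fun ε _ =>
      h ε ε r hr r hr).trans (le_of_eq ?_))
    rw [nsmul_eq_mul]
    rfl
  · rw [nsmul_eq_mul]
    gcongr
    exact card_eigSet_le (hV θ)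

end Expansion

/-! ### Convergence of the covariances -/

section Convergence

variable {V : Interaction d n} {μ : Measure (PhaseSpace d n α)}
  {hV : ∀ θ, (torusFourier V θ).IsHermitian} {O : Set (Fin d → ℝ)} {θ₀ : Fin d → ℝ}
  {ψ : ℝ → (Fin d → ℝ) → ℝ}

lemma EigenBranches.sum_eq {M : Type*} [AddCommMonoid M] (h : EigenBranches hV O θ₀ ψ)
    {θ : Fin d → ℝ} (hθ : θ ∈ O) (F : ℤˣ × ℝ → M) :
    ∑ m ∈ modes (hV θ), F m
      = ∑ m ∈ modes (hV θ₀), F (m.1, ψ m.2 θ) := by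
  rw [modes, modes, Finset.sum_product, Finset.sum_product]
  refine Finset.sum_congr rfl fun ε _ => ?_
  rw [h.image_eq θ hθ, Finset.sum_image (h.injOn θ hθ)]

lemma integrableOn_of_continuousOn_of_le {f : (Fin d → ℝ) → ℂ} {G : (Fin d → ℝ) → ℝ}
    {O A B : Set (Fin d → ℝ)} (hf : ContinuousOn f O) (hA : MeasurableSet A) (hO : A ⊆ O)
    (hB : A ⊆ B) (hG : IntegrableOn G B) (hle : ∀ θ ∈ A, ‖f θ‖ ≤ G θ) : IntegrableOn f A :=
  Integrable.mono' (hG.mono_set hB) ((hf.mono hO).aestronglyMeasurable hA)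
    ((ae_restrict_iff' hA).2 (Eventually.of_forall hle))

/-- Near a regular point the nonresonant terms average out. -/
lemma EigenBranches.tendsto_integral_sub (hd : 1 ≤ d) (hE1 : CondE1 V) (hE3 : CondE3 V)
    (hE4 : CondE4 V) (hE5 : CondE5 V)
    (hsum : ∀ i j k l, Summable fun z : Site d => |corrDiff μ i j z k l|)
    {G : (Fin d → ℝ) → ℝ} (hG : IntegrableOn G (cube d))
    (hle : ∀ θ ∈ cube d, (torusFourier V θ).det ≠ 0 → ∀ ε ε' : ℤˣ, ∀ r ∈ eigSet (hV θ),
      ∀ r' ∈ eigSet (hV θ), ∀ p p',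
        ‖modeAmp (torusFourier V θ) (qBlock μ θ) ε ε' r r' p p'‖ ≤ G θ)
    (h : EigenBranches hV O θ₀ ψ) (hdet : ∀ θ ∈ O, (torusFourier V θ).det ≠ 0)
    {A : Set (Fin d → ℝ)} (hA : MeasurableSet A) (hAO : A ⊆ O) (hAc : A ⊆ cube d)
    (z : Site d) (i j : Fin 2) (k l : Fin n) :
    Tendsto (fun t : ℝ => ∫ θ in A, Complex.exp (-(Complex.I * (phase z θ : ℂ))) *
      (qBlockAt V μ t θ (i, k) (j, l) - qInfHat V μ i j θ k l)) atTop (𝓝 0) := by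
  set M : Finset (ℤˣ × ℝ) := modes (hV θ₀) with hM
  have hMS : ∀ m ∈ M, m.2 ∈ eigSet (hV θ₀) := fun m hm => mem_eigSet_of_mem_modes hm
  set φ : ℤˣ × ℝ → ℤˣ × ℝ → (Fin d → ℝ) → ℝ := fun m m' θ =>
    ((m.1 : ℤ) : ℝ) * Real.sqrt (ψ m.2 θ) - ((m'.1 : ℤ) : ℝ) * Real.sqrt (ψ m'.2 θ) with hφ
  set a : ℤˣ × ℝ → ℤˣ × ℝ → (Fin d → ℝ) → ℂ := fun m m' θ =>
    Complex.exp (-(Complex.I * (phase z θ : ℂ))) *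
      modeAmp (torusFourier V θ) (qBlock μ θ) m.1 m'.1 (ψ m.2 θ) (ψ m'.2 θ) (i, k) (j, l) with ha
  have hφan : ∀ m ∈ M, ∀ m' ∈ M, AnalyticOnNhd ℝ (φ m m') O := fun m hm m' hm' θ hθ =>
    (analyticAt_const.mul (h.analyticOnNhd_sqrt hE3 hdet (hMS m hm) θ hθ)).sub
      (analyticAt_const.mul (h.analyticOnNhd_sqrt hE3 hdet (hMS m' hm') θ hθ))
  have hac : ∀ m ∈ M, ∀ m' ∈ M, ContinuousOn (a m m') O := fun m hm m' hm' =>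
    (by fun_prop : Continuous fun θ : Fin d → ℝ =>
      Complex.exp (-(Complex.I * (phase z θ : ℂ)))).continuousOn.mul
      (h.continuousOn_modeAmp (continuous_torusFourier hE1).continuousOn
        (continuous_qBlock hsum).continuousOn _ _ (hMS m hm) (hMS m' hm')
        (fun θ hθ => h.pos hE3 hdet hθ (hMS m hm)) (fun θ hθ => h.pos hE3 hdet hθ (hMS m' hm')) _ _)
  have hale : ∀ m ∈ M, ∀ m' ∈ M, ∀ θ ∈ A, ‖a m m' θ‖ ≤ G θ := by
    intro m hm m' hm' θ hθ
    have hmem : ∀ m ∈ M, ψ m.2 θ ∈ eigSet (hV θ) := fun m hm => by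
      rw [h.image_eq θ (hAO hθ)]
      exact Finset.mem_image_of_mem _ (hMS m hm)
    rw [ha, norm_mul, norm_exp_neg_I_mul, one_mul]
    exact hle θ (hAc hθ) (hdet θ (hAO hθ)) _ _ _ (hmem m hm) _ (hmem m' hm') _ _
  have hint : ∀ m ∈ M, ∀ m' ∈ M, IntegrableOn (a m m') A := fun m hm m' hm' =>
    integrableOn_of_continuousOn_of_le (hac m hm m' hm') hA hAO hAc hG (hale m hm m' hm')
  have hinte : ∀ t : ℝ, ∀ m ∈ M, ∀ m' ∈ M, IntegrableOn (fun θ =>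
      Complex.exp (Complex.I * ((t * φ m m' θ : ℝ) : ℂ)) * a m m' θ) A := by
    intro t m hm m' hm'
    refine integrableOn_of_continuousOn_of_le (O := O) ?_ hA hAO hAc hG fun θ hθ => ?_
    · refine ContinuousOn.mul ?_ (hac m hm m' hm')
      have := (hφan m hm m' hm').continuousOn
      fun_prop
    · rw [norm_mul, norm_exp_I_mul, one_mul]
      exact hale m hm m' hm' θ hθ
  have hexp : ∀ t : ℝ, ∫ θ in A, Complex.exp (-(Complex.I * (phase z θ : ℂ))) *
      (qBlockAt V μ t θ (i, k) (j, l) - qInfHat V μ i j θ k l) =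
      ∑ m ∈ M, ∑ m' ∈ M, if m = m' then 0 else
        ∫ θ in A, Complex.exp (Complex.I * ((t * φ m m' θ : ℝ) : ℂ)) * a m m' θ := by
    intro t
    have h1 : ∀ θ ∈ A, Complex.exp (-(Complex.I * (phase z θ : ℂ))) *
        (qBlockAt V μ t θ (i, k) (j, l) - qInfHat V μ i j θ k l) =
        ∑ m ∈ M, ∑ m' ∈ M, if m = m' then 0 else
          Complex.exp (Complex.I * ((t * φ m m' θ : ℝ) : ℂ)) * a m m' θ := by
      intro θ hθ
      rw [qBlockAt_sub_qInfHat (hV := hV)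
        (fun r hr => pos_of_mem_eigSet hE3 hV (hdet θ (hAO hθ)) hr), h.sum_eq (hAO hθ), Finset.mul_sum]
      refine Finset.sum_congr rfl fun m hm => ?_
      rw [h.sum_eq (hAO hθ), Finset.mul_sum]
      refine Finset.sum_congr rfl fun m' hm' => ?_
      by_cases hmm : m = m'
      · simp [hmm]
      · rw [if_neg hmm, if_neg]
        · simp only [hφ, ha]
          ring
        · rintro heq
          obtain ⟨h2, h3⟩ := Prod.ext_iff.1 heq
          exact hmm (Prod.ext h2 (h.injOn θ (hAO hθ) (hMS m hm) (hMS m' hm') h3))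
    rw [setIntegral_congr_fun hA h1]
    have h4 : ∀ m ∈ M, ∀ m' ∈ M, IntegrableOn (fun θ => if m = m' then 0 else
        Complex.exp (Complex.I * ((t * φ m m' θ : ℝ) : ℂ)) * a m m' θ) A := by
      intro m hm m' hm'
      split_ifs
      · exact integrable_zero _ _ _
      · exact hinte t m hm m' hm'
    rw [integral_finsetSum _ fun m hm => integrable_finsetSum _ (h4 m hm)]
    refine Finset.sum_congr rfl fun m hm => ?_
    rw [integral_finsetSum _ (h4 m hm)]
    refine Finset.sum_congr rfl fun m' hm' => ?_
    split_ifs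
    · simp
    · rfl
  simp_rw [hexp]
  rw [show (0 : ℂ) = ∑ m ∈ M, ∑ m' ∈ M, 0 by simp]
  refine tendsto_finsetSum _ fun m hm => tendsto_finsetSum _ fun m' hm' => ?_
  by_cases hmm : m = m'
  · simp [hmm]
  · simp only [if_neg hmm]
    obtain ⟨θ₁, h₁, hne⟩ := h.exists_phase_ne hd hE3 hE4 hE5 hdet (hMS m hm) (hMS m' hm')
      (ε := m.1) (ε' := m'.1) hmm
    exact tendsto_oscillatory_integral h.isOpen h.convex (hφan m hm m' hm') h₁ h.mem hne hAO
      (hint m hm m' hm')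

/-- Localization of the convergence to zero of the integrals of a dominated family. -/
lemma tendsto_setIntegral_of_forall_subset {X : Type*} [MeasurableSpace X] {ν : Measure X}
    {F : ℝ → X → ℂ} {G : X → ℝ} {Q : Set X} {O : ℕ → Set X} (hQ : MeasurableSet Q)
    (hO : ∀ k, MeasurableSet (O k)) (hnull : ν (⋃ k, O k)ᶜ = 0)
    (hF : ∀ t, IntegrableOn (F t) Q ν) (hG : IntegrableOn G Q ν)
    (hle : ∀ t, ∀ k, ∀ x ∈ O k, x ∈ Q → ‖F t x‖ ≤ G x)
    (hloc : ∀ k A, MeasurableSet A → A ⊆ O k → A ⊆ Q →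
      Tendsto (fun t => ∫ x in A, F t x ∂ν) atTop (𝓝 0)) :
    Tendsto (fun t => ∫ x in Q, F t x ∂ν) atTop (𝓝 0) := by
  set A : ℕ → Set X := disjointed fun k => Q ∩ O k with hAdef
  have hAm : ∀ k, MeasurableSet (A k) := fun k => MeasurableSet.disjointed
    (fun k => hQ.inter (hO k)) k
  have hAsub : ∀ k, A k ⊆ Q ∩ O k := fun k => disjointed_subset _ k
  have hAU : ⋃ k, A k = Q ∩ ⋃ k, O k := by
    rw [hAdef, iUnion_disjointed, Set.inter_iUnion]
  have hAQ : (⋃ k, A k) ⊆ Q := hAU ▸ Set.inter_subset_left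
  have hae : (⋃ k, A k : Set X) =ᵐ[ν] Q := by
    rw [hAU]
    exact inter_ae_eq_left_of_ae_eq_univ (ae_eq_univ.2 hnull)
  have hdisj : Pairwise (Function.onFun Disjoint A) := disjoint_disjointed _
  have hsum : ∀ t, ∫ x in Q, F t x ∂ν = ∑' k, ∫ x in A k, F t x ∂ν := fun t => by
    rw [← setIntegral_congr_set hae]
    exact integral_iUnion hAm hdisj ((hF t).mono_set hAQ)
  simp_rw [hsum]
  have hGsum : Summable fun k => ∫ x in A k, G x ∂ν :=
    (hasSum_integral_iUnion hAm hdisj (hG.mono_set hAQ)).summable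
  rw [show (0 : ℂ) = ∑' _ : ℕ, 0 by simp]
  refine tendsto_tsum_of_dominated_convergence hGsum (fun k => ?_) (Eventually.of_forall fun t k => ?_)
  · exact hloc k (A k) (hAm k) ((hAsub k).trans Set.inter_subset_right)
      ((hAsub k).trans Set.inter_subset_left)
  · refine norm_integral_le_of_norm_le (hG.mono_set ((hAsub k).trans Set.inter_subset_left)) ?_
    exact (ae_restrict_iff' (hAm k)).2 (Eventually.of_forall fun x hx =>
      hle t k x (hAsub k hx).2 (hAsub k hx).1)

end Convergence

section Limit

variable {V : Interaction d n} {μ : Measure (PhaseSpace d n α)}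
  {hV : ∀ θ, (torusFourier V θ).IsHermitian}

/-- Almost all of the torus is covered by countably many regions with invertible analytic eigenvalue
branches. -/
lemma exists_cover (hd : 1 ≤ d) (hE1 : CondE1 V) (hE3 : CondE3 V) (hE4 : CondE4 V)
    (hV : ∀ θ, (torusFourier V θ).IsHermitian) :
    ∃ (O : ℕ → Set (Fin d → ℝ)) (c : ℕ → Fin d → ℝ) (ψ : ℕ → ℝ → (Fin d → ℝ) → ℝ),
      (∀ k, EigenBranches hV (O k) (c k) (ψ k)) ∧
      (∀ k, ∀ θ ∈ O k, (torusFourier V θ).det ≠ 0) ∧ volume (⋃ k, O k)ᶜ = 0 := by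
  have hnull := volume_compl_regularSet (hV := hV) hd hE1 hE3 hE4
  have hloc : ∀ θ₀ ∈ regularSet hV, ∃ O ψ, EigenBranches hV O θ₀ ψ ∧
      ∀ θ ∈ O, (torusFourier V θ).det ≠ 0 := fun θ₀ h => exists_eigenBranches_of_mem_regularSet hE1 h
  choose! O ψ hbr hdet using hloc
  obtain ⟨T, hTsub, hT, hcov⟩ := TopologicalSpace.countable_cover_nhdsWithin
    (f := O) (s := regularSet hV) fun θ hθ =>
      mem_nhdsWithin_of_mem_nhds ((hbr θ hθ).isOpen.mem_nhds (hbr θ hθ).mem)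
  have hne : T.Nonempty := by
    by_contra h
    rw [Set.not_nonempty_iff_eq_empty] at h
    subst h
    simp only [Set.mem_empty_iff_false, Set.iUnion_of_empty, Set.iUnion_empty,
      Set.subset_empty_iff] at hcov
    rw [hcov, Set.compl_empty, Measure.measure_univ_eq_zero] at hnull
    exact NeZero.ne _ hnull
  obtain ⟨c, rfl⟩ := hT.exists_eq_range hne
  have hc : ∀ k, c k ∈ regularSet hV := fun k => hTsub ⟨k, rfl⟩
  refine ⟨fun k => O (c k), c, fun k => ψ (c k), fun k => hbr _ (hc k), fun k => hdet _ (hc k), ?_⟩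
  refine measure_mono_null (Set.compl_subset_compl.2 fun θ hθ => ?_) hnull
  simpa using hcov hθ

lemma EigenBranches.continuousOn_qInfHat {O : Set (Fin d → ℝ)} {θ₀ : Fin d → ℝ}
    {ψ : ℝ → (Fin d → ℝ) → ℝ} (hE1 : CondE1 V) (hE3 : CondE3 V)
    (hsum : ∀ i j k l, Summable fun z : Site d => |corrDiff μ i j z k l|)
    (h : EigenBranches hV O θ₀ ψ) (hdet : ∀ θ ∈ O, (torusFourier V θ).det ≠ 0)
    (i j : Fin 2) (k l : Fin n) : ContinuousOn (fun θ => qInfHat V μ i j θ k l) O := by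
  have hpos : ∀ r ∈ eigSet (hV θ₀), ∀ θ ∈ O, 0 < ψ r θ := fun r hr θ hθ => h.pos hE3 hdet hθ hr
  have h1 : ContinuousOn (fun θ => ∑ m ∈ modes (hV θ₀), modeAmp (torusFourier V θ) (qBlock μ θ)
      m.1 m.1 (ψ m.2 θ) (ψ m.2 θ) (i, k) (j, l)) O :=
    continuousOn_finsetSum _ fun m hm =>
      h.continuousOn_modeAmp (continuous_torusFourier hE1).continuousOn
        (continuous_qBlock hsum).continuousOn _ _ (mem_eigSet_of_mem_modes hm)
        (mem_eigSet_of_mem_modes hm) (hpos _ (mem_eigSet_of_mem_modes hm))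
        (hpos _ (mem_eigSet_of_mem_modes hm)) _ _
  refine h1.congr fun θ hθ => ?_
  rw [qInfHat_apply_eq_sum_modes (hV := hV) fun r hr => pos_of_mem_eigSet hE3 hV (hdet θ hθ) hr,
    h.sum_eq hθ]

/-- The spectral densities are dominated by an integrable function, and the integrals of
`e^{-i z·θ} (q̂_t - q̂_∞)` over the torus converge to zero. -/
lemma exists_bound_and_tendsto (hd : 1 ≤ d) (hE1 : CondE1 V) (hE3 : CondE3 V) (hE4 : CondE4 V)
    (hE5 : CondE5 V) (hsum : ∀ i j k l, Summable fun z : Site d => |corrDiff μ i j z k l|)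
    (hES : (∃ θ, (torusFourier V θ).det = 0) → CondES V μ) :
    (∃ C : ℝ, ∀ t p p', ∫ θ in cube d, ‖qBlockAt V μ t θ p p'‖ ≤ C) ∧
    (∀ i j k l, IntegrableOn (fun θ => qInfHat V μ i j θ k l) (cube d)) ∧
    ∀ z i j k l, Tendsto (fun t : ℝ => ∫ θ in cube d, Complex.exp (-(Complex.I * (phase z θ : ℂ))) *
      (qBlockAt V μ t θ (i, k) (j, l) - qInfHat V μ i j θ k l)) atTop (𝓝 0) := by
  have hV := isHermitian_torusFourier hE3
  obtain ⟨O, c, ψ, hbr, hdet, hnull⟩ := exists_cover hd hE1 hE3 hE4 hV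
  obtain ⟨G, hG, hle⟩ := exists_modeAmp_bound hE1 hE3 hV hsum hES
  have hpos : ∀ m, ∀ θ ∈ O m, ∀ r ∈ eigSet (hV θ), 0 < r := fun m θ hθ r hr =>
    pos_of_mem_eigSet hE3 hV (hdet m θ hθ) hr
  have hle' : ∀ m, ∀ θ ∈ O m, θ ∈ cube d → ∀ ε ε' : ℤˣ, ∀ r ∈ eigSet (hV θ),
      ∀ r' ∈ eigSet (hV θ), ∀ p p',
        ‖modeAmp (torusFourier V θ) (qBlock μ θ) ε ε' r r' p p'‖ ≤ |G θ| :=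
    fun m θ hθ hθc ε ε' r hr r' hr' p p' =>
      (hle θ hθc (hdet m θ hθ) ε ε' r hr r' hr' p p').trans (le_abs_self _)
  have hq : ∀ m, ∀ θ ∈ O m, θ ∈ cube d → ∀ t p p',
      ‖qBlockAt V μ t θ p p'‖ ≤ (2 * n) * ((2 * n) * |G θ|) := fun m θ hθ hθc t p p' =>
    norm_qBlockAt_apply_le (hV := hV) (hpos m θ hθ) (abs_nonneg _)
      (fun ε ε' r hr r' hr' => hle' m θ hθ hθc ε ε' r hr r' hr' p p') t
  have hqInf : ∀ m, ∀ θ ∈ O m, θ ∈ cube d → ∀ i j k l,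
      ‖qInfHat V μ i j θ k l‖ ≤ n * (2 * |G θ|) := fun m θ hθ hθc i j k l =>
    norm_qInfHat_apply_le (hV := hV) (hpos m θ hθ) (abs_nonneg _)
      (fun ε ε' r hr r' hr' => hle' m θ hθ hθc ε ε' r hr r' hr' _ _)
  have hae : ∀ {P : (Fin d → ℝ) → Prop}, (∀ m, ∀ θ ∈ O m, θ ∈ cube d → P θ) →
      ∀ᵐ θ ∂volume.restrict (cube d), P θ := by
    intro P hP
    have h1 : ∀ᵐ θ ∂(volume : Measure (Fin d → ℝ)), θ ∈ ⋃ m, O m :=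
      measure_eq_zero_iff_ae_notMem.1 hnull |>.mono fun θ h => not_not.1 h
    refine (ae_restrict_iff' measurableSet_Icc).2 ?_
    filter_upwards [h1] with θ hθ hθc
    obtain ⟨m, hm⟩ := Set.mem_iUnion.1 hθ
    exact hP m θ hm hθc
  have hG1 : IntegrableOn (fun θ => (2 * n) * ((2 * n) * |G θ|)) (cube d) :=
    (hG.abs.const_mul _).const_mul _
  have hG2 : IntegrableOn (fun θ => n * (2 * |G θ|)) (cube d) := (hG.abs.const_mul _).const_mul _
  have hqInfInt : ∀ i j k l, IntegrableOn (fun θ => qInfHat V μ i j θ k l) (cube d) := by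
    intro i j k l
    have hmeas : AEStronglyMeasurable (fun θ => qInfHat V μ i j θ k l) volume := by
      have h1 : AEStronglyMeasurable (fun θ => qInfHat V μ i j θ k l)
          (volume.restrict (⋃ m, O m)) :=
        AEStronglyMeasurable.iUnion fun m =>
          ((hbr m).continuousOn_qInfHat hE1 hE3 hsum (hdet m) i j k l).aestronglyMeasurable
            (hbr m).isOpen.measurableSet
      rwa [Measure.restrict_congr_set (ae_eq_univ.2 hnull), Measure.restrict_univ] at h1
    exact hG2.mono' hmeas.restrict (hae fun m θ hθ hθc => hqInf m θ hθ hθc i j k l)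
  refine ⟨⟨∫ θ in cube d, (2 * n) * ((2 * n) * |G θ|), fun t p p' => ?_⟩, hqInfInt, ?_⟩
  · exact integral_mono_ae
      (integrableOn_cube ((continuous_qBlockAt hE1 hsum t).matrix_elem p p')).norm hG1
      (hae fun m θ hθ hθc => hq m θ hθ hθc t p p')
  · intro z i j k l
    refine tendsto_setIntegral_of_forall_subset measurableSet_Icc
      (fun m => (hbr m).isOpen.measurableSet) hnull (fun t => ?_) (hG1.add hG2) ?_ ?_
    · have h1 : Continuous fun θ : Fin d → ℝ => Complex.exp (-(Complex.I * (phase z θ : ℂ))) := by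
        fun_prop
      refine ((integrableOn_cube ((continuous_qBlockAt hE1 hsum t).matrix_elem _ _)).sub
        (hqInfInt i j k l)).bdd_mul h1.aestronglyMeasurable (c := 1)
        (Eventually.of_forall fun θ => (norm_exp_neg_I_mul _).le)
    · intro t m θ hθ hθc
      rw [norm_mul, norm_exp_neg_I_mul, one_mul]
      exact (norm_sub_le _ _).trans (add_le_add (hq m θ hθ hθc t _ _) (hqInf m θ hθ hθc i j k l))
    · intro m A hA hAO hAc
      exact (hbr m).tendsto_integral_sub hd hE1 hE3 hE4 hE5 hsum hG hle (hdet m) hA hAO hAc z i j k l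

end Limit

end HarmonicCrystal

end

open HarmonicCrystal
theorem proposition3p2 (d n : ℕ) (hd : 1 ≤ d) (hn : 1 ≤ n) (α : ℝ)
    (V : Interaction d n)
    (hE1 : CondE1 V) (hE2 : CondE2 V) (hE3 : CondE3 V) (hE4 : CondE4 V) (hE5 : CondE5 V)
    (μ₀ : Measure (PhaseSpace d n α)) [IsProbabilityMeasure μ₀]
    (hS0 : CondS0 μ₀) (hS1 : CondS1 μ₀) (hS2 : CondS2 μ₀) (hS3 : CondS3 μ₀)
    (hES : (∃ θ, (torusFourier V θ).det = 0) → CondES V μ₀) :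
    -- the correlations of `μ_t` are finite and depend on `x - y` only
    (∀ (t : ℝ) (i j : Fin 2) (x y : Site d),
      (∀ k l, Integrable (fun Y : PhaseSpace d n α => Y x (i, k) * Y y (j, l)) (law V μ₀ t)) ∧
      corr (law V μ₀ t) i j x y = corrDiff (law V μ₀ t) i j (x - y)) ∧
    -- uniform bound
    (∃ C : ℝ, ∀ t : ℝ, 0 ≤ t → ∀ (i j : Fin 2) (z : Site d) (k l : Fin n),
      |corrDiff (law V μ₀ t) i j z k l| ≤ C) ∧
    -- the limit functions are well defined
    (∀ (i j : Fin 2) (k l : Fin n),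
      IntegrableOn (fun θ => qInfHat V μ₀ i j θ k l) (cube d)) ∧
    -- convergence
    (∀ (i j : Fin 2) (z : Site d),
      Tendsto (fun t : ℝ => (corrDiff (law V μ₀ t) i j z).map Complex.ofReal) atTop
        (𝓝 (qInf V μ₀ i j z))) := by
  have hsum := summable_corrDiff hd hS0 hS1 hS2 hS3
  have hcorr := fun t x p y q => integrable_and_correlation_eq hE1 hS1 hS2 hsum t x p y q
  have hdiff : ∀ t i j z k l, ((corrDiff (law V μ₀ t) i j z k l : ℝ) : ℂ) = torusAvg fun θ =>
      Complex.exp (-(Complex.I * (phase z θ : ℂ))) * qBlockAt V μ₀ t θ (i, k) (j, l) := by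
    intro t i j z k l
    have h := (hcorr t z (i, k) 0 (j, l)).2
    rwa [sub_zero] at h
  obtain ⟨⟨C, hC⟩, hint, hlim⟩ := exists_bound_and_tendsto hd hE1 hE3 hE4 hE5 hsum hES
  refine ⟨fun t i j x y => ⟨fun k l => (hcorr t x (i, k) y (j, l)).1, ?_⟩, ?_, hint, ?_⟩
  · ext k l
    have h := (hcorr t x (i, k) y (j, l)).2
    rw [← hdiff t i j (x - y) k l] at h
    exact_mod_cast h
  · refine ⟨‖((2 * Real.pi : ℝ) ^ d : ℂ)⁻¹‖ * C, fun t _ i j z k l => ?_⟩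
    rw [← Real.norm_eq_abs, ← Complex.norm_real, hdiff, torusAvg, norm_mul]
    gcongr
    refine (norm_integral_le_integral_norm _).trans (le_trans (le_of_eq ?_) (hC t (i, k) (j, l)))
    simp only [norm_mul, norm_exp_neg_I_mul, one_mul]
  · intro i j z
    refine tendsto_pi_nhds.2 fun k => tendsto_pi_nhds.2 fun l => ?_
    have h := ((hlim z i j k l).const_mul (((2 * Real.pi : ℝ) ^ d : ℂ)⁻¹)).add_const
      (qInf V μ₀ i j z k l)
    rw [mul_zero, zero_add] at h
    refine h.congr fun t => ?_
    have hcont : Continuous fun θ : Fin d → ℝ => Complex.exp (-(Complex.I * (phase z θ : ℂ))) := by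
      fun_prop
    have hI1 : IntegrableOn (fun θ => Complex.exp (-(Complex.I * (phase z θ : ℂ))) *
        qBlockAt V μ₀ t θ (i, k) (j, l)) (cube d) :=
      integrableOn_cube (hcont.mul ((continuous_qBlockAt hE1 hsum t).matrix_elem _ _))
    have hI2 : IntegrableOn (fun θ => Complex.exp (-(Complex.I * (phase z θ : ℂ))) *
        qInfHat V μ₀ i j θ k l) (cube d) :=
      (hint i j k l).bdd_mul hcont.aestronglyMeasurable (c := 1)
        (Eventually.of_forall fun θ => (norm_exp_neg_I_mul _).le)
    rw [Matrix.map_apply]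
    refine Eq.trans ?_ (hdiff t i j z k l).symm
    simp only [mul_sub]
    rw [integral_sub hI1 hI2, mul_sub]
    exact sub_add_cancel _ _
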